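/- Let $\nu\ge 2$ and let $L\ge 3$ be an odd integer. Let $\mathcal V=(\mathbb Z/L\mathbb Z)^\nu$ be the vertex set of the periodic hypercubic lattice, with unit vectors $\delta_1,\dots,\delta_\nu$, and let $\Lambda$ be the set of midpoints of the edges joining $\alpha$ and $\alpha+\delta_l$ ($\alpha\in\mathcal V$, $1\le l\le\nu$). For $x,y\in\Lambda$ let $|x-y|$ be the periodic Euclidean distance, and let $m(x,y)$ be the point halfway between $x$ and $y$. For real $s\ge0$, $t>0$ define the hopping amplitudes $$t_{x,y}=\begin{cases}-2s+2(\nu-1)t & \text{if } x=y,\\ -s & \text{if } |x-y|=1 \text{ and } m(x,y)\in\mathcal V,\\ t & \text{if } |x-y|=1 \text{ and } m(x,y)\notin\mathcal V,\\ -(s+t) & \text{if } |x-y|=\tfrac{\sqrt2}{2},\\ 0 & \text{otherwise.}\end{cases}$$ Let $c_{x,\sigma}$, $c^\dagger_{x,\sigma}$ ($x\in\Lambda$, $\sigma=\uparrow,\downarrow$) be the annihilation and creation operators on the fermionic Fock space, let $n_{x,\sigma}=c^\dagger_{x,\sigma}c_{x,\sigma}$, and for $U>0$ consider the Hubbard Hamiltonian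 $$H=\sum_{\sigma}\sum_{x,y\in\Lambda}t_{x,y}\,c^\dagger_{x,\sigma}c_{y,\sigma}+U\sum_{x\in\Lambda}n_{x,\uparrow}n_{x,\downarrow}$$ on the space of states with exactly $N_{\mathrm e}=|\mathcal V|$ electrons. Let $S^{(i)}_{\mathrm{tot}}=\frac12\sum_{x}\sum_{\sigma,\tau}c^\dagger_{x,\sigma}\mathsf p^{(i)}_{\sigma\tau}c_{x,\tau}$, with the Pauli matrices $\mathsf p^{(i)}$, be the components of the total spin, and say that a state has total spin $S_{\mathrm{tot}}\ge0$ if it is an eigenstate of $\sum_{i=1}^{3}(S^{(i)}_{\mathrm{tot}})^2$ with eigenvalue $S_{\mathrm{tot}}(S_{\mathrm{tot}}+1)$. Then for all $\nu\ge2$ and $s\ge0$ there exist $t_{\mathrm c}\ge0$ and $U_{\mathrm c}\ge0$, independent of $L$, such that for all odd $L\ge3$, all $t>t_{\mathrm c}$ and all $U>U_{\mathrm c}$ the following hold: 1. the ground-state energy (the least eigenvalue of $H$ on the $N_{\mathrm e}$-electron space) is $-2\nu s|\mathcal V|$; 2. every ground state has total spin $S_{\mathrm{tot}}=N_{\mathrm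 e}/2$, which is the largest total spin that occurs among $N_{\mathrm e}$-electron states; 3. the ground state is unique apart from the $(2S_{\mathrm{tot}}+1)$-fold degeneracy due to the spin rotation symmetry: the space of ground states has dimension $2S_{\mathrm{tot}}+1=N_{\mathrm e}+1$ and is spanned by the vectors $(S^-_{\mathrm{tot}})^k\Phi$, $0\le k\le N_{\mathrm e}$, for a single ground state $\Phi$, where $S^-_{\mathrm{tot}}=S^{(1)}_{\mathrm{tot}}-\mathrm i\,S^{(2)}_{\mathrm{tot}}$. For $s=0$ (the flat-band case) one may take $t_{\mathrm c}=U_{\mathrm c}=0$, so that 1–3 hold for all $t,U>0$. -/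

import Mathlib

noncomputable section

namespace Hubbard

/-! ### Fermionic Fock space over a finite set of modes -/

/-- The fermionic Fock space over a finite set `ι` of modes, in the occupation-number
representation: the coordinate `ψ S` is the amplitude of the configuration in which exactly the
modes in `S` are occupied. -/
abbrev Fock (ι : Type) [Fintype ι] : Type := EuclideanSpace ℂ (Finset ι)

/-- Linear operators on the Fock space; the product is composition. -/
abbrev Op (ι : Type) [Fintype ι] : Type := Module.End ℂ (Fock ι)

/-- The fermionic sign `(-1) ^ k`, where `k` is the number of modes of `S` that precede `i` in a
fixed enumeration of the modes. -/
def fermiSign {ι : Type} [Fintype ι] (i : ι) (S : Finset ι) : ℂ :=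
  (-1) ^ (S.filter fun j => Fintype.equivFin ι j < Fintype.equivFin ι i).card

/-- The annihilation operator `c_i`. -/
def annihilation {ι : Type} [Fintype ι] [DecidableEq ι] (i : ι) : Op ι where
  toFun ψ := WithLp.toLp 2 fun S => if i ∈ S then 0 else fermiSign i S * ψ (insert i S)
  map_add' φ ψ := by
    ext S
    by_cases h : i ∈ S <;> simp [h, mul_add]
  map_smul' a ψ := by
    ext S
    by_cases h : i ∈ S <;> simp [h, mul_left_comm]

/-- The creation operator `c_i†`, the adjoint of `c_i`. -/
def creation {ι : Type} [Fintype ι] [DecidableEq ι] (i : ι) : Op ι :=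
  LinearMap.adjoint (annihilation i)

/-- The operator counting the electrons. -/
def totalNumber (ι : Type) [Fintype ι] [DecidableEq ι] : Op ι :=
  ∑ i : ι, creation i * annihilation i

/-- The subspace of states with exactly `N` electrons. -/
def electronSpace (ι : Type) [Fintype ι] [DecidableEq ι] (N : ℕ) : Submodule ℂ (Fock ι) :=
  Module.End.eigenspace (totalNumber ι) (N : ℂ)

/-- `E` is the ground-state energy of `H` for `N` electrons: the least eigenvalue of `H` on the
`N`-electron space. -/
def IsGroundEnergy {ι : Type} [Fintype ι] [DecidableEq ι] (H : Op ι) (N : ℕ) (E : ℝ) : Prop :=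
  IsLeast {E' : ℝ | ∃ ψ ∈ electronSpace ι N, ψ ≠ 0 ∧ H ψ = (E' : ℂ) • ψ} E

/-- The `N`-electron states `ψ` with `H ψ = E ψ`. -/
def energySpace {ι : Type} [Fintype ι] [DecidableEq ι] (H : Op ι) (N : ℕ) (E : ℝ) :
    Submodule ℂ (Fock ι) :=
  electronSpace ι N ⊓ Module.End.eigenspace H (E : ℂ)

/-! ### Total spin of electrons on a finite set of sites; spin up is `0` and spin down is `1` -/

/-- The Pauli matrices. -/
def pauli : Fin 3 → Matrix (Fin 2) (Fin 2) ℂ :=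
  ![!![0, 1; 1, 0], !![0, -Complex.I; Complex.I, 0], !![1, 0; 0, -1]]

/-- The three components of the total spin. -/
def totalSpin (X : Type) [Fintype X] [DecidableEq X] (i : Fin 3) : Op (X × Fin 2) :=
  (1 / 2 : ℂ) • ∑ x : X, ∑ σ : Fin 2, ∑ τ : Fin 2,
    pauli i σ τ • (creation (x, σ) * annihilation (x, τ))

/-- The square of the total spin. -/
def totalSpinSq (X : Type) [Fintype X] [DecidableEq X] : Op (X × Fin 2) :=
  ∑ i : Fin 3, totalSpin X i ^ 2

/-- The spin lowering operator `S⁻ = S¹ - i S²`. -/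
def spinLowering (X : Type) [Fintype X] [DecidableEq X] : Op (X × Fin 2) :=
  totalSpin X 0 - Complex.I • totalSpin X 1

/-- The state `ψ` has total spin `S`, that is, `(S_tot)² ψ = S (S + 1) ψ`. -/
def HasTotalSpin {X : Type} [Fintype X] [DecidableEq X] (S : ℝ) (ψ : Fock (X × Fin 2)) : Prop :=
  totalSpinSq X ψ = ((S * (S + 1) : ℝ) : ℂ) • ψ

/-- The values of the total spin that occur for `N` electrons. -/
def spinValues (X : Type) [Fintype X] [DecidableEq X] (N : ℕ) : Set ℝ :=
  {S : ℝ | 0 ≤ S ∧ ∃ ψ ∈ electronSpace (X × Fin 2) N, ψ ≠ 0 ∧ HasTotalSpin S ψ}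

/-! ### The lattice -/

/-- Vertices of the periodic `ν`-dimensional hypercubic lattice of side length `L`. -/
abbrev Vertex (ν L : ℕ) : Type := Fin ν → ZMod L

/-- The unit vector along the `l`-axis. -/
def unitVec {ν L : ℕ} (l : Fin ν) : Vertex ν L := Pi.single l 1

/-- Lattice sites: `(α, l)` is the midpoint of the edge joining `α` and `α + unitVec l`.
For `3 ≤ L` each edge is listed exactly once. -/
abbrev Site (ν L : ℕ) : Type := Vertex ν L × Fin ν

/-- The vertex `α` is an endpoint of the edge with midpoint `x`. -/
def IsEndpoint {ν L : ℕ} (α : Vertex ν L) (x : Site ν L) : Prop :=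
  x.1 = α ∨ x.1 + unitVec x.2 = α

/-- The edges of `x` and `y` are parallel and `y` is the translate of `x` by one lattice unit
along the `j`-axis, in either direction. In particular `|x - y| = 1`; the point halfway between
`x` and `y` is a vertex precisely if `j` is the direction of the two edges. -/
def IsTranslate {ν L : ℕ} (j : Fin ν) (x y : Site ν L) : Prop :=
  x.2 = y.2 ∧ (y.1 = x.1 + unitVec j ∨ x.1 = y.1 + unitVec j)

open Classical in
/-- The hopping amplitudes `t_{x,y}`:
* the on-site term;
* `|x - y| = 1` and the point halfway between `x` and `y` is a vertex;
* `|x - y| = 1` and the point halfway between `x` and `y` is not a vertex;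
* `|x - y| = √2 / 2`, that is, two perpendicular edges with a common endpoint. -/
def hoppingAmplitude {ν L : ℕ} (s t : ℝ) (x y : Site ν L) : ℝ :=
  if x = y then -2 * s + 2 * ((ν : ℝ) - 1) * t
  else if IsTranslate x.2 x y then -s
  else if ∃ j, j ≠ x.2 ∧ IsTranslate j x y then t
  else if x.2 ≠ y.2 ∧ ∃ α, IsEndpoint α x ∧ IsEndpoint α y then -(s + t)
  else 0

/-! ### The Hamiltonian -/

/-- The single-electron modes: a site and a spin. -/
abbrev Mode (ν L : ℕ) : Type := Site ν L × Fin 2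

/-- The hopping term `∑_σ ∑_{x,y} t_{x,y} c†_{x,σ} c_{y,σ}`. -/
def hoppingTerm (ν L : ℕ) [NeZero L] (s t : ℝ) : Op (Mode ν L) :=
  ∑ σ : Fin 2, ∑ x : Site ν L, ∑ y : Site ν L,
    (hoppingAmplitude s t x y : ℂ) • (creation (x, σ) * annihilation (y, σ))

/-- The on-site interaction `U ∑_x n_{x,↑} n_{x,↓}`. -/
def interactionTerm (ν L : ℕ) [NeZero L] (U : ℝ) : Op (Mode ν L) :=
  (U : ℂ) • ∑ x : Site ν L,
    (creation (x, 0) * annihilation (x, 0)) * (creation (x, 1) * annihilation (x, 1))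

/-- The Hubbard Hamiltonian. -/
def hamiltonian (ν L : ℕ) [NeZero L] (s t U : ℝ) : Op (Mode ν L) :=
  hoppingTerm ν L s t + interactionTerm ν L U

end Hubbard

end

/-! ### Canonical anticommutation relations -/

noncomputable section
namespace Hubbard

section CAR
variable {ι : Type} [Fintype ι] [DecidableEq ι]

/-! The hopping matrix is a signed sum of squares (`hoppingAmplitude_eq`). Thus H = -s Σ a_α† a_α +
(t/2) Σ p† p + U Σ n↑n↓, where a_α belongs to the star of edges at the vertex α and p runs over the
alternating plaquette states. Only the star terms are negative, and they must be absorbed into the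
other two with constants that do not see L.

This is done star by star. Let d be the normalized star and D = `pairAnn d`. As n↑ + n↓ = 1 + n↑n↓ -
(1-n↑)(1-n↓), the occupation of d exceeds one by exactly ‖DΦ‖² - ‖D*Φ‖² (`norm_sq_pair_sub`). The
sum of the pair annihilators over an orthonormal basis is independent of the basis. Hence D plus the
pair annihilators of the other modes on the 2ν legs equals the sum over single legs, which U
controls. Modulo plaquette states each other mode equals a vector orthogonal to the plaquettes, of
squared length 1/λ with λ = ν or ν + 1 (`placed_legOp`). A sum of n orthonormal pair annihilators
has norm at most (n+1)/2 (`norm_sum_pair_le`), so these shortened modes contribute at most q =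
ν/(ν+1) + 1/(2ν), and q < 1 exactly because ν > 1. It follows that ‖DΦ‖ ≤ q‖D*Φ‖ + errors, the
errors being double occupancies and plaquette terms. Squaring and summing over the stars gives
`exists_energy_bound`.

For t, U > K s, a state with energy -2νs|V| is therefore annihilated by all plaquettes and has no
doubly occupied edge (`IsFlat`). Since L is odd, the orthogonal complement of the plaquettes has a
basis `rodVec` dual to the edges of one direction. With |V| electrons and no double occupancy, each
basis vector carries exactly one electron (`frameNumber_apply_eq`). Absence of double occupancy on
the remaining edges forces the spins of neighbouring vertices to be symmetric, and this propagates
through the lattice (`singlet_trans`, `IsFlat.singletAnn_apply`).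

All singlet annihilators then vanish, so the total spin is maximal (`totalSpinSq_eq`). The only such
state without down electrons is the filled state `allUp`, and lowering it yields the whole multiplet
(`eq_span_lower_pow`). -/

omit [DecidableEq ι] in
lemma fermiSign_mul_self (i : ι) (S : Finset ι) : fermiSign i S * fermiSign i S = 1 := by
  unfold fermiSign
  rw [← mul_pow]; simp

lemma fermiSign_insert (i j : ι) (S : Finset ι) (hj : j ∉ S) :
    fermiSign i (insert j S) =
      (if Fintype.equivFin ι j < Fintype.equivFin ι i then -1 else 1) * fermiSign i S := by
  unfold fermiSign
  rw [Finset.filter_insert]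
  split_ifs with h
  · rw [Finset.card_insert_of_notMem (by simp [hj]), pow_succ]; ring
  · simp

lemma fermiSign_insert_self (i : ι) (S : Finset ι) :
    fermiSign i (insert i S) = fermiSign i S := by
  by_cases h : i ∈ S
  · rw [Finset.insert_eq_of_mem h]
  · rw [fermiSign_insert _ _ _ h]; simp

omit [DecidableEq ι] in
lemma star_fermiSign (i : ι) (S : Finset ι) : (starRingEnd ℂ) (fermiSign i S) = fermiSign i S := by
  simp [fermiSign]

/-- Exactly one of two distinct modes precedes the other in the enumeration, so exactly one of the
two insertions flips a sign. All anticommutation relations between distinct modes come from this. -/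
lemma fermiSign_swap {i j : ι} (h : i ≠ j) {S : Finset ι} (hi : i ∉ S) (hj : j ∉ S) :
    fermiSign i S * fermiSign j (insert i S) = - (fermiSign j S * fermiSign i (insert j S)) := by
  rw [fermiSign_insert _ _ _ hi, fermiSign_insert _ _ _ hj]
  have hne : Fintype.equivFin ι i ≠ Fintype.equivFin ι j := fun e => h ((Fintype.equivFin ι).injective e)
  rcases lt_or_gt_of_ne hne with h1 | h1
  · rw [if_pos h1, if_neg h1.asymm]; ring
  · rw [if_pos h1, if_neg h1.asymm]; ring

lemma annihilation_apply (i : ι) (ψ : Fock ι) (S : Finset ι) :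
    annihilation i ψ S = if i ∈ S then 0 else fermiSign i S * ψ (insert i S) := rfl

lemma annihilation_single (i : ι) (S : Finset ι) :
    annihilation i (EuclideanSpace.single S (1 : ℂ)) =
      if i ∈ S then fermiSign i S • EuclideanSpace.single (S.erase i) (1 : ℂ) else 0 := by
  ext T
  rw [annihilation_apply]
  by_cases hT : i ∈ T
  · rw [if_pos hT]
    split_ifs with hS
    · have : T ≠ S.erase i := by rintro rfl; simp at hT
      simp [this]
    · simp
  · rw [if_neg hT]
    split_ifs with hS
    · by_cases h : T = S.erase i
      · subst h
        rw [Finset.insert_erase hS]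
        rw [← fermiSign_insert_self, Finset.insert_erase hS]
        simp
      · have h2 : insert i T ≠ S := by
          rintro rfl
          exact h (by rw [Finset.erase_insert hT])
        simp [h, h2]
    · have h2 : insert i T ≠ S := by
        rintro rfl
        simp at hS
      simp [h2]

lemma creation_apply (i : ι) (ψ : Fock ι) (S : Finset ι) :
    creation i ψ S = if i ∈ S then fermiSign i S * ψ (S.erase i) else 0 := by
  have h : creation i ψ S = inner ℂ (EuclideanSpace.single S (1 : ℂ)) (creation i ψ) := by
    rw [EuclideanSpace.inner_single_left]; simp
  rw [h, creation, LinearMap.adjoint_inner_right, annihilation_single]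
  split_ifs with hS
  · rw [inner_smul_left, star_fermiSign, EuclideanSpace.inner_single_left]; simp
  · simp

lemma annihilation_mul_annihilation (i j : ι) :
    annihilation i * annihilation j = - (annihilation j * annihilation i) := by
  ext ψ S
  simp only [Module.End.mul_apply, LinearMap.neg_apply, PiLp.neg_apply, annihilation_apply]
  by_cases hij : i = j
  · subst hij
    by_cases h : i ∈ S <;> simp [h]
  · by_cases hi : i ∈ S
    · simp [hi]
    · by_cases hj : j ∈ S
      · simp [hj]
      · simp only [hi, hj, if_false, Finset.mem_insert, hij, Ne.symm hij, or_self]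
        rw [← mul_assoc, ← mul_assoc, fermiSign_swap hij hi hj, Finset.insert_comm]; ring

lemma annihilation_mul_creation (i j : ι) :
    annihilation i * creation j = (if i = j then 1 else 0) - creation j * annihilation i := by
  ext ψ S
  by_cases hij : i = j
  · subst hij
    simp only [Module.End.mul_apply, LinearMap.sub_apply, PiLp.sub_apply, annihilation_apply,
      creation_apply, if_true, Module.End.one_apply]
    by_cases hi : i ∈ S
    · have h1 : fermiSign i (S.erase i) = fermiSign i S := by
        rw [← fermiSign_insert_self, Finset.insert_erase hi]
      simp only [hi, if_true, Finset.notMem_erase, if_false, Finset.insert_erase hi, h1]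
      rw [← mul_assoc, fermiSign_mul_self]; ring
    · simp only [hi, if_false, Finset.mem_insert_self, if_true, Finset.erase_insert hi,
        fermiSign_insert_self]
      rw [← mul_assoc, fermiSign_mul_self]; ring
  · rw [if_neg hij, zero_sub]
    simp only [Module.End.mul_apply, LinearMap.neg_apply, PiLp.neg_apply, annihilation_apply,
      creation_apply, Finset.mem_insert, Ne.symm hij, false_or, Finset.mem_erase]
    by_cases hi : i ∈ S
    · simp [hi, hij]
    · by_cases hj : j ∈ S
      · simp only [hi, hj, if_false, if_true, and_false, ne_eq]
        have hS : S = insert j (S.erase j) := (Finset.insert_erase hj).symm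
        set T := S.erase j with hT
        have hjT : j ∉ T := by simp [hT]
        have hiT : i ∉ T := by simp [hT, hi]
        rw [hS, Finset.insert_comm i j T, Finset.erase_insert (by simp [hjT, Ne.symm hij])]
        have key := fermiSign_swap hij hiT hjT
        have e1 : fermiSign j (insert j (insert i T)) = fermiSign j (insert i T) := by
          rw [fermiSign_insert_self]
        rw [fermiSign_insert_self j T]
        have h2 := fermiSign_mul_self i T
        rw [e1, ← mul_assoc, ← mul_assoc]
        have : fermiSign i (insert j T) * fermiSign j (insert i T)
            = - (fermiSign j T * fermiSign i T) := by
          calc _ = fermiSign i (insert j T) * (fermiSign i T * fermiSign i T)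
                  * fermiSign j (insert i T) := by rw [h2]; ring
            _ = fermiSign i (insert j T) * fermiSign i T *
                  (fermiSign i T * fermiSign j (insert i T)) := by ring
            _ = -(fermiSign i (insert j T) * fermiSign i (insert j T)) 
                  * (fermiSign j T * fermiSign i T):= by rw [key]; ring
            _ = _ := by rw [fermiSign_mul_self]; ring
        rw [this]; ring
      · simp [hj]

lemma star_annihilation (i : ι) : star (annihilation i) = creation i := rfl

lemma star_creation (i : ι) : star (creation i) = annihilation i := by
  rw [← star_annihilation, star_star]

end CAR
end Hubbard
end

/-! ### Creation and annihilation operators of real one-electron states -/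

noncomputable section
namespace Hubbard

lemma eq_zero_of_eq_neg_self {M : Type*} [AddCommGroup M] [Module ℂ M] {a : M} (h : a = -a) :
    a = 0 := by
  have h2 : (2 : ℂ) • a = 0 := by
    rw [two_smul]
    nth_rewrite 1 [h]
    simp
  simpa using h2

section Smeared
variable {X : Type} [Fintype X] [DecidableEq X]

/-- The annihilation operator of the real single-electron state `f` with spin `σ`. -/
def ann (f : X → ℝ) (σ : Fin 2) : Op (X × Fin 2) :=
  ∑ x, (f x : ℂ) • annihilation (x, σ)

/-- The creation operator of the real single-electron state `f` with spin `σ`. -/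
def cre (f : X → ℝ) (σ : Fin 2) : Op (X × Fin 2) := star (ann f σ)

lemma star_ann (f : X → ℝ) (σ : Fin 2) : star (ann f σ) = cre f σ := rfl

lemma star_cre (f : X → ℝ) (σ : Fin 2) : star (cre f σ) = ann f σ := star_star _

lemma cre_eq (f : X → ℝ) (σ : Fin 2) : cre f σ = ∑ x, (f x : ℂ) • creation (x, σ) := by
  simp [cre, ann, star_sum, star_smul, star_annihilation]

lemma ann_single (x : X) (σ : Fin 2) : ann (Pi.single x 1) σ = annihilation (x, σ) := by
  unfold ann
  rw [Finset.sum_eq_single x] <;> simp +contextual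

lemma cre_single (x : X) (σ : Fin 2) : cre (Pi.single x 1) σ = creation (x, σ) := by
  rw [cre, ann_single, star_annihilation]

lemma ann_add (f g : X → ℝ) (σ : Fin 2) : ann (f + g) σ = ann f σ + ann g σ := by
  simp [ann, add_smul, Finset.sum_add_distrib]

lemma ann_smul (a : ℝ) (f : X → ℝ) (σ : Fin 2) : ann (a • f) σ = (a : ℂ) • ann f σ := by
  simp only [ann, Finset.smul_sum, smul_smul, Pi.smul_apply, smul_eq_mul, Complex.ofReal_mul]

lemma ann_zero (σ : Fin 2) : ann (0 : X → ℝ) σ = 0 := by simp [ann]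

lemma ann_sub (f g : X → ℝ) (σ : Fin 2) : ann (f - g) σ = ann f σ - ann g σ := by
  simp [ann, sub_smul, Finset.sum_sub_distrib]

lemma ann_sum {J : Type*} (s : Finset J) (f : J → X → ℝ) (σ : Fin 2) :
    ann (∑ j ∈ s, f j) σ = ∑ j ∈ s, ann (f j) σ := by
  classical
  induction s using Finset.induction_on with
  | empty => simp [ann_zero]
  | insert a s ha ih => rw [Finset.sum_insert ha, Finset.sum_insert ha, ann_add, ih]

lemma cre_smul (a : ℝ) (f : X → ℝ) (σ : Fin 2) : cre (a • f) σ = (a : ℂ) • cre f σ := by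
  simp [cre, ann_smul]

lemma cre_sum {J : Type*} (s : Finset J) (f : J → X → ℝ) (σ : Fin 2) :
    cre (∑ j ∈ s, f j) σ = ∑ j ∈ s, cre (f j) σ := by
  simp [cre, ann_sum, star_sum]

lemma ann_mul_ann (f g : X → ℝ) (σ τ : Fin 2) :
    ann f σ * ann g τ = - (ann g τ * ann f σ) := by
  unfold ann
  rw [Finset.sum_mul_sum, Finset.sum_mul_sum, Finset.sum_comm, ← Finset.sum_neg_distrib]
  refine Finset.sum_congr rfl fun y _ => ?_
  rw [← Finset.sum_neg_distrib]
  refine Finset.sum_congr rfl fun x _ => ?_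
  rw [smul_mul_smul_comm, smul_mul_smul_comm, annihilation_mul_annihilation, smul_neg, mul_comm]

lemma ann_mul_self (f : X → ℝ) (σ : Fin 2) : ann f σ * ann f σ = 0 := by
  have h := ann_mul_ann f f σ σ
  exact eq_zero_of_eq_neg_self h

lemma cre_mul_cre (f g : X → ℝ) (σ τ : Fin 2) :
    cre f σ * cre g τ = - (cre g τ * cre f σ) := by
  have := congrArg star (ann_mul_ann g f τ σ)
  simpa [cre] using this

lemma cre_mul_self (f : X → ℝ) (σ : Fin 2) : cre f σ * cre f σ = 0 :=
  eq_zero_of_eq_neg_self (cre_mul_cre f f σ σ)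

lemma ann_mul_cre (f g : X → ℝ) (σ τ : Fin 2) :
    ann f σ * cre g τ = (if σ = τ then ((f ⬝ᵥ g : ℝ) : ℂ) else 0) • 1 - cre g τ * ann f σ := by
  rw [cre_eq]
  unfold ann
  rw [Finset.sum_mul_sum, Finset.sum_mul_sum, Finset.sum_comm (s := Finset.univ (α := X)) (t := Finset.univ (α := X)) (f := fun x y => ((g x : ℂ) • creation (x, τ)) * ((f y : ℂ) • annihilation (y, σ))),
    eq_sub_iff_add_eq, ← Finset.sum_add_distrib]
  simp_rw [← Finset.sum_add_distrib, smul_mul_smul_comm, annihilation_mul_creation, smul_sub,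
    mul_comm ((g _ : ℝ) : ℂ), sub_add_cancel, Prod.mk.injEq]
  by_cases h : σ = τ
  · subst h
    simp [dotProduct, Finset.sum_smul]
  · simp [h]

lemma ann_mul_cre_of_ne (f g : X → ℝ) {σ τ : Fin 2} (h : σ ≠ τ) :
    ann f σ * cre g τ = - (cre g τ * ann f σ) := by
  rw [ann_mul_cre, if_neg h]; simp

lemma ann_mul_cre_same (f g : X → ℝ) (σ : Fin 2) :
    ann f σ * cre g σ = ((f ⬝ᵥ g : ℝ) : ℂ) • 1 - cre g σ * ann f σ := by
  rw [ann_mul_cre, if_pos rfl]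

end Smeared

section Norm
variable {ι : Type} [Fintype ι]

lemma norm_sq_eq_inner_star_mul (A : Op ι) (Φ : Fock ι) :
    ((‖A Φ‖ ^ 2 : ℝ) : ℂ) = inner ℂ Φ ((star A * A) Φ) := by
  rw [Module.End.mul_apply, LinearMap.star_eq_adjoint, LinearMap.adjoint_inner_right,
    inner_self_eq_norm_sq_to_K]
  simp

end Norm
end Hubbard
end

/-! ### Up-down pairs in a single state -/

noncomputable section
namespace Hubbard
section PairNorm
variable {X : Type} [Fintype X] [DecidableEq X]

/-- Operator that annihilates an up-down pair in the state `f`. -/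
def pairAnn (f : X → ℝ) : Op (X × Fin 2) := ann f 1 * ann f 0

/-- The number operator of the state `f` with spin `σ`. -/
def num (f : X → ℝ) (σ : Fin 2) : Op (X × Fin 2) := cre f σ * ann f σ

variable {f g : X → ℝ}

lemma commute_num_num_spin (σ τ : Fin 2) : Commute (num f σ) (num f τ) := by
  rcases eq_or_ne σ τ with rfl | h
  · exact Commute.refl _
  have h1 := ann_mul_cre_of_ne f f h
  have h2 := ann_mul_cre_of_ne f f h.symm
  have h3 := ann_mul_ann f f σ τ
  have h4 := cre_mul_cre f f σ τ
  unfold num Commute SemiconjBy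
  generalize ann f σ = a at *
  generalize ann f τ = b at *
  generalize cre f σ = a' at *
  generalize cre f τ = b' at *
  linear_combination (norm := noncomm_ring) a' * h1 * b - a' * b' * h3 + h4 * b * a - b' * h2 * a

lemma num_mul_self (hf : f ⬝ᵥ f = 1) (σ : Fin 2) : num f σ * num f σ = num f σ := by
  have h1 := ann_mul_cre_same f f σ
  rw [hf] at h1
  have h2 := ann_mul_self f σ
  unfold num
  generalize ann f σ = a at *
  generalize cre f σ = a' at *
  simp only [Complex.ofReal_one, one_smul] at h1
  linear_combination (norm := noncomm_ring) a' * h1 * a - a' * a' * h2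

lemma star_pairAnn : star (pairAnn f) = cre f 0 * cre f 1 := by
  simp [pairAnn, star_mul, star_ann]

lemma star_pairAnn_mul : star (pairAnn f) * pairAnn f = num f 0 * num f 1 := by
  rw [star_pairAnn]
  have h1 := ann_mul_cre_of_ne f f (σ := 0) (τ := 1) (by decide)
  have h3 := ann_mul_ann f f 0 1
  unfold pairAnn num
  generalize ann f 0 = a at *
  generalize ann f 1 = b at *
  generalize cre f 0 = a' at *
  generalize cre f 1 = b' at *
  linear_combination (norm := noncomm_ring) a' * b' * h3 - a' * h1 * b

/-- A pair can be created only in an empty mode. With `star_pairAnn_mul` this turns `‖star (pairAnn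
f) Φ‖²` and `‖pairAnn f Φ‖²` into the weights of the empty and of the doubly occupied mode. -/
lemma pairAnn_mul_star (hf : f ⬝ᵥ f = 1) :
    pairAnn f * star (pairAnn f) = (1 - num f 0) * (1 - num f 1) := by
  rw [star_pairAnn]
  have h0 := ann_mul_cre_same f f 0
  have h1 := ann_mul_cre_same f f 1
  rw [hf] at h0 h1
  have h2 := ann_mul_cre_of_ne f f (σ := 0) (τ := 1) (by decide)
  have h2' := ann_mul_cre_of_ne f f (σ := 1) (τ := 0) (by decide)
  have h3 := ann_mul_ann f f 0 1
  unfold pairAnn num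
  generalize ann f 0 = a at *
  generalize ann f 1 = b at *
  generalize cre f 0 = a' at *
  generalize cre f 1 = b' at *
  simp only [Complex.ofReal_one, one_smul] at h0 h1
  linear_combination (norm := noncomm_ring) b * h0 * b' + h1 - h2' * a * b' + a' * b * h2
    - a' * h1 * a - a' * h2 * b + a' * b' * h3

end PairNorm
end Hubbard
end

/-! ### Norm of a sum of commuting pair annihilators -/

noncomputable section
namespace Hubbard
section PairFamily
variable {ι : Type} [Fintype ι]

lemma inner_apply_eq_star (A : Op ι) (u v : Fock ι) :
    inner ℂ (A u) v = inner ℂ u ((star A) v) := by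
  rw [LinearMap.star_eq_adjoint, LinearMap.adjoint_inner_right]

lemma re_inner_star_mul (A : Op ι) (Φ : Fock ι) :
    (inner ℂ Φ ((star A * A) Φ)).re = ‖A Φ‖ ^ 2 := by
  rw [← norm_sq_eq_inner_star_mul, Complex.ofReal_re]

lemma re_inner_self (v : Fock ι) : (inner ℂ v v).re = ‖v‖ ^ 2 := by
  have := inner_self_eq_norm_sq (𝕜 := ℂ) v
  simpa using this

lemma norm_sq_sum {J : Type*} [Fintype J] (v : J → Fock ι) :
    ‖∑ j, v j‖ ^ 2 = ∑ i, ∑ j, (inner ℂ (v i) (v j)).re := by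
  rw [← re_inner_self, sum_inner, Complex.re_sum]
  simp_rw [inner_sum, Complex.re_sum]

/-- `re ⟪P v, Q v⟫` for `P = Q` a self-adjoint idempotent. -/
lemma re_inner_projection {P : Op ι} (hs : star P = P) (hP : P * P = P) (v : Fock ι) :
    (inner ℂ v (P v)).re = ‖P v‖ ^ 2 := by
  rw [← re_inner_star_mul, hs, hP]

/-- Bessel's inequality for two orthogonal projections, by expanding the square of the remainder `v
- (P v + Q v)`. -/
lemma norm_projection_add_le {P Q : Op ι} (hPs : star P = P) (hP : P * P = P) (hQs : star Q = Q)
    (hQ : Q * Q = Q) (hPQ : P * Q = 0) (v : Fock ι) : ‖P v‖ ^ 2 + ‖Q v‖ ^ 2 ≤ ‖v‖ ^ 2 := by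
  have h0 : 0 ≤ ‖v - (P v + Q v)‖ ^ 2 := sq_nonneg _
  have h1 : (inner ℂ (P v) (Q v)) = 0 := by
    rw [inner_apply_eq_star, hPs, ← Module.End.mul_apply, hPQ]; simp
  have h2 := re_inner_projection hPs hP v
  have h3 := re_inner_projection hQs hQ v
  rw [@norm_sub_sq ℂ, @norm_add_sq ℂ, h1, inner_add_right] at h0
  simp only [map_add, map_zero, RCLike.re_to_complex, h2, h3] at h0
  linarith

variable {J : Type*} [Fintype J] [DecidableEq J]

/-- Norm bound for the sum of a commuting family of pair annihilation operators. -/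
theorem norm_sum_pair_le (η : J → Op ι) (hc : ∀ i j, i ≠ j → Commute (η i) (η j))
    (hcs : ∀ i j, i ≠ j → Commute (η i) (star (η j))) (hsq : ∀ j, η j * η j = 0)
    (hpi : ∀ j, η j * star (η j) * η j = η j) (Φ : Fock ι) :
    ‖(∑ j, η j) Φ‖ ≤ ((Fintype.card J : ℝ) + 1) / 2 * ‖Φ‖ := by
  -- Each `η j` acts like a spin-1/2 lowering operator, so the bound is that of the collective
  -- lowering operator of spin K/2. `N j` projects onto a present pair and `E j` onto an empty mode.
  set N : J → Op ι := fun j => star (η j) * η j with hN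
  set E : J → Op ι := fun j => η j * star (η j) with hE
  have hNs : ∀ j, star (N j) = N j := fun j => by simp [hN]
  have hEs : ∀ j, star (E j) = E j := fun j => by simp [hE]
  have hpi' : ∀ j, star (η j) * η j * star (η j) = star (η j) := fun j => by
    have := congrArg star (hpi j)
    simpa [mul_assoc] using this
  have hNN : ∀ j, N j * N j = N j := fun j => by
    simp only [hN]; rw [← mul_assoc, hpi']
  have hEE : ∀ j, E j * E j = E j := fun j => by
    simp only [hE]; rw [← mul_assoc, hpi]
  have hNE : ∀ j, N j * E j = 0 := fun j => by
    simp only [hN, hE]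
    rw [mul_assoc, ← mul_assoc (η j), hsq]; simp
  have hcN : ∀ i j, i ≠ j → Commute (η i) (N j) := fun i j h => (hcs i j h).mul_right (hc i j h)
  have hcE : ∀ i j, i ≠ j → Commute (η i) (E j) := fun i j h => (hc i j h).mul_right (hcs i j h)
  have hcEE : ∀ i j, i ≠ j → Commute (E i) (E j) := fun i j h => by
    have h1 := hcE i j h
    have h2 : Commute (star (η i)) (E j) := by
      have := h1.star_star
      rwa [hEs] at this
    exact h1.mul_left h2
  set v : J → Fock ι := fun j => η j Φ with hv
  have hEv : ∀ j, E j (v j) = v j := fun j => by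
    simp only [hv, hE, ← Module.End.mul_apply, hpi]
  set ς : ℝ := ∑ i, ‖v i‖ ^ 2 with hς
  set T : Op ι := ∑ j, N j with hT
  have hTς : (inner ℂ Φ (T Φ)).re = ς := by
    rw [hT, LinearMap.sum_apply, inner_sum, Complex.re_sum]
    exact Finset.sum_congr rfl fun i _ => re_inner_star_mul _ _
  have hTT : ‖T Φ‖ ^ 2 = ∑ i, ∑ j, if i = j then ‖v i‖ ^ 2 else ‖N j (v i)‖ ^ 2 := by
    rw [hT, LinearMap.sum_apply, norm_sq_sum]
    refine Finset.sum_congr rfl fun i _ => Finset.sum_congr rfl fun j _ => ?_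
    split_ifs with h
    · subst h
      rw [re_inner_self, ← re_inner_projection (hNs i) (hNN i), re_inner_star_mul]
    · rw [inner_apply_eq_star, hNs, ← Module.End.mul_apply]
      simp only [hN]
      rw [mul_assoc, Module.End.mul_apply, ← inner_apply_eq_star]
      change (inner ℂ (v i) ((η i * N j) Φ)).re = _
      rw [(hcN i j h).eq, Module.End.mul_apply, re_inner_projection (hNs j) (hNN j)]
  -- Mode `i` is empty in `v i`, so an overlap of `v i` with `v j` only sees the part where both
  -- modes are empty. The inequality 2ab ≤ a² + b² then separates the two factors.
  have hR : ‖(∑ j, η j) Φ‖ ^ 2 ≤ ∑ i, ∑ j, if i = j then ‖v i‖ ^ 2 else ‖E j (v i)‖ ^ 2 := by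
    rw [LinearMap.sum_apply, norm_sq_sum]
    have hle : ∀ i j, (inner ℂ (v i) (v j)).re ≤
        ((if i = j then ‖v i‖ ^ 2 else ‖E j (v i)‖ ^ 2) +
          (if j = i then ‖v j‖ ^ 2 else ‖E i (v j)‖ ^ 2)) / 2 := by
      intro i j
      by_cases h : i = j
      · subst h
        rw [if_pos rfl, re_inner_self]
        linarith
      · rw [if_neg h, if_neg (Ne.symm h)]
        have e : inner ℂ (v i) (v j) = inner ℂ (E j (v i)) (E i (v j)) := by
          conv_lhs => rw [← hEv i, ← hEv j]
          rw [inner_apply_eq_star (E i), hEs, inner_apply_eq_star (E j), hEs, ← Module.End.mul_apply,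
            ← Module.End.mul_apply, (hcEE i j h).eq]
          rfl
        rw [e]
        have h1 : (inner ℂ (E j (v i)) (E i (v j))).re ≤ ‖E j (v i)‖ * ‖E i (v j)‖ :=
          (Complex.re_le_norm _).trans (norm_inner_le_norm _ _)
        nlinarith [sq_nonneg (‖E j (v i)‖ - ‖E i (v j)‖)]
    have := Finset.sum_le_sum fun i (_ : i ∈ Finset.univ) =>
      Finset.sum_le_sum fun j (_ : j ∈ Finset.univ) => hle i j
    refine this.trans (le_of_eq ?_)
    simp_rw [← Finset.sum_div, Finset.sum_add_distrib]
    nth_rewrite 2 [Finset.sum_comm]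
    ring
  -- For j ≠ i the ranges of `N j` and `E j` are orthogonal and together cost one ‖v i‖². The
  -- diagonal term is counted in both sums, whence K + 1 instead of K.
  have hsum : (∑ i, ∑ j, if i = j then ‖v i‖ ^ 2 else ‖E j (v i)‖ ^ 2) + ‖T Φ‖ ^ 2 ≤
      (Fintype.card J + 1) * ς := by
    rw [hTT, ← Finset.sum_add_distrib, hς, Finset.mul_sum]
    refine Finset.sum_le_sum fun i _ => ?_
    rw [← Finset.sum_add_distrib]
    have : ∀ j, ((if i = j then ‖v i‖ ^ 2 else ‖E j (v i)‖ ^ 2) +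
        if i = j then ‖v i‖ ^ 2 else ‖N j (v i)‖ ^ 2) ≤
        ‖v i‖ ^ 2 + if i = j then ‖v i‖ ^ 2 else 0 := by
      intro j
      split_ifs with h
      · exact le_rfl
      · have := norm_projection_add_le (hNs j) (hNN j) (hEs j) (hEE j) (hNE j) (v i)
        linarith
    refine (Finset.sum_le_sum fun j _ => this j).trans (le_of_eq ?_)
    rw [Finset.sum_add_distrib]
    simp
    ring
  set K : ℝ := (Fintype.card J : ℝ)
  -- Completing the square: (K+1)⟨T⟩ - ‖TΦ‖² ≤ ((K+1)/2)² ‖Φ‖².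
  have h0 : 0 ≤ ‖(((K + 1) / 2 : ℝ) : ℂ) • Φ - T Φ‖ ^ 2 := sq_nonneg _
  rw [@norm_sub_sq ℂ, norm_smul, inner_smul_left, Complex.conj_ofReal] at h0
  simp only [RCLike.re_to_complex, Complex.re_ofReal_mul, hTς, Complex.norm_real,
    Real.norm_eq_abs, mul_pow, sq_abs] at h0
  have hK : 0 ≤ K := Nat.cast_nonneg _
  refine abs_le_of_sq_le_sq' ?_ (by positivity) |>.2
  rw [mul_pow]
  linarith

end PairFamily

section
variable {X : Type} [Fintype X] [DecidableEq X]

lemma commute_pairAnn (f g : X → ℝ) : Commute (pairAnn f) (pairAnn g) := by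
  have h1 := ann_mul_ann f g 0 0
  have h2 := ann_mul_ann f g 0 1
  have h3 := ann_mul_ann f g 1 0
  have h4 := ann_mul_ann f g 1 1
  unfold pairAnn Commute SemiconjBy
  generalize ann f 0 = a at *
  generalize ann f 1 = b at *
  generalize ann g 0 = a' at *
  generalize ann g 1 = b' at *
  linear_combination (norm := noncomm_ring) b * h2 * a' - b * b' * h1 + h4 * a' * a - b' * h3 * a

lemma commute_pairAnn_star {f g : X → ℝ} (h : f ⬝ᵥ g = 0) :
    Commute (pairAnn f) (star (pairAnn g)) := by
  have key : ∀ σ τ, ann f σ * cre g τ = - (cre g τ * ann f σ) := fun σ τ => by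
    rw [ann_mul_cre, h]; simp
  have h1 := key 0 0
  have h2 := key 0 1
  have h3 := key 1 0
  have h4 := key 1 1
  rw [star_pairAnn]
  unfold pairAnn Commute SemiconjBy
  generalize ann f 0 = a at *
  generalize ann f 1 = b at *
  generalize cre g 0 = a' at *
  generalize cre g 1 = b' at *
  linear_combination (norm := noncomm_ring) b * h1 * b' - h3 * a * b' + a' * b * h2 - a' * h4 * a

lemma pairAnn_mul_self (f : X → ℝ) : pairAnn f * pairAnn f = 0 := by
  have h2 := ann_mul_ann f f 0 1
  have h1 := ann_mul_self f 1
  unfold pairAnn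
  generalize ann f 0 = a at *
  generalize ann f 1 = b at *
  linear_combination (norm := noncomm_ring) b * h2 * a - h1 * a * a

lemma pairAnn_star_pairAnn {f : X → ℝ} (hf : f ⬝ᵥ f = 1) :
    pairAnn f * star (pairAnn f) * pairAnn f = pairAnn f := by
  rw [pairAnn_mul_star hf]
  have h0 := ann_mul_self f 0
  have h1 := ann_mul_self f 1
  have h2 := ann_mul_ann f f 0 1
  have h3 := ann_mul_cre_of_ne f f (σ := 1) (τ := 0) (by decide)
  unfold pairAnn num
  generalize ann f 0 = a at *
  generalize ann f 1 = b at *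
  generalize cre f 0 = a' at *
  generalize cre f 1 = b' at *
  linear_combination (norm := noncomm_ring) (a' * a - 1) * b' * h1 * a - a' * h2 * a + a' * b * h0

theorem norm_sum_pairAnn_le {J : Type*} [Fintype J] [DecidableEq J] (k : J → X → ℝ)
    (hk : ∀ i j, k i ⬝ᵥ k j = if i = j then 1 else 0) (Φ : Fock (X × Fin 2)) :
    ‖(∑ j, pairAnn (k j)) Φ‖ ≤ ((Fintype.card J : ℝ) + 1) / 2 * ‖Φ‖ :=
  norm_sum_pair_le _ (fun _ _ _ => commute_pairAnn _ _)
    (fun i j h => commute_pairAnn_star (by rw [hk, if_neg h])) (fun _ => pairAnn_mul_self _)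
    (fun j => pairAnn_star_pairAnn (by rw [hk, if_pos rfl])) Φ

/-- The anticommutator of `cre f σ` and `ann f σ` is the scalar `f ⬝ᵥ f`, and both summands are
nonnegative operators. -/
lemma norm_ann_le {f : X → ℝ} (σ : Fin 2) (Φ : Fock (X × Fin 2)) :
    ‖ann f σ Φ‖ ^ 2 ≤ (f ⬝ᵥ f) * ‖Φ‖ ^ 2 := by
  have h1 := re_inner_star_mul (ann f σ) Φ
  have h2 := re_inner_star_mul (cre f σ) Φ
  rw [star_cre, ann_mul_cre_same] at h2
  rw [star_ann] at h1
  simp only [LinearMap.sub_apply, inner_sub_right, LinearMap.smul_apply, inner_smul_right,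
    Module.End.one_apply, Complex.sub_re, Complex.re_ofReal_mul, re_inner_self, h1] at h2
  nlinarith [sq_nonneg ‖cre f σ Φ‖]

end
end Hubbard
end

/-! ### Bounding one pair annihilator by the others -/

noncomputable section
namespace Hubbard
section LocalBound
variable {X : Type} [Fintype X] [DecidableEq X]

lemma norm_projection_le {ι : Type} [Fintype ι] {P : Op ι} (hs : star P = P) (hP : P * P = P)
    (v : Fock ι) : ‖P v‖ ≤ ‖v‖ := by
  have := norm_projection_add_le hs hP (star_zero _) (mul_zero 0) (mul_zero P) v
  simp only [LinearMap.zero_apply, norm_zero] at this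
  exact abs_le_of_sq_le_sq' (by linarith) (norm_nonneg _) |>.2

lemma norm_ann_le_of_le_one {f : X → ℝ} (hf : f ⬝ᵥ f ≤ 1) (σ : Fin 2) (Φ : Fock (X × Fin 2)) :
    ‖ann f σ Φ‖ ≤ ‖Φ‖ := by
  have := norm_ann_le (f := f) σ Φ
  refine abs_le_of_sq_le_sq' (this.trans ?_) (norm_nonneg _) |>.2
  nlinarith [sq_nonneg ‖Φ‖]

lemma pairAnn_smul (a : ℝ) (f : X → ℝ) : pairAnn (a • f) = ((a ^ 2 : ℝ) : ℂ) • pairAnn f := by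
  rw [pairAnn, ann_smul, ann_smul, smul_mul_smul_comm, pairAnn]
  push_cast; rw [sq]

/-- The remainder is ordered so that an annihilator of the perturbation `g` acts first on the state.
Its norm is then bounded by `‖ann g σ Φ‖`. -/
lemma pairAnn_add (f g : X → ℝ) :
    pairAnn (f + g) = pairAnn f + (ann f 1 * ann g 0 - ann (f + g) 0 * ann g 1) := by
  have h := ann_mul_ann (f + g) g 0 1
  simp only [pairAnn, ann_add] at *
  rw [h]; noncomm_ring

/-- Write D = W - A - R with A the part built from the `k j`, and multiply by the projection D D*,
which fixes D. It commutes with A because every `k j` is orthogonal to `d`. Thus A acts on D D*Φ,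
and A is paid for by `q` times the norm of D*Φ. -/
theorem norm_pairAnn_le {J : Type*} [Fintype J] {d : X → ℝ} (hd : d ⬝ᵥ d = 1)
    (k r : J → X → ℝ) (hkd : ∀ j, k j ⬝ᵥ d = 0) (hk : ∀ j, k j ⬝ᵥ k j ≤ 1)
    (hkr : ∀ j, (k j + r j) ⬝ᵥ (k j + r j) ≤ 1) (q : ℝ)
    (hq : ∀ Φ, ‖(∑ j, pairAnn (k j)) Φ‖ ≤ q * ‖Φ‖) (hq0 : 0 ≤ q) (Φ : Fock (X × Fin 2)) :
    ‖pairAnn d Φ‖ ≤ q * ‖star (pairAnn d) Φ‖ +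
      ‖(pairAnn d + ∑ j, pairAnn (k j + r j)) Φ‖ +
      ∑ j, (‖ann (r j) 0 Φ‖ + ‖ann (r j) 1 Φ‖) := by
  set D := pairAnn d with hD
  set A := ∑ j, pairAnn (k j) with hA
  set W := D + ∑ j, pairAnn (k j + r j) with hW
  set R := ∑ j, (ann (k j) 1 * ann (r j) 0 - ann (k j + r j) 0 * ann (r j) 1) with hR
  have hDDD : D * star D * D = D := pairAnn_star_pairAnn hd
  have hP : (D * star D) * (D * star D) = D * star D := by rw [← mul_assoc, hDDD]
  have hPs : star (D * star D) = D * star D := by simp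
  have hPle := norm_projection_le hPs hP
  have hcomm : Commute (D * star D) A := by
    refine Commute.sum_right _ _ _ fun j _ => ?_
    exact (commute_pairAnn _ _).mul_left (commute_pairAnn_star (hkd j)).symm
  have hdec : D = D * star D * W - A * (D * star D) - D * star D * R := by
    have h1 : D = W - A - R := by
      rw [hW, hA, hR, add_sub_assoc, add_sub_assoc, ← Finset.sum_sub_distrib,
        ← Finset.sum_sub_distrib]
      rw [Finset.sum_eq_zero, add_zero]
      intro j _
      rw [pairAnn_add]; abel
    calc D = D * star D * D := hDDD.symm
      _ = D * star D * (W - A - R) := by rw [← h1]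
      _ = _ := by rw [← hcomm.eq]; noncomm_ring
  have hD1 : ∀ v, ‖D v‖ ≤ ‖v‖ := fun v =>
    (norm_ann_le_of_le_one hd.le 1 _).trans (norm_ann_le_of_le_one hd.le 0 _)
  have hRle : ‖R Φ‖ ≤ ∑ j, (‖ann (r j) 0 Φ‖ + ‖ann (r j) 1 Φ‖) := by
    rw [hR, LinearMap.sum_apply]
    refine (norm_sum_le _ _).trans (Finset.sum_le_sum fun j _ => ?_)
    rw [LinearMap.sub_apply]
    refine (norm_sub_le _ _).trans (add_le_add ?_ ?_)
    · exact norm_ann_le_of_le_one (hk j) _ _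
    · exact norm_ann_le_of_le_one (hkr j) _ _
  calc ‖D Φ‖ = ‖(D * star D) (W Φ) - A (D (star D Φ)) - (D * star D) (R Φ)‖ := by
        conv_lhs => rw [hdec]
        rfl
    _ ≤ ‖(D * star D) (W Φ)‖ + ‖A (D (star D Φ))‖ + ‖(D * star D) (R Φ)‖ :=
        (norm_sub_le _ _).trans (add_le_add_left (norm_sub_le _ _) _)
    _ ≤ ‖W Φ‖ + q * ‖star D Φ‖ + ‖R Φ‖ := by
        gcongr
        · exact hPle _
        · exact (hq _).trans (mul_le_mul_of_nonneg_left (hD1 _) hq0)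
        · exact hPle _
    _ ≤ _ := by linarith

end LocalBound

/-! ### Geometry of a star and its plaquettes -/

section StarGeometry
variable {X : Type} [Fintype X] [DecidableEq X]

/-- The vector on `X` with entries `c b` at the points `p b`. -/
def placed {B : Type*} [Fintype B] (p : B → X) (c : B → ℝ) : X → ℝ :=
  ∑ b, c b • Pi.single (p b) 1

lemma placed_dotProduct {B : Type*} [Fintype B] {p : B → X} (hp : Function.Injective p)
    (c c' : B → ℝ) : placed p c ⬝ᵥ placed p c' = ∑ b, c b * c' b := by
  classical
  unfold placed
  rw [sum_dotProduct]
  refine Finset.sum_congr rfl fun b _ => ?_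
  rw [dotProduct_sum, Finset.sum_eq_single b]
  · simp [mul_comm]
  · intro b' _ h
    simp [hp.ne h.symm]
  · simp

lemma pairAnn_placed {B : Type*} [Fintype B] (p : B → X) (c : B → ℝ) :
    pairAnn (placed p c) =
      ∑ a, ∑ b, ((c a * c b : ℝ) : ℂ) • (annihilation (p a, 1) * annihilation (p b, 0)) := by
  unfold pairAnn placed
  simp_rw [ann_sum, ann_smul, ann_single, Finset.sum_mul_sum, smul_mul_smul_comm,
    Complex.ofReal_mul]

/-- The pair annihilator is quadratic in the real one-electron state, so only the completeness
relation of the family enters. -/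
lemma sum_pairAnn_placed {B J : Type*} [Fintype B] [DecidableEq B] [Fintype J] (p : B → X)
    (v : J → B → ℝ) (hv : ∀ a b, ∑ j, v j a * v j b = if a = b then 1 else 0) :
    ∑ j, pairAnn (placed p (v j)) = ∑ b, pairAnn (Pi.single (p b) 1) := by
  simp_rw [pairAnn_placed]
  rw [Finset.sum_comm]
  refine Finset.sum_congr rfl fun a _ => ?_
  rw [Finset.sum_comm]
  simp_rw [← Finset.sum_smul, ← Complex.ofReal_sum, hv]
  simp [pairAnn, ann_single]

variable {ν : ℕ}

/-- A direction and a sign. -/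
abbrev Leg (ν : ℕ) : Type := Fin ν × Bool

/-- Pairs of perpendicular legs. -/
abbrev Corner (ν : ℕ) : Type := {p : Leg ν × Leg ν // p.1.1 ≠ p.2.1}

/-- The state of the plaquette that contains the two legs `p.1.1`, `p.1.2`. -/
def plaqVec (S : Leg ν → X) (O : Corner ν → X) (p : Corner ν) : X → ℝ :=
  Pi.single (S p.1.1) 1 - Pi.single (S p.1.2) 1 + Pi.single (O p) 1
    - Pi.single (O ⟨p.1.swap, p.2.symm⟩) 1

/-- The quadratic form matrix `1 + Laplacian / 2` on the legs. -/
def legOp (v : Leg ν → ℝ) (a : Leg ν) : ℝ :=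
  v a + (∑ b, if a.1 ≠ b.1 then v a - v b else 0) / 2

/-- Coefficients of the extension of `v` orthogonal to all plaquettes. -/
def extCoeff (v : Leg ν → ℝ) : Leg ν ⊕ Corner ν → ℝ :=
  Sum.elim v fun p => -(v p.1.1 - v p.1.2) / 2

lemma sum_corner (f : Leg ν → Leg ν → ℝ) :
    ∑ p : Corner ν, f p.1.1 p.1.2 = ∑ a, ∑ b, if a.1 ≠ b.1 then f a b else 0 := by
  rw [← Fintype.sum_prod_type' (f := fun a b : Leg ν => if a.1 ≠ b.1 then f a b else 0),
    ← Finset.sum_filter]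
  exact (Finset.sum_subtype _ (by simp) (fun p : Leg ν × Leg ν => f p.1 p.2)).symm

lemma sum_corner_swap {M : Type*} [AddCommMonoid M] (f : Corner ν → M) :
    ∑ p : Corner ν, f ⟨p.1.swap, p.2.symm⟩ = ∑ p, f p := by
  let e : Corner ν ≃ Corner ν :=
    { toFun := fun p => ⟨p.1.swap, p.2.symm⟩
      invFun := fun p => ⟨p.1.swap, p.2.symm⟩
      left_inv := fun p => rfl
      right_inv := fun p => rfl }
  exact e.sum_comp f

/-- The outer coefficients contribute a sum of squares of differences, that is, a Dirichlet form on
pairs of perpendicular legs. Symmetrizing over the two orders of a corner turns it into the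
Laplacian in `legOp`. Eigenvectors of `legOp` therefore have mutually orthogonal extensions if they
are orthogonal themselves. -/
lemma extCoeff_dot (v w : Leg ν → ℝ) :
    ∑ b, extCoeff v b * extCoeff w b = ∑ a, v a * legOp w a := by
  rw [Fintype.sum_sum_type]
  simp only [extCoeff, Sum.elim_inl, Sum.elim_inr, legOp, mul_add, Finset.sum_add_distrib]
  congr 1
  have h1 : ∑ p : Corner ν, v p.1.1 * (w p.1.1 - w p.1.2) =
      ∑ a, v a * ∑ b, if a.1 ≠ b.1 then w a - w b else 0 := by
    rw [sum_corner (fun a b => v a * (w a - w b))]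
    simp [Finset.mul_sum]
  have h2 := sum_corner_swap (fun p : Corner ν => v p.1.2 * (w p.1.1 - w p.1.2))
  simp only [Prod.fst_swap, Prod.snd_swap] at h2
  have h3 : ∑ a, v a * ((∑ b, if a.1 ≠ b.1 then w a - w b else 0) / 2) =
      (∑ a, v a * ∑ b, if a.1 ≠ b.1 then w a - w b else 0) / 2 := by
    rw [Finset.sum_div]; exact Finset.sum_congr rfl fun _ _ => by ring
  rw [h3, ← h1]
  have h4 : ∑ p : Corner ν, -(v p.1.1 - v p.1.2) / 2 * (-(w p.1.1 - w p.1.2) / 2) =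
      (∑ p : Corner ν, v p.1.1 * (w p.1.1 - w p.1.2) -
        ∑ p : Corner ν, v p.1.2 * (w p.1.1 - w p.1.2)) / 4 := by
    rw [← Finset.sum_sub_distrib, Finset.sum_div]
    exact Finset.sum_congr rfl fun _ _ => by ring
  have h5 : ∑ p : Corner ν, v p.1.1 * (w p.1.2 - w p.1.1) =
      - ∑ p : Corner ν, v p.1.1 * (w p.1.1 - w p.1.2) := by
    rw [← Finset.sum_neg_distrib]
    exact Finset.sum_congr rfl fun _ _ => by ring
  rw [h4, ← h2, h5]; ring

-- Subtracting a quarter of each difference times its plaquette, over ordered corners, moves the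
-- star vector onto the complement of the plaquettes. Each unordered corner occurs twice with the
-- same contribution, so the effective weight is one half.
omit [Fintype X] in
lemma placed_legOp (S : Leg ν → X) (O : Corner ν → X) (v : Leg ν → ℝ) :
    placed S (legOp v) = placed (Sum.elim S O) (extCoeff v) +
      (1 / 4 : ℝ) • ∑ p : Corner ν, (v p.1.1 - v p.1.2) • plaqVec S O p := by
  have key : ∀ x, placed S (legOp v) x = (placed (Sum.elim S O) (extCoeff v) +
      (1 / 4 : ℝ) • ∑ p : Corner ν, (v p.1.1 - v p.1.2) • plaqVec S O p) x := by
    intro x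
    set s : Leg ν → ℝ := fun a => Pi.single (M := fun _ => ℝ) (S a) 1 x with hs
    set o : Corner ν → ℝ := fun a => Pi.single (M := fun _ => ℝ) (O a) 1 x with ho
    have e1 := sum_corner_swap (fun p : Corner ν => (v p.1.1 - v p.1.2) * s p.1.1)
    have e2 := sum_corner_swap (fun p : Corner ν => (v p.1.1 - v p.1.2) * o p)
    have e3 := sum_corner (fun a b => (v a - v b) * s a)
    simp only [placed, plaqVec, Pi.add_apply, Pi.sub_apply, Finset.sum_apply, Pi.smul_apply,
      smul_eq_mul, Fintype.sum_sum_type, extCoeff, Sum.elim_inl, Sum.elim_inr, legOp]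
    simp only [Prod.fst_swap, Prod.snd_swap] at e1 e2
    have f1 : ∑ a, (v a + (∑ b, if a.1 ≠ b.1 then v a - v b else 0) / 2) * s a =
        ∑ a, v a * s a + (∑ p : Corner ν, (v p.1.1 - v p.1.2) * s p.1.1) / 2 := by
      rw [e3, Finset.sum_div, ← Finset.sum_add_distrib]
      refine Finset.sum_congr rfl fun a _ => ?_
      simp only [← ite_zero_mul, ← Finset.sum_mul]
      ring
    have f2 : ∑ p : Corner ν, -(v p.1.1 - v p.1.2) / 2 * o p =
        - (∑ p : Corner ν, (v p.1.1 - v p.1.2) * o p) / 2 := by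
      rw [← Finset.sum_neg_distrib, Finset.sum_div]
      exact Finset.sum_congr rfl fun _ _ => by ring
    have f3 : ∑ p : Corner ν, (v p.1.1 - v p.1.2) *
          (s p.1.1 - s p.1.2 + o p - o ⟨p.1.swap, p.2.symm⟩) =
        2 * (∑ p : Corner ν, (v p.1.1 - v p.1.2) * s p.1.1) +
          2 * ∑ p : Corner ν, (v p.1.1 - v p.1.2) * o p := by
      rw [two_mul, two_mul]
      nth_rewrite 2 [← e1]
      nth_rewrite 2 [← e2]
      simp only [← Finset.sum_add_distrib]
      exact Finset.sum_congr rfl fun _ _ => by ring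
    rw [f1, f2, f3]; ring
  exact funext key

end StarGeometry
end Hubbard
end

/-! ### Spectrum of the leg operator -/

noncomputable section
namespace Hubbard
section LegBasis
variable {ν : ℕ}

lemma legOp_eq_sum (v : Leg ν → ℝ) (a : Leg ν) :
    legOp v a = v a +
      (∑ m, if a.1 ≠ m then 2 * v a - (v (m, true) + v (m, false)) else 0) / 2 := by
  unfold legOp
  rw [Fintype.sum_prod_type]
  congr 2
  refine Finset.sum_congr rfl fun m _ => ?_
  rw [Fintype.sum_bool]
  split_ifs <;> ring

/-- The neighbours of a leg come in opposite pairs, on which an odd function cancels. What remains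
is half the degree 2(ν - 1), plus one. -/
lemma legOp_of_antisymm {v : Leg ν → ℝ} (h : ∀ m, v (m, true) + v (m, false) = 0) :
    legOp v = (ν : ℝ) • v := by
  funext a
  rw [legOp_eq_sum]
  simp only [h, sub_zero]
  have : (∑ m, if a.1 ≠ m then 2 * v a else 0) = (∑ m : Fin ν, 2 * v a) - 2 * v a := by
    rw [eq_sub_iff_add_eq]
    have h2 : 2 * v a = ∑ m, if a.1 = m then 2 * v a else 0 := by simp
    nth_rewrite 2 [h2]
    rw [← Finset.sum_add_distrib]
    exact Finset.sum_congr rfl fun m _ => by by_cases h : a.1 = m <;> simp [h]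
  rw [this]
  simp
  ring

lemma legOp_of_symm (u : Fin ν → ℝ) :
    legOp (fun a => u a.1) = fun a => (ν + 1) * u a.1 - ∑ m, u m := by
  funext a
  rw [legOp_eq_sum]
  have : (∑ m, if a.1 ≠ m then 2 * u a.1 - (u m + u m) else 0) =
      ∑ m : Fin ν, (2 * u a.1 - 2 * u m) :=
    Finset.sum_congr rfl fun m _ => by
      by_cases h : a.1 = m
      · subst h; simp
      · rw [if_pos h]; ring
  simp only
  have h2 : ∑ m, 2 * u m = 2 * ∑ m, u m := (Finset.mul_sum _ _ _).symm
  rw [this, Finset.sum_sub_distrib, h2, Finset.sum_const, Finset.card_univ,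
    Fintype.card_fin, nsmul_eq_mul]
  ring

/-- The constant vector is singled out because it gives the star state. Rows orthogonal to it have
sum zero, hence are eigenvectors for ν + 1. -/
lemma exists_orthogonal_of_const (hν : 0 < ν) :
    ∃ B : Fin ν → Fin ν → ℝ, (∀ i j, ∑ m, B i m * B j m = if i = j then 1 else 0) ∧
      ∀ m, B ⟨0, hν⟩ m = 1 / √(ν : ℝ) := by
  classical
  have hν' : (0 : ℝ) < ν := by exact_mod_cast hν
  let w : Fin ν → EuclideanSpace ℝ (Fin ν) := fun _ => WithLp.toLp 2 fun _ => 1 / √(ν : ℝ)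
  have hw : Orthonormal ℝ (({⟨0, hν⟩} : Set (Fin ν)).domRestrict w) := by
    constructor
    · intro i
      rw [EuclideanSpace.norm_eq]
      simp [w, Set.domRestrict, hν'.ne']
    · intro i j hij
      exact absurd (Subsingleton.elim i j) hij
  obtain ⟨b, hb⟩ := hw.exists_orthonormalBasis_extension_of_card_eq (by simp)
  refine ⟨fun i m => b i m, fun i j => ?_, fun m => ?_⟩
  · have := b.inner_eq_ite j i
    rw [PiLp.inner_apply] at this
    simpa [eq_comm] using this
  · have := hb ⟨0, hν⟩ rfl
    simp only [this, w]

/-- An orthonormal basis of functions on the legs: odd functions and even functions. -/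
def legBasis (B : Fin ν → Fin ν → ℝ) : Fin ν ⊕ Fin ν → Leg ν → ℝ :=
  Sum.elim (fun l a => if a.1 = l then (if a.2 then 1 else -1) / √2 else 0)
    (fun j a => B j a.1 / √2)

lemma legBasis_orthonormal {B : Fin ν → Fin ν → ℝ}
    (hB : ∀ i j, ∑ m, B i m * B j m = if i = j then 1 else 0) (i j : Fin ν ⊕ Fin ν) :
    ∑ a, legBasis B i a * legBasis B j a = if i = j then 1 else 0 := by
  have h2 : (√2 : ℝ) * √2 = 2 := Real.mul_self_sqrt (by norm_num)
  have h2' : (√2 : ℝ) ^ 2 = 2 := Real.sq_sqrt (by norm_num)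
  have h0 : (√2 : ℝ) ≠ 0 := by positivity
  rw [Fintype.sum_prod_type]
  rcases i with i | i <;> rcases j with j | j
  · simp only [legBasis, Sum.elim_inl, Fintype.sum_bool, Sum.inl.injEq, if_true,
      Bool.false_eq_true, if_false]
    by_cases h : i = j
    · subst h
      rw [Finset.sum_eq_single i, if_pos rfl, if_pos rfl, if_pos rfl]
      · field_simp; rw [h2']; norm_num
      · intro b _ hb; simp [hb]
      · simp
    · rw [if_neg h]
      refine Finset.sum_eq_zero fun m _ => ?_
      by_cases hm : m = i
      · subst hm; simp [h]
      · simp [hm]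
  · simp only [legBasis, Sum.elim_inl, Sum.elim_inr, Fintype.sum_bool, reduceCtorEq, if_true,
      Bool.false_eq_true, if_false]
    refine Finset.sum_eq_zero fun m _ => ?_
    split_ifs <;> ring
  · simp only [legBasis, Sum.elim_inl, Sum.elim_inr, Fintype.sum_bool, reduceCtorEq, if_true,
      Bool.false_eq_true, if_false]
    refine Finset.sum_eq_zero fun m _ => ?_
    split_ifs <;> ring
  · simp only [legBasis, Sum.elim_inr, Fintype.sum_bool, Sum.inr.injEq]
    rw [← hB i j]
    refine Finset.sum_congr rfl fun m _ => ?_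
    field_simp; rw [h2']; ring

lemma legBasis_complete {B : Fin ν → Fin ν → ℝ}
    (hB : ∀ i j, ∑ m, B i m * B j m = if i = j then 1 else 0) (a b : Leg ν) :
    ∑ i, legBasis B i a * legBasis B i b = if a = b then 1 else 0 := by
  let M : Matrix (Fin ν ⊕ Fin ν) (Leg ν) ℝ := Matrix.of (legBasis B)
  have h1 : M * M.transpose = 1 := by
    ext i j
    simp only [Matrix.mul_apply, Matrix.transpose_apply, M, Matrix.of_apply, Matrix.one_apply]
    exact legBasis_orthonormal hB i j
  have h2 : M.transpose * M = 1 :=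
    (Matrix.mul_eq_one_comm_of_card_eq _ _ _ (by simp [mul_two])).mp h1
  have := congrFun (congrFun h2 a) b
  simpa [Matrix.mul_apply, M, Matrix.one_apply] using this

lemma legOp_legBasis_inl (B : Fin ν → Fin ν → ℝ) (l : Fin ν) :
    legOp (legBasis B (.inl l)) = (ν : ℝ) • legBasis B (.inl l) := by
  refine legOp_of_antisymm fun m => ?_
  simp only [legBasis, Sum.elim_inl]
  split_ifs <;> simp_all
  ring

lemma legOp_legBasis_inr (B : Fin ν → Fin ν → ℝ) (j : Fin ν) (h : ∑ m, B j m = 0) :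
    legOp (legBasis B (.inr j)) = (ν + 1 : ℝ) • legBasis B (.inr j) := by
  have := legOp_of_symm (fun m => B j m / √2)
  rw [← Finset.sum_div, h] at this
  simp only [zero_div, sub_zero] at this
  exact this

lemma legOp_const (c : ℝ) : legOp (fun _ : Leg ν => c) = fun _ => c := by
  have := legOp_of_symm (ν := ν) (fun _ => c)
  simp only [Finset.sum_const, Finset.card_univ, Fintype.card_fin, nsmul_eq_mul] at this
  rw [this]; funext; ring

end LegBasis
end Hubbard
end

/-! ### Local bound on the double occupancy of a star -/

noncomputable section
namespace Hubbard
section LocalQuadratic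
variable {X : Type} [Fintype X] [DecidableEq X] {ν : ℕ}

/-- Because q < 1 the coefficient of y² can be raised to exactly one, at the price of a larger
multiple of ε². The coefficient one is what cancels the weight of the empty star. -/
lemma sq_le_of_le_mul_add {q x y ε : ℝ} (hq0 : 0 ≤ q) (hq : q < 1) (hx : 0 ≤ x)
    (h : x ≤ q * y + ε) : x ^ 2 ≤ y ^ 2 + ε ^ 2 / (1 - q ^ 2) := by
  have h1 : 0 < 1 - q ^ 2 := by nlinarith
  have h2 : x ^ 2 ≤ (q * y + ε) ^ 2 := pow_le_pow_left₀ hx h 2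
  refine h2.trans ?_
  rw [← sub_le_iff_le_add', le_div_iff₀ h1]
  nlinarith [sq_nonneg ((1 - q ^ 2) * y - q * ε)]

/-- The indices of the leg functions orthogonal to the constants. -/
abbrev LegIndex (hν : 0 < ν) : Type := Fin ν ⊕ {j : Fin ν // j ≠ ⟨0, hν⟩}

/-- The inclusion of `LegIndex` into the indices of `legBasis`. -/
def LegIndex.incl {hν : 0 < ν} : LegIndex hν → Fin ν ⊕ Fin ν := Sum.map id Subtype.val

/-- Eigenvalue of `legOp`. -/
def LegIndex.eigenvalue {hν : 0 < ν} : LegIndex hν → ℝ := Sum.elim (fun _ => ν) (fun _ => ν + 1)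

lemma LegIndex.incl_injective {hν : 0 < ν} : Function.Injective (LegIndex.incl (hν := hν)) :=
  Function.Injective.sumMap Function.injective_id Subtype.val_injective

lemma LegIndex.one_le_eigenvalue {hν : 0 < ν} (i : LegIndex hν) : 1 ≤ i.eigenvalue := by
  have : (1 : ℝ) ≤ ν := by exact_mod_cast hν
  rcases i with i | i <;> simp only [LegIndex.eigenvalue, Sum.elim_inl, Sum.elim_inr] <;> linarith

/-- The weights are 1/(ν+1) on all 2ν - 1 modes, plus the excess 1/ν - 1/(ν+1) on the ν odd modes.
Each of the two uniform sums is bounded by half of its number of modes plus one. -/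
lemma norm_weighted_pair_sum_le (hν : 0 < ν) (k : LegIndex hν → X → ℝ)
    (hk : ∀ i j, k i ⬝ᵥ k j = if i = j then 1 else 0) (Φ : Fock (X × Fin 2)) :
    ‖(∑ i, ((i.eigenvalue⁻¹ : ℝ) : ℂ) • pairAnn (k i)) Φ‖ ≤
      (ν / (ν + 1) + 1 / (2 * ν)) * ‖Φ‖ := by
  have hν' : (0 : ℝ) < ν := by exact_mod_cast hν
  have h1 := norm_sum_pairAnn_le k hk Φ
  have h2 := norm_sum_pairAnn_le (fun l => k (.inl l)) (fun i j => by rw [hk]; simp) Φ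
  have hcard : (Fintype.card (LegIndex hν) : ℝ) = 2 * ν - 1 := by
    rw [Fintype.card_sum, Fintype.card_fin, Fintype.card_subtype_compl, Fintype.card_fin,
      Fintype.card_subtype_eq, Nat.cast_add, Nat.cast_sub hν]
    push_cast; ring
  rw [hcard] at h1
  rw [Fintype.card_fin] at h2
  set a : ℝ := 1 / (ν + 1)
  set b : ℝ := 1 / (ν * (ν + 1))
  have e : (∑ i, ((i.eigenvalue⁻¹ : ℝ) : ℂ) • pairAnn (k i)) =
      (a : ℂ) • (∑ i, pairAnn (k i)) + (b : ℂ) • ∑ l, pairAnn (k (.inl l)) := by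
    have hab : (ν : ℝ)⁻¹ = a + b := by simp only [a, b]; field_simp
    have ha : ((ν : ℝ) + 1)⁻¹ = a := by simp [a]
    rw [Fintype.sum_sum_type, Fintype.sum_sum_type]
    simp only [LegIndex.eigenvalue, Sum.elim_inl, Sum.elim_inr, hab, ha, ← Finset.smul_sum]
    push_cast
    module
  have ha0 : 0 ≤ a := by positivity
  have hb0 : 0 ≤ b := by positivity
  rw [e, LinearMap.add_apply, LinearMap.smul_apply, LinearMap.smul_apply]
  refine (norm_add_le _ _).trans ?_
  rw [norm_smul, norm_smul, Complex.norm_real, Complex.norm_real, Real.norm_of_nonneg ha0,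
    Real.norm_of_nonneg hb0]
  calc _ ≤ a * ((2 * ν - 1 + 1) / 2 * ‖Φ‖) + b * ((ν + 1) / 2 * ‖Φ‖) := by gcongr
    _ = _ := by simp only [a, b]; field_simp; ring

/-- Double occupancy of the symmetric state on the legs is controlled by double occupancy of the
legs and by the plaquettes. -/
theorem norm_double_occupancy_le (hν : 2 ≤ ν) {S : Leg ν → X} {O : Corner ν → X}
    (hinj : Function.Injective (Sum.elim S O)) (Φ : Fock (X × Fin 2)) :
    ‖pairAnn (placed S fun _ => 1 / √(2 * ν)) Φ‖ ≤
      (ν / (ν + 1) + 1 / (2 * ν)) * ‖star (pairAnn (placed S fun _ => 1 / √(2 * ν))) Φ‖ +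
        (∑ a, ‖pairAnn (Pi.single (S a) 1) Φ‖ +
          (2 * ν) * ∑ p, ∑ σ, ‖ann (plaqVec S O p) σ Φ‖) := by
  have hν0 : 0 < ν := by omega
  have hν' : (2 : ℝ) ≤ ν := by exact_mod_cast hν
  obtain ⟨B, hB, hB0⟩ := exists_orthogonal_of_const hν0
  set q : ℝ := ν / (ν + 1) + 1 / (2 * ν) with hq
  have hq0 : 0 ≤ q := by positivity
  have hS : Function.Injective S := fun a b h => by
    have : (Sum.elim S O) (.inl a) = (Sum.elim S O) (.inl b) := h
    simpa using hinj this
  set d : X → ℝ := placed S fun _ => 1 / √(2 * ν) with hd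
  have hdB : legBasis B (.inr ⟨0, hν0⟩) = fun _ => 1 / √(2 * (ν : ℝ)) := by
    funext a
    simp only [legBasis, Sum.elim_inr, hB0]
    rw [Real.sqrt_mul (by norm_num)]
    field_simp
  set κ : LegIndex hν0 → X → ℝ := fun i => placed (Sum.elim S O) (extCoeff (legBasis B i.incl))
  -- A constant function has no differences, so the star state needs no plaquette correction and is
  -- its own extension.
  have hdκ : d = placed (Sum.elim S O) (extCoeff (legBasis B (.inr ⟨0, hν0⟩))) := by
    have := placed_legOp S O (fun _ => 1 / √(2 * (ν : ℝ)))
    rw [legOp_const] at this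
    rw [hdB, hd, this]
    simp
  have hdd : d ⬝ᵥ d = 1 := by
    have := legBasis_orthonormal hB (.inr ⟨0, hν0⟩) (.inr ⟨0, hν0⟩)
    rw [hd, placed_dotProduct hS]
    simpa only [hdB, if_true] using this
  have hsum0 : ∀ j : {j : Fin ν // j ≠ ⟨0, hν0⟩}, ∑ m, B j m = 0 := by
    intro j
    have h1 := hB j ⟨0, hν0⟩
    rw [if_neg j.2] at h1
    simp only [hB0, ← Finset.sum_mul] at h1
    have : (1 : ℝ) / √ν ≠ 0 := by positivity
    exact (mul_eq_zero.mp h1).resolve_right this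
  have heig : ∀ i : LegIndex hν0,
      legOp (legBasis B i.incl) = i.eigenvalue • legBasis B i.incl := by
    rintro (i | i)
    · exact legOp_legBasis_inl B i
    · exact legOp_legBasis_inr B _ (hsum0 i)
  have hpos : ∀ i : LegIndex hν0, 0 < i.eigenvalue := fun i =>
    lt_of_lt_of_le one_pos i.one_le_eigenvalue
  have hdotκ : ∀ (v : Leg ν → ℝ) (i : LegIndex hν0),
      placed (Sum.elim S O) (extCoeff v) ⬝ᵥ κ i =
        i.eigenvalue * ∑ a, v a * legBasis B i.incl a := by
    intro v i
    simp only [κ]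
    rw [placed_dotProduct hinj, extCoeff_dot, heig, Finset.mul_sum]
    refine Finset.sum_congr rfl fun a _ => ?_
    rw [Pi.smul_apply, smul_eq_mul]; ring
  have hκκ : ∀ i j, κ i ⬝ᵥ κ j = if i = j then j.eigenvalue else 0 := by
    intro i j
    rw [hdotκ, legBasis_orthonormal hB]
    simp [LegIndex.incl_injective.eq_iff]
  have hdκ0 : ∀ i, d ⬝ᵥ κ i = 0 := by
    intro i
    rw [hdκ, hdotκ, legBasis_orthonormal hB, if_neg, mul_zero]
    rcases i with i | i
    · simp [LegIndex.incl]
    · simpa [LegIndex.incl] using i.2.symm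
  set u : LegIndex hν0 → X → ℝ := fun i => (√i.eigenvalue)⁻¹ • κ i with hu
  have huu : ∀ i j, u i ⬝ᵥ u j = if i = j then 1 else 0 := by
    intro i j
    simp only [hu, smul_dotProduct, dotProduct_smul, hκκ, smul_eq_mul]
    split_ifs with h
    · subst h
      have := Real.mul_self_sqrt (hpos i).le
      have h0 : √i.eigenvalue ≠ 0 := (Real.sqrt_pos.mpr (hpos i)).ne'
      field_simp
      nlinarith
    · simp
  set k : LegIndex hν0 → X → ℝ := fun i => i.eigenvalue⁻¹ • κ i with hk
  set c : LegIndex hν0 → Corner ν → ℝ := fun i p =>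
    i.eigenvalue⁻¹ * ((1 / 4) * (legBasis B i.incl p.1.1 - legBasis B i.incl p.1.2)) with hc
  set r : LegIndex hν0 → X → ℝ := fun i => ∑ p, c i p • plaqVec S O p with hr
  have hku : ∀ i, k i = (√i.eigenvalue)⁻¹ • u i := by
    intro i
    simp only [hk, hu, smul_smul]
    rw [← mul_inv, Real.mul_self_sqrt (hpos i).le]
  -- `placed_legOp` divided by the eigenvalue: `k i` has squared length 1/λ and is orthogonal to
  -- `d`, while `r i` consists of plaquette states.
  have hkr : ∀ i, k i + r i = placed S (legBasis B i.incl) := by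
    intro i
    have h1 := placed_legOp S O (legBasis B i.incl)
    rw [heig] at h1
    have h2 : placed S (i.eigenvalue • legBasis B i.incl) =
        i.eigenvalue • placed S (legBasis B i.incl) := by
      simp [placed, Finset.smul_sum, smul_smul]
    rw [h2] at h1
    have h3 : r i = i.eigenvalue⁻¹ • ((1 / 4 : ℝ) • ∑ p : Corner ν,
        (legBasis B i.incl p.1.1 - legBasis B i.incl p.1.2) • plaqVec S O p) := by
      simp only [hr, hc, Finset.smul_sum, smul_smul]
    rw [h3]
    simp only [hk]
    rw [← smul_add, ← h1, smul_smul, inv_mul_cancel₀ (hpos i).ne', one_smul]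
  have hWW : pairAnn d + ∑ i, pairAnn (k i + r i) = ∑ a, pairAnn (Pi.single (S a) 1) := by
    rw [← sum_pairAnn_placed S _ (legBasis_complete hB), Fintype.sum_sum_type,
      Fintype.sum_sum_type]
    rw [← Finset.add_sum_erase _ (fun j => pairAnn (placed S (legBasis B (.inr j))))
      (Finset.mem_univ (⟨0, hν0⟩ : Fin ν)), hdB]
    have : ∑ j ∈ Finset.univ.erase (⟨0, hν0⟩ : Fin ν), pairAnn (placed S (legBasis B (.inr j))) =
        ∑ j : {j : Fin ν // j ≠ ⟨0, hν0⟩}, pairAnn (placed S (legBasis B (.inr j))) :=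
      Finset.sum_subtype _ (by simp) _
    rw [this]
    simp only [hkr]
    rw [← hd]
    simp only [LegIndex.incl, Sum.map_inl, Sum.map_inr, id]
    abel
  have hcle : ∀ i p, |c i p| ≤ 1 := by
    intro i p
    have hW : ∀ a, |legBasis B i.incl a| ≤ 1 := by
      intro a
      have h1 := legBasis_orthonormal hB i.incl i.incl
      rw [if_pos rfl] at h1
      have h2 := Finset.single_le_sum (f := fun a => legBasis B i.incl a * legBasis B i.incl a)
        (fun a _ => mul_self_nonneg _) (Finset.mem_univ a)
      rw [h1] at h2
      exact abs_le_one_iff_mul_self_le_one.mpr h2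
    have h1 : i.eigenvalue⁻¹ ≤ 1 := inv_le_one_of_one_le₀ i.one_le_eigenvalue
    have h2 : |(1 / 4) * (legBasis B i.incl p.1.1 - legBasis B i.incl p.1.2)| ≤ 1 := by
      have ha := abs_le.mp (hW p.1.1)
      have hb := abs_le.mp (hW p.1.2)
      rw [abs_le]; constructor <;> linarith
    simp only [hc]
    rw [abs_mul, abs_of_pos (inv_pos.mpr (hpos i))]
    exact mul_le_one₀ h1 (abs_nonneg _) h2
  have hrle : ∀ i σ, ‖ann (r i) σ Φ‖ ≤ ∑ p, ‖ann (plaqVec S O p) σ Φ‖ := by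
    intro i σ
    simp only [hr]
    rw [ann_sum, LinearMap.sum_apply]
    refine (norm_sum_le _ _).trans (Finset.sum_le_sum fun p _ => ?_)
    rw [ann_smul, LinearMap.smul_apply, norm_smul, Complex.norm_real, Real.norm_eq_abs]
    exact mul_le_of_le_one_left (norm_nonneg _) (hcle i p)
  have hqle : ∀ Ψ : Fock (X × Fin 2), ‖(∑ i, pairAnn (k i)) Ψ‖ ≤ q * ‖Ψ‖ := by
    intro Ψ
    have := norm_weighted_pair_sum_le hν0 u huu Ψ
    convert this using 5 with i
    rw [hku, pairAnn_smul, inv_pow, Real.sq_sqrt (hpos _).le]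
  have hmain := norm_pairAnn_le hdd k r
    (fun i => by
      simp only [hk]
      rw [smul_dotProduct, dotProduct_comm, hdκ0, smul_zero])
    (fun i => by
      rw [hku, smul_dotProduct, dotProduct_smul, huu, if_pos rfl]
      simp only [smul_eq_mul, mul_one]
      rw [← mul_inv, Real.mul_self_sqrt (hpos i).le]
      exact inv_le_one_of_one_le₀ i.one_le_eigenvalue)
    (fun i => by rw [hkr, placed_dotProduct hS, legBasis_orthonormal hB, if_pos rfl])
    q hqle hq0 Φ
  rw [hWW] at hmain
  set α := ∑ a, ‖pairAnn (Pi.single (S a) 1) Φ‖ with hα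
  set β := ∑ p, ∑ σ, ‖ann (plaqVec S O p) σ Φ‖ with hβ
  have hε : ‖(∑ a, pairAnn (Pi.single (S a) 1)) Φ‖ +
      ∑ i, (‖ann (r i) 0 Φ‖ + ‖ann (r i) 1 Φ‖) ≤ α + 2 * ν * β := by
    refine add_le_add ?_ ?_
    · rw [LinearMap.sum_apply]; exact norm_sum_le _ _
    · have : ∀ i ∈ (Finset.univ : Finset (LegIndex hν0)),
          ‖ann (r i) 0 Φ‖ + ‖ann (r i) 1 Φ‖ ≤ β := by
        intro i _
        refine (add_le_add (hrle i 0) (hrle i 1)).trans (le_of_eq ?_)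
        rw [hβ, ← Finset.sum_add_distrib]
        simp [Fin.sum_univ_two]
      refine (Finset.sum_le_sum this).trans ?_
      have hβ0 : 0 ≤ β := by positivity
      have hcard : Fintype.card (LegIndex hν0) ≤ 2 * ν := by
        rw [Fintype.card_sum, Fintype.card_fin, Fintype.card_subtype_compl, Fintype.card_fin]
        omega
      have hcard' : (Fintype.card (LegIndex hν0) : ℝ) ≤ 2 * ν := by exact_mod_cast hcard
      rw [Finset.sum_const, Finset.card_univ, nsmul_eq_mul]
      gcongr
  linarith

/-- `C` is chosen before the site set `X`, so it depends on ν alone. This is the source of the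
independence of L. -/
theorem exists_double_occupancy_bound (hν : 2 ≤ ν) : ∃ C : ℝ, 0 ≤ C ∧
    ∀ (X : Type) [Fintype X] [DecidableEq X] (S : Leg ν → X) (O : Corner ν → X),
      Function.Injective (Sum.elim S O) → ∀ Φ : Fock (X × Fin 2),
      ‖pairAnn (placed S fun _ => 1 / √(2 * ν)) Φ‖ ^ 2 ≤
        ‖star (pairAnn (placed S fun _ => 1 / √(2 * ν))) Φ‖ ^ 2 +
        C * (∑ a, ‖pairAnn (Pi.single (S a) 1) Φ‖ ^ 2 +
          ∑ p, ∑ σ, ‖ann (plaqVec S O p) σ Φ‖ ^ 2) := by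
  have hν' : (2 : ℝ) ≤ ν := by exact_mod_cast hν
  set q : ℝ := ν / (ν + 1) + 1 / (2 * ν) with hq
  have hq0 : 0 ≤ q := by positivity
  -- Equivalent to 1/(2ν) < 1/(ν+1), that is, to ν > 1.
  have hq1 : q < 1 := by
    rw [hq, div_add_div _ _ (by positivity) (by positivity), div_lt_one (by positivity)]
    nlinarith
  have hq2 : 0 < 1 - q ^ 2 := by nlinarith
  set n₁ : ℝ := (Fintype.card (Leg ν) : ℝ) with hn₁
  set n₂ : ℝ := (Fintype.card (Corner ν) : ℝ) with hn₂
  set n₃ : ℝ := 2 * ν with hn₃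
  have hn₁0 : 0 ≤ n₁ := Nat.cast_nonneg _
  have hn₂0 : 0 ≤ n₂ := Nat.cast_nonneg _
  -- The numerator comes from (α + n₃β)² ≤ 2α² + 2n₃²β² and Cauchy-Schwarz over the legs, the
  -- corners and the two spins.
  refine ⟨(2 * n₁ + 4 * n₃ ^ 2 * n₂) / (1 - q ^ 2), by positivity, ?_⟩
  intro X _ _ S O hinj Φ
  have hlin := norm_double_occupancy_le hν hinj Φ
  rw [← hq, ← hn₃] at hlin
  set d : X → ℝ := placed S fun _ => 1 / √n₃ with hd
  set α := ∑ a, ‖pairAnn (Pi.single (S a) 1) Φ‖ with hα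
  set β := ∑ p, ∑ σ, ‖ann (plaqVec S O p) σ Φ‖ with hβ
  have hfin := sq_le_of_le_mul_add hq0 hq1 (norm_nonneg _) hlin
  refine hfin.trans ?_
  set α₂ := ∑ a, ‖pairAnn (Pi.single (S a) 1) Φ‖ ^ 2 with hα₂
  set β₂ := ∑ p, ∑ σ, ‖ann (plaqVec S O p) σ Φ‖ ^ 2 with hβ₂
  have h1 : α ^ 2 ≤ n₁ * α₂ := by
    have := sq_sum_le_card_mul_sum_sq (s := (Finset.univ : Finset (Leg ν)))
      (f := fun a => ‖pairAnn (Pi.single (S a) 1) Φ‖)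
    simpa [hn₁] using this
  have h2 : β ^ 2 ≤ n₂ * (2 * β₂) := by
    have := sq_sum_le_card_mul_sum_sq (s := (Finset.univ : Finset (Corner ν)))
      (f := fun p => ∑ σ, ‖ann (plaqVec S O p) σ Φ‖)
    refine this.trans ?_
    have e : 2 * β₂ = ∑ p, 2 * ∑ σ, ‖ann (plaqVec S O p) σ Φ‖ ^ 2 := Finset.mul_sum _ _ _
    rw [Finset.card_univ, ← hn₂, e]
    refine mul_le_mul_of_nonneg_left (Finset.sum_le_sum fun p _ => ?_) hn₂0
    have h3 := sq_sum_le_card_mul_sum_sq (s := (Finset.univ : Finset (Fin 2)))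
      (f := fun σ => ‖ann (plaqVec S O p) σ Φ‖)
    simpa using h3
  have hα0 : 0 ≤ α₂ := Finset.sum_nonneg fun _ _ => sq_nonneg _
  have hβ0 : 0 ≤ β₂ := Finset.sum_nonneg fun _ _ => Finset.sum_nonneg fun _ _ => sq_nonneg _
  clear_value α₂ β₂ α β n₁ n₂ n₃ q
  have h3 : (α + n₃ * β) ^ 2 ≤ (2 * n₁ + 4 * n₃ ^ 2 * n₂) * (α₂ + β₂) := by
    have e1 : (α + n₃ * β) ^ 2 ≤ 2 * α ^ 2 + 2 * (n₃ ^ 2 * β ^ 2) := by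
      nlinarith [sq_nonneg (α - n₃ * β)]
    have e2 : n₃ ^ 2 * β ^ 2 ≤ n₃ ^ 2 * (n₂ * (2 * β₂)) := by gcongr
    have e3 : 0 ≤ n₁ * β₂ := by positivity
    have e4 : 0 ≤ n₃ ^ 2 * n₂ * α₂ := by positivity
    nlinarith
  rw [div_mul_eq_mul_div]
  exact add_le_add_right (div_le_div_of_nonneg_right h3 hq2.le) _

end LocalQuadratic
end Hubbard
end

/-! ### Spin operators and singlets -/

noncomputable section
namespace Hubbard
section SpinHop
variable (X : Type) [Fintype X] [DecidableEq X]

/-- The operator that changes spin `τ` into spin `σ`, summed over the sites. -/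
def spinHop (σ τ : Fin 2) : Op (X × Fin 2) := ∑ x : X, creation (x, σ) * annihilation (x, τ)

/-- The operator annihilating a singlet on the sites `x` and `y`. -/
def singletAnn {X : Type} [Fintype X] [DecidableEq X] (x y : X) : Op (X × Fin 2) :=
  annihilation (x, 1) * annihilation (y, 0) + annihilation (y, 1) * annihilation (x, 0)

variable {X}

lemma star_spinHop (σ τ : Fin 2) : star (spinHop X σ τ) = spinHop X τ σ := by
  simp [spinHop, star_sum, star_mul, star_creation, star_annihilation]

lemma creation_mul_creation {ι : Type} [Fintype ι] [DecidableEq ι] (i j : ι) :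
    creation i * creation j = - (creation j * creation i) := by
  have := congrArg star (annihilation_mul_annihilation j i)
  simpa [star_mul, star_annihilation] using this

lemma spinHop_mul_annihilation (σ τ ρ : Fin 2) (y : X) :
    spinHop X σ τ * annihilation (y, ρ) =
      annihilation (y, ρ) * spinHop X σ τ - if ρ = σ then annihilation (y, τ) else 0 := by
  unfold spinHop
  rw [Finset.sum_mul, Finset.mul_sum]
  have h : ∀ x : X, creation (x, σ) * annihilation (x, τ) * annihilation (y, ρ) =
      annihilation (y, ρ) * (creation (x, σ) * annihilation (x, τ)) -
        if y = x then (if ρ = σ then annihilation (x, τ) else 0) else 0 := by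
    intro x
    have h1 := annihilation_mul_annihilation (x, τ) (y, ρ)
    have h2 := annihilation_mul_creation (y, ρ) (x, σ)
    have h3 : (if y = x then (if ρ = σ then annihilation (x, τ) else 0) else 0) =
        (if (y, ρ) = (x, σ) then 1 else 0) * annihilation (x, τ) := by
      by_cases hy : y = x <;> by_cases hr : ρ = σ <;> simp [hy, hr]
    rw [h3]
    linear_combination (norm := noncomm_ring) creation (x, σ) * h1 - h2 * annihilation (x, τ)
  simp_rw [h, Finset.sum_sub_distrib]
  simp

lemma spinHop_mul_creation (σ τ ρ : Fin 2) (y : X) :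
    spinHop X σ τ * creation (y, ρ) =
      creation (y, ρ) * spinHop X σ τ + if ρ = τ then creation (y, σ) else 0 := by
  have h := congrArg star (spinHop_mul_annihilation τ σ ρ y)
  have h2 : star (if ρ = τ then annihilation (y, σ) else 0) =
      if ρ = τ then creation (y, σ) else 0 := by
    split_ifs <;> simp [star_annihilation]
  rw [star_sub, star_mul, star_mul, star_spinHop, star_annihilation, h2] at h
  rw [h]; noncomm_ring

lemma commute_spinHop_pair (σ τ : Fin 2) (x y : X) :
    Commute (spinHop X σ τ) (∑ ρ, creation (x, ρ) * annihilation (y, ρ)) := by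
  unfold Commute SemiconjBy
  rw [Finset.mul_sum, Finset.sum_mul]
  have h : ∀ ρ, spinHop X σ τ * (creation (x, ρ) * annihilation (y, ρ)) =
      creation (x, ρ) * annihilation (y, ρ) * spinHop X σ τ
        + (if ρ = τ then creation (x, σ) * annihilation (y, τ) else 0)
        - (if ρ = σ then creation (x, σ) * annihilation (y, τ) else 0) := by
    intro ρ
    have h1 := spinHop_mul_creation σ τ ρ x
    have h2 := spinHop_mul_annihilation σ τ ρ y
    have h3 : (if ρ = τ then creation (x, σ) * annihilation (y, τ) else 0) =
        (if ρ = τ then creation (x, σ) else 0) * annihilation (y, ρ) := by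
      split_ifs with h <;> simp [h]
    have h4 : (if ρ = σ then creation (x, σ) * annihilation (y, τ) else 0) =
        creation (x, ρ) * (if ρ = σ then annihilation (y, τ) else 0) := by
      split_ifs with h <;> simp [h]
    rw [h3, h4]
    linear_combination (norm := noncomm_ring) h1 * annihilation (y, ρ) + creation (x, ρ) * h2
  simp_rw [h, Finset.sum_sub_distrib, Finset.sum_add_distrib]
  simp

/-- With n the spin-summed occupation, n↑n↓ = (n² - n)/2. In this form the invariance of the
interaction under spin rotations is visible. -/
lemma double_occupancy_eq (x : X) :
    (creation (x, 0) * annihilation (x, 0)) * (creation (x, 1) * annihilation (x, 1)) =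
      (1 / 2 : ℂ) • ((∑ ρ : Fin 2, creation (x, ρ) * annihilation (x, ρ)) ^ 2 -
        ∑ ρ : Fin 2, creation (x, ρ) * annihilation (x, ρ)) := by
  have hs : ∀ σ, num (Pi.single x 1) σ = creation (x, σ) * annihilation (x, σ) := fun σ => by
    rw [num, cre_single, ann_single]
  simp only [← hs, Fin.sum_univ_two]
  have h1 : (Pi.single x 1 : X → ℝ) ⬝ᵥ Pi.single x 1 = 1 := by simp
  have h2 := num_mul_self h1 0
  have h3 := num_mul_self h1 1
  have h4 := (commute_num_num_spin (f := (Pi.single x 1 : X → ℝ)) 0 1).eq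
  have h5 : (num (Pi.single x 1) 0 + num (Pi.single x 1) 1) ^ 2 -
      (num (Pi.single x 1) 0 + num (Pi.single x 1) 1) =
      (2 : ℂ) • (num (Pi.single x 1 : X → ℝ) 0 * num (Pi.single x 1) 1) := by
    rw [two_smul]
    linear_combination (norm := noncomm_ring) h2 + h3 - h4
  rw [h5, smul_smul]; norm_num

lemma star_mul_pairAnn_single (x : X) :
    (creation (x, 0) * annihilation (x, 0)) * (creation (x, 1) * annihilation (x, 1)) =
      star (pairAnn (Pi.single x 1)) * pairAnn (Pi.single x 1) := by
  rw [star_pairAnn_mul, num, num, cre_single, ann_single, cre_single, ann_single]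

lemma commute_spinHop_double (σ τ : Fin 2) (x : X) :
    Commute (spinHop X σ τ)
      ((creation (x, 0) * annihilation (x, 0)) * (creation (x, 1) * annihilation (x, 1))) := by
  rw [double_occupancy_eq]
  have h := commute_spinHop_pair σ τ x x
  exact ((h.pow_right 2).sub_right h).smul_right _

lemma totalNumber_eq : totalNumber (X × Fin 2) = spinHop X 0 0 + spinHop X 1 1 := by
  unfold totalNumber spinHop
  rw [Fintype.sum_prod_type, ← Finset.sum_add_distrib]
  simp [Fin.sum_univ_two]

lemma commute_spinHop_totalNumber (σ τ : Fin 2) :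
    Commute (spinHop X σ τ) (totalNumber (X × Fin 2)) := by
  unfold totalNumber
  rw [Fintype.sum_prod_type]
  exact Commute.sum_right _ _ _ fun x _ => commute_spinHop_pair σ τ x x

lemma spinHop_mul_spinHop_sub (σ τ σ' τ' : Fin 2) :
    spinHop X σ τ * spinHop X σ' τ' = spinHop X σ' τ' * spinHop X σ τ
      + (if σ' = τ then spinHop X σ τ' else 0) - (if τ' = σ then spinHop X σ' τ else 0) := by
  have h : ∀ x : X, spinHop X σ τ * (creation (x, σ') * annihilation (x, τ')) =
      creation (x, σ') * annihilation (x, τ') * spinHop X σ τ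
        + (if σ' = τ then creation (x, σ) * annihilation (x, τ') else 0)
        - (if τ' = σ then creation (x, σ') * annihilation (x, τ) else 0) := by
    intro x
    have h1 := spinHop_mul_creation σ τ σ' x
    have h2 := spinHop_mul_annihilation σ τ τ' x
    have h3 : (if σ' = τ then creation (x, σ) * annihilation (x, τ') else 0) =
        (if σ' = τ then creation (x, σ) else 0) * annihilation (x, τ') := by
      split_ifs with h <;> simp
    have h4 : (if τ' = σ then creation (x, σ') * annihilation (x, τ) else 0) =
        creation (x, σ') * (if τ' = σ then annihilation (x, τ) else 0) := by
      split_ifs with h <;> simp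
    rw [h3, h4]
    linear_combination (norm := noncomm_ring)
      h1 * annihilation (x, τ') + creation (x, σ') * h2
  conv_lhs => rw [show spinHop X σ' τ' = ∑ x : X, creation (x, σ') * annihilation (x, τ') from rfl]
  rw [Finset.mul_sum]
  simp_rw [h, Finset.sum_sub_distrib, Finset.sum_add_distrib, ← Finset.sum_mul]
  congr 1
  · congr 1
    split_ifs <;> simp [spinHop]
  · split_ifs <;> simp [spinHop]

lemma commute_annihilation_num_of_ne {i j : X × Fin 2} (h : i ≠ j) :
    Commute (annihilation i) (creation j * annihilation j) := by
  have h1 := annihilation_mul_creation i j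
  rw [if_neg h] at h1
  have h2 := annihilation_mul_annihilation i j
  unfold Commute SemiconjBy
  linear_combination (norm := noncomm_ring) h1 * annihilation j - creation j * h2

/-- Normal ordering of S⁻S⁺ leaves the number of down electrons minus an exchange term. The singlet
sum is that exchange term together with a density-density term, which makes up n↑n↓. -/
lemma spinHop_lower_mul_raise :
    spinHop X 1 0 * spinHop X 0 1 = spinHop X 1 1 + spinHop X 0 0 * spinHop X 1 1 -
      (1 / 2 : ℂ) • ∑ x : X, ∑ y : X, star (singletAnn x y) * singletAnn x y := by
  set Q₁ : X → X → Op (X × Fin 2) := fun x y =>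
    creation (y, 0) * creation (x, 1) * (annihilation (x, 1) * annihilation (y, 0)) with hQ₁
  set Q₂ : X → X → Op (X × Fin 2) := fun x y =>
    creation (y, 0) * creation (x, 1) * (annihilation (y, 1) * annihilation (x, 0)) with hQ₂
  have hB : ∀ x y : X, star (singletAnn x y) * singletAnn x y =
      (Q₁ x y + Q₁ y x) + (Q₂ x y + Q₂ y x) := by
    intro x y
    simp only [singletAnn, star_add, star_mul, star_annihilation, hQ₁, hQ₂]
    noncomm_ring
  have hsum : (1 / 2 : ℂ) • ∑ x : X, ∑ y : X, star (singletAnn x y) * singletAnn x y =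
      ∑ x, ∑ y, Q₁ x y + ∑ x, ∑ y, Q₂ x y := by
    simp_rw [hB, Finset.sum_add_distrib]
    rw [Finset.sum_comm (f := fun x y => Q₁ y x), Finset.sum_comm (f := fun x y => Q₂ y x)]
    module
  have h1 : ∑ x, ∑ y, Q₁ x y = spinHop X 0 0 * spinHop X 1 1 := by
    unfold spinHop
    rw [Finset.sum_mul_sum, Finset.sum_comm]
    refine Finset.sum_congr rfl fun y _ => Finset.sum_congr rfl fun x _ => ?_
    have h := (commute_annihilation_num_of_ne (i := (y, 0)) (j := (x, 1)) (by simp)).eq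
    simp only [hQ₁]
    linear_combination (norm := noncomm_ring) - (creation (y, 0) * h)
  have h2 : spinHop X 1 0 * spinHop X 0 1 = spinHop X 1 1 - ∑ x, ∑ y, Q₂ x y := by
    unfold spinHop
    rw [Finset.sum_mul_sum]
    have h : ∀ x y : X, creation (x, 1) * annihilation (x, 0) *
        (creation (y, 0) * annihilation (y, 1)) =
        (if x = y then creation (x, 1) * annihilation (y, 1) else 0) - Q₂ x y := by
      intro x y
      have e1 := annihilation_mul_creation (x, (0 : Fin 2)) (y, 0)
      have e2 := creation_mul_creation (x, (1 : Fin 2)) (y, 0)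
      have e3 := annihilation_mul_annihilation (x, (0 : Fin 2)) (y, 1)
      have e4 : (if x = y then creation (x, (1 : Fin 2)) * annihilation (y, (1 : Fin 2)) else 0) =
          creation (x, (1 : Fin 2)) * (if (x, (0 : Fin 2)) = (y, 0) then 1 else 0) * annihilation (y, (1 : Fin 2)) := by
        by_cases h : x = y <;> simp [h]
      rw [e4]
      simp only [hQ₂]
      linear_combination (norm := noncomm_ring) creation (x, 1) * e1 * annihilation (y, 1)
        - creation (x, 1) * creation (y, 0) * e3
        + e2 * annihilation (y, 1) * annihilation (x, 0)
    simp_rw [h, Finset.sum_sub_distrib]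
    simp
  rw [h2, hsum, h1]; abel

lemma totalSpin_zero : totalSpin X 0 = (1 / 2 : ℂ) • (spinHop X 0 1 + spinHop X 1 0) := by
  simp [totalSpin, pauli, spinHop, Fin.sum_univ_two, Finset.sum_add_distrib]
  abel

lemma totalSpin_one :
    totalSpin X 1 = (Complex.I / 2) • (spinHop X 1 0 - spinHop X 0 1) := by
  simp [totalSpin, pauli, spinHop, Fin.sum_univ_two, Finset.sum_add_distrib, Finset.smul_sum]
  simp_rw [← Finset.smul_sum]
  module

lemma totalSpin_two : totalSpin X 2 = (1 / 2 : ℂ) • (spinHop X 0 0 - spinHop X 1 1) := by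
  simp [totalSpin, pauli, spinHop, Fin.sum_univ_two, Finset.sum_add_distrib, sub_eq_add_neg]

lemma spinLowering_eq : spinLowering X = spinHop X 1 0 := by
  rw [spinLowering, totalSpin_zero, totalSpin_one]
  simp only [smul_add, smul_smul]
  have h1 : Complex.I * (Complex.I / 2) = - (1 / 2) := by
    linear_combination (1 / 2 : ℂ) * Complex.I_mul_I
  simp only [smul_sub, h1]
  module

/-- On N electrons the first two terms give (N/2)(N/2 + 1). Every singlet lowers the spin below
this, so maximal spin means that all `singletAnn x y` vanish. -/
lemma totalSpinSq_eq : totalSpinSq X =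
    (1 / 2 : ℂ) • totalNumber (X × Fin 2) + (1 / 4 : ℂ) • totalNumber (X × Fin 2) ^ 2 -
      (1 / 2 : ℂ) • ∑ x : X, ∑ y : X, star (singletAnn x y) * singletAnn x y := by
  have h1 := spinHop_lower_mul_raise (X := X)
  have h2 := spinHop_mul_spinHop_sub (X := X) 0 1 1 0
  have h3 := spinHop_mul_spinHop_sub (X := X) 0 0 1 1
  simp only [if_true, one_ne_zero, if_false, add_zero, sub_zero] at h2 h3
  rw [eq_sub_iff_add_eq, ← sub_eq_iff_eq_add'] at h1
  rw [totalSpinSq, Fin.sum_univ_three, totalSpin_zero, totalSpin_one, totalSpin_two,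
    totalNumber_eq]
  have e : (1 / 2 : ℂ) • ∑ x : X, ∑ y : X, star (singletAnn x y) * singletAnn x y =
      spinHop X 1 1 + spinHop X 0 0 * spinHop X 1 1 - spinHop X 1 0 * spinHop X 0 1 := by
    rw [← h1]; abel
  rw [e]
  have hI : Complex.I / 2 * (Complex.I / 2) = - (1 / 4) := by
    linear_combination (1 / 4 : ℂ) * Complex.I_mul_I
  simp only [sq, smul_mul_smul_comm, add_mul, mul_add, sub_mul, mul_sub, smul_add, smul_sub,
    hI, h2, h3]
  module

end SpinHop
end Hubbard
end

/-! ### The hopping matrix as stars and plaquettes -/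

noncomputable section
namespace Hubbard
section Lattice
variable {ν L : ℕ}

lemma unitVec_apply (l m : Fin ν) : (unitVec l : Vertex ν L) m = if m = l then 1 else 0 := by
  simp [unitVec, Pi.single_apply]

lemma zmod_one_ne_zero (hL : 3 ≤ L) : (1 : ZMod L) ≠ 0 := by
  have : Fact (1 < L) := ⟨by omega⟩
  exact one_ne_zero

lemma zmod_two_ne_zero (hL : 3 ≤ L) : (1 : ZMod L) + 1 ≠ 0 := by
  intro h
  have h2 : ((2 : ℕ) : ZMod L) = 0 := by push_cast; rw [← h]; norm_num
  rw [ZMod.natCast_eq_zero_iff] at h2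
  exact absurd (Nat.le_of_dvd (by norm_num) h2) (by omega)

lemma unitVec_ne_zero (hL : 3 ≤ L) (l : Fin ν) : (unitVec l : Vertex ν L) ≠ 0 := by
  intro h
  have := congrFun h l
  rw [unitVec_apply, if_pos rfl] at this
  exact zmod_one_ne_zero hL this

lemma unitVec_injective (hL : 3 ≤ L) : Function.Injective (unitVec : Fin ν → Vertex ν L) := by
  intro l m h
  have := congrFun h l
  rw [unitVec_apply, unitVec_apply, if_pos rfl] at this
  by_contra hne
  rw [if_neg hne] at this
  exact zmod_one_ne_zero hL this

lemma unitVec_add_ne_zero (hL : 3 ≤ L) (l m : Fin ν) :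
    (unitVec l + unitVec m : Vertex ν L) ≠ 0 := by
  intro h
  have := congrFun h l
  rw [Pi.add_apply, unitVec_apply, unitVec_apply, if_pos rfl, Pi.zero_apply] at this
  by_cases hlm : l = m
  · rw [if_pos hlm] at this; exact zmod_two_ne_zero hL this
  · rw [if_neg hlm, add_zero] at this; exact zmod_one_ne_zero hL this

/-- The indicator of the edges ending at `α`. -/
def starVec (α : Vertex ν L) (x : Site ν L) : ℝ :=
  (if x.1 = α then 1 else 0) + (if x.1 + unitVec x.2 = α then 1 else 0)

/-- Indicator of the edges in direction `l` of the plaquette at `α` in directions `l`, `m`. -/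
def railVec (α : Vertex ν L) (l m : Fin ν) (x : Site ν L) : ℝ :=
  (if x.2 = l then 1 else 0) * ((if x.1 = α then 1 else 0) + (if x.1 = α + unitVec m then 1 else 0))

/-- The alternating state on the plaquette at `α` in directions `l`, `m`. -/
def plaquette (α : Vertex ν L) (l m : Fin ν) : Site ν L → ℝ := railVec α l m - railVec α m l

variable [NeZero L]

/-- Overlap of the edges `x` and `y`: the number of common endpoints. -/
def commonEnds (x y : Site ν L) : ℝ :=
  (if x.1 = y.1 then 1 else 0) + (if x.1 = y.1 + unitVec y.2 then 1 else 0) +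
    (if x.1 + unitVec x.2 = y.1 then 1 else 0) +
    (if x.1 + unitVec x.2 = y.1 + unitVec y.2 then 1 else 0)

lemma sum_indicator_mul {V : Type*} [Fintype V] [DecidableEq V] (a b c d : V) :
    ∑ α, ((if a = α then (1 : ℝ) else 0) + (if b = α then 1 else 0)) *
        ((if c = α then 1 else 0) + (if d = α then 1 else 0)) =
      (if a = c then 1 else 0) + (if a = d then 1 else 0) + (if b = c then 1 else 0) +
        (if b = d then 1 else 0) := by
  have h : ∀ p r : V, ∑ α, (if p = α then (1 : ℝ) else 0) * (if r = α then 1 else 0) =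
      if p = r then 1 else 0 := by
    intro p r
    simp
  simp only [add_mul, mul_add, Finset.sum_add_distrib, h]
  ring

lemma sum_starVec_mul (x y : Site ν L) :
    ∑ α, starVec α x * starVec α y = commonEnds x y := by
  unfold starVec commonEnds
  rw [sum_indicator_mul]

lemma sum_railVec_mul_same (x y : Site ν L) :
    ∑ α, ∑ l, ∑ m, railVec α l m x * railVec α l m y =
      if x.2 = y.2 then ∑ m, (2 * (if x.1 = y.1 then 1 else 0) +
        (if y.1 = x.1 + unitVec m then 1 else 0) +
        (if x.1 = y.1 + unitVec m then 1 else 0)) else 0 := by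
  rw [Finset.sum_comm]
  have h : ∀ l m : Fin ν, ∑ α, railVec α l m x * railVec α l m y =
      if x.2 = l then (if y.2 = l then (2 * (if x.1 = y.1 then 1 else 0) +
        (if y.1 = x.1 + unitVec m then 1 else 0) +
        (if x.1 = y.1 + unitVec m then 1 else 0)) else 0) else 0 := by
    intro l m
    unfold railVec
    by_cases h1 : x.2 = l
    · by_cases h2 : y.2 = l
      · have := sum_indicator_mul x.1 (x.1 - unitVec m) y.1 (y.1 - unitVec m)
        simp only [sub_eq_iff_eq_add, eq_sub_iff_add_eq, sub_add_cancel] at this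
        simp only [h1, h2, if_true, one_mul]
        rw [this]
        simp only [eq_comm (a := y.1)]
        ring
      · simp [h2]
    · simp [h1]
  have h2 : ∀ l : Fin ν, ∑ α, ∑ m, railVec α l m x * railVec α l m y =
      if x.2 = l then (if y.2 = l then ∑ m, (2 * (if x.1 = y.1 then 1 else 0) +
        (if y.1 = x.1 + unitVec m then 1 else 0) +
        (if x.1 = y.1 + unitVec m then 1 else 0)) else 0) else 0 := by
    intro l
    rw [Finset.sum_comm]
    simp_rw [h]
    split_ifs <;> simp
  simp_rw [h2]
  simp [eq_comm]

lemma sum_railVec_mul_swap (x y : Site ν L) :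
    ∑ α, ∑ l, ∑ m, railVec α l m x * railVec α m l y = commonEnds x y := by
  rw [Finset.sum_comm]
  have h : ∀ l m : Fin ν, ∑ α, railVec α l m x * railVec α m l y =
      if x.2 = l then (if y.2 = m then commonEnds x y else 0) else 0 := by
    intro l m
    unfold railVec commonEnds
    by_cases h1 : x.2 = l
    · by_cases h2 : y.2 = m
      · have := sum_indicator_mul x.1 (x.1 - unitVec m) y.1 (y.1 - unitVec l)
        simp only [sub_eq_iff_eq_add, eq_sub_iff_add_eq] at this
        simp only [h1, h2, if_true, one_mul]
        rw [this]
        have e : x.1 - unitVec m + unitVec l = y.1 ↔ x.1 + unitVec l = y.1 + unitVec m := by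
          rw [sub_add_eq_add_sub, sub_eq_iff_eq_add]
        simp only [e]
        ring
      · simp [h2]
    · simp [h1]
  have h2 : ∀ l : Fin ν, ∑ α, ∑ m, railVec α l m x * railVec α m l y =
      if x.2 = l then commonEnds x y else 0 := by
    intro l
    rw [Finset.sum_comm]
    simp_rw [h]
    split_ifs <;> simp
  simp_rw [h2]
  simp

lemma sum_plaquette_mul (x y : Site ν L) :
    ∑ α, ∑ l, ∑ m, plaquette α l m x * plaquette α l m y =
      2 * (if x.2 = y.2 then ∑ m, (2 * (if x.1 = y.1 then 1 else 0) +
        (if y.1 = x.1 + unitVec m then 1 else 0) +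
        (if x.1 = y.1 + unitVec m then 1 else 0)) else 0) - 2 * commonEnds x y := by
  rw [← sum_railVec_mul_same, ← sum_railVec_mul_swap]
  have e : ∀ α : Vertex ν L, ∑ l, ∑ m, plaquette α l m x * plaquette α l m y =
      2 * (∑ l, ∑ m, railVec α l m x * railVec α l m y) -
      2 * (∑ l, ∑ m, railVec α l m x * railVec α m l y) := by
    intro α
    have h1 : ∑ l, ∑ m, railVec α m l x * railVec α m l y =
        ∑ l, ∑ m, railVec α l m x * railVec α l m y := Finset.sum_comm
    have h2 : ∑ l, ∑ m, railVec α m l x * railVec α l m y =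
        ∑ l, ∑ m, railVec α l m x * railVec α m l y := Finset.sum_comm
    simp only [plaquette, Pi.sub_apply, sub_mul, mul_sub, Finset.sum_sub_distrib, h1, h2]
    ring
  simp_rw [e, Finset.sum_sub_distrib, ← Finset.mul_sum]

/-- Stars give the number of common endpoints. Plaquettes give parallel translates minus common
endpoints, and the two cancel for neighbours on a line. The factor t/2 compensates the two orders of
the directions. For `3 ≤ L` no unit vector and no sum of two unit vectors vanishes, so distinct
cases never coincide. -/
theorem hoppingAmplitude_eq (hL : 3 ≤ L) (s t : ℝ) (x y : Site ν L) :
    hoppingAmplitude s t x y = -s * ∑ α, starVec α x * starVec α y +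
      t / 2 * ∑ α, ∑ l, ∑ m, plaquette α l m x * plaquette α l m y := by
  rw [sum_starVec_mul, sum_plaquette_mul]
  obtain ⟨β, i⟩ := x
  obtain ⟨γ, j⟩ := y
  have h0 := unitVec_ne_zero (ν := ν) hL
  have h2 := unitVec_add_ne_zero (ν := ν) hL
  have hi : ∀ {l m : Fin ν}, (unitVec l : Vertex ν L) = unitVec m ↔ l = m :=
    (unitVec_injective (ν := ν) hL).eq_iff
  by_cases hij : i = j
  · subst hij
    simp only [hoppingAmplitude, commonEnds, IsTranslate, Prod.mk.injEq, true_and, and_true,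
      if_true, ne_eq, not_true_eq_false, false_and, if_false]
    by_cases hβ : β = γ
    · subst hβ
      simp [h0]
      ring
    · by_cases hm : ∃ m, γ = β + unitVec m
      · obtain ⟨m, rfl⟩ := hm
        have e1 : ∀ l, ¬ β = β + unitVec m + unitVec l := fun l h => h2 m l (by
          rw [add_assoc] at h; exact left_eq_add.mp h)
        have e2 : ∀ l, (β + unitVec m = β + unitVec l) ↔ m = l := fun l => by
          rw [add_right_inj, hi]
        have e3 : ¬ β + unitVec i = β + unitVec m + unitVec i := by
          rw [add_right_comm]; simpa using h0 m
        simp only [hβ, e1, e2, e3, or_false, if_false]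
        by_cases hmi : m = i
        · subst hmi
          simp
        · simp [hmi, hi, Ne.symm hmi]
      · by_cases hm' : ∃ m, β = γ + unitVec m
        · obtain ⟨m, rfl⟩ := hm'
          have e1 : ∀ l, ¬ γ = γ + unitVec m + unitVec l := fun l h => hm ⟨l, h⟩
          have e1' : ∀ l, ¬ γ + unitVec m + unitVec l = γ := fun l h => hm ⟨l, h.symm⟩
          have e2 : ∀ l, (γ + unitVec m = γ + unitVec l) ↔ m = l := fun l => by
            rw [add_right_inj, hi]
          have e3 : ¬ γ + unitVec m + unitVec i = γ + unitVec i := by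
            rw [add_right_comm]; simpa using h0 m
          simp only [hβ, e1, e1', e2, e3, false_or, if_false]
          by_cases hmi : m = i
          · subst hmi
            simp
          · simp [hmi]
        · have e1 : ∀ l, ¬ γ = β + unitVec l := fun l h => hm ⟨l, h⟩
          have e1' : ∀ l, ¬ β + unitVec l = γ := fun l h => hm ⟨l, h.symm⟩
          have e2 : ∀ l, ¬ β = γ + unitVec l := fun l h => hm' ⟨l, h⟩
          simp [hβ, e1, e1', e2]
  · have hxy : ¬ ((β, i) : Site ν L) = (γ, j) := fun h => hij (congrArg Prod.snd h)
    have hends : (∃ α, IsEndpoint α ((β, i) : Site ν L) ∧ IsEndpoint α ((γ, j) : Site ν L)) ↔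
        (β = γ ∨ β = γ + unitVec j ∨ β + unitVec i = γ ∨ β + unitVec i = γ + unitVec j) := by
      simp only [IsEndpoint]
      constructor
      · rintro ⟨α, h | h, h' | h'⟩ <;> rw [← h'] at h <;> simp [h]
      · rintro (h | h | h | h)
        · exact ⟨β, .inl rfl, .inl h.symm⟩
        · exact ⟨β, .inl rfl, .inr h.symm⟩
        · exact ⟨γ, .inr h, .inl rfl⟩
        · exact ⟨_, .inr rfl, .inr h.symm⟩
    have hne : ¬ (unitVec i : Vertex ν L) = unitVec j := fun h => hij (hi.mp h)
    simp only [hoppingAmplitude, hxy, IsTranslate, hij, false_and, and_false, exists_false,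
      if_false, ne_eq, not_false_eq_true, true_and, hends, commonEnds, mul_zero, zero_sub]
    by_cases c1 : β = γ
    · subst c1
      simp [h0, hne]
      ring
    · by_cases c2 : β = γ + unitVec j
      · subst c2
        have e : ¬ γ + unitVec j + unitVec i = γ := by
          rw [add_assoc]; simpa using h2 j i
        simp [h0, e]
        ring
      · by_cases c3 : β + unitVec i = γ
        · subst c3
          have e : ¬ β = β + unitVec i + unitVec j := by
            rw [add_assoc]; simpa using h2 i j
          simp [h0, e]
          ring
        · by_cases c4 : β + unitVec i = γ + unitVec j
          · simp [c1, c2, c4, h0]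
            ring
          · simp [c1, c2, c3, c4]

end Lattice
end Hubbard
end

/-! ### Embedding the local geometry into the lattice -/

noncomputable section
namespace Hubbard
section Energy

section
variable {X : Type} [Fintype X] [DecidableEq X]

lemma cre_mul_ann_eq (f g : X → ℝ) (σ τ : Fin 2) :
    cre f σ * ann g τ =
      ∑ x, ∑ y, ((f x * g y : ℝ) : ℂ) • (creation (x, σ) * annihilation (y, τ)) := by
  rw [cre_eq, ann, Finset.sum_mul_sum]
  simp_rw [smul_mul_smul_comm, Complex.ofReal_mul]

lemma norm_sq_pair_sub {d : X → ℝ} (hd : d ⬝ᵥ d = 1) (Φ : Fock (X × Fin 2)) :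
    ‖star (pairAnn d) Φ‖ ^ 2 - ‖pairAnn d Φ‖ ^ 2 =
      ‖Φ‖ ^ 2 - ∑ σ, ‖ann d σ Φ‖ ^ 2 := by
  rw [← re_inner_star_mul (star (pairAnn d)), ← re_inner_star_mul (pairAnn d), star_star,
    pairAnn_mul_star hd, star_pairAnn_mul, ← re_inner_self Φ, Fin.sum_univ_two,
    ← re_inner_star_mul (ann d 0), ← re_inner_star_mul (ann d 1)]
  have e : (1 - num d 0) * (1 - num d 1) =
      1 - (star (ann d 0) * ann d 0 + star (ann d 1) * ann d 1) + num d 0 * num d 1 := by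
    simp only [num, star_ann]; noncomm_ring
  rw [e]
  simp only [LinearMap.add_apply, LinearMap.sub_apply, Module.End.one_apply, inner_add_right,
    inner_sub_right, Complex.add_re, Complex.sub_re]
  ring
end

variable {ν L : ℕ}

/-- The edge at `α` along the leg `a`. -/
def legSite (α : Vertex ν L) (a : Leg ν) : Site ν L :=
  (α - if a.2 then 0 else unitVec a.1, a.1)

/-- The edge parallel to the leg `p.1.1` at the far end of the leg `p.1.2`. -/
def outerSite (α : Vertex ν L) (p : Corner ν) : Site ν L :=
  ((legSite α p.1.1).1 + (if p.1.2.2 then unitVec p.1.2.1 else -unitVec p.1.2.1), p.1.1.1)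

lemma legSite_apply_of_ne (α : Vertex ν L) (a : Leg ν) {m : Fin ν} (h : m ≠ a.1) :
    (legSite α a).1 m = α m := by
  unfold legSite
  by_cases ha : a.2 <;> simp [ha, unitVec_apply, h]

lemma legSite_injective (hL : 3 ≤ L) (α : Vertex ν L) : Function.Injective (legSite α) := by
  rintro ⟨l, ε⟩ ⟨m, ε'⟩ h
  obtain ⟨h1, rfl⟩ := Prod.mk.inj h
  have := unitVec_ne_zero hL l
  cases ε <;> cases ε'
  · rfl
  · simp [this] at h1
  · have h2 := h1.symm
    simp [this] at h2
  · rfl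

/-- An outer edge is displaced by ±1 from the star in the direction of its second leg, a coordinate
in which its own leg agrees with α. Telling +1 from -1 takes 2 ≠ 0 modulo L. -/
lemma injective_leg_outer (hL : 3 ≤ L) (α : Vertex ν L) :
    Function.Injective (Sum.elim (legSite α) (outerSite α)) := by
  have h1 := zmod_one_ne_zero hL
  have h2 := zmod_two_ne_zero hL
  have houter : ∀ p : Corner ν, (outerSite α p).1 p.1.2.1 =
      α p.1.2.1 + if p.1.2.2 then 1 else -1 := by
    intro p
    simp only [outerSite]
    rw [Pi.add_apply, legSite_apply_of_ne α _ p.2.symm]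
    split_ifs <;> simp [unitVec_apply]
  have houter' : ∀ (p : Corner ν) (m : Fin ν), m ≠ p.1.1.1 → m ≠ p.1.2.1 →
      (outerSite α p).1 m = α m := by
    intro p m hm hm'
    simp only [outerSite]
    rw [Pi.add_apply, legSite_apply_of_ne α _ hm]
    split_ifs <;> simp [unitVec_apply, hm']
  have hs : ∀ b : Bool, (if b then (1 : ZMod L) else -1) ≠ 0 := by
    intro b; cases b <;> simp [h1]
  refine Function.Injective.sumElim (legSite_injective hL α) ?_ ?_
  · intro p p' h
    have hd : p.1.1.1 = p'.1.1.1 := congrArg Prod.snd h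
    have hb : p.1.2.1 = p'.1.2.1 := by
      by_contra hne
      have e1 := houter p
      rw [h, houter' p' _ (fun e => p.2 (by rw [hd, e])) hne] at e1
      exact hs _ (left_eq_add.mp e1)
    have hε : p.1.2.2 = p'.1.2.2 := by
      have e1 := houter p
      have e2 := houter p'
      rw [h, hb, e2, add_right_inj] at e1
      by_contra hne
      rcases hp : p.1.2.2 <;> rcases hp' : p'.1.2.2 <;> simp [hp, hp'] at e1 hne
      · exact h2 (by nth_rewrite 1 [e1]; simp)
      · exact h2 (by nth_rewrite 1 [← e1]; simp)
    have hb2 : p.1.2 = p'.1.2 := Prod.ext hb hε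
    have hbase : (legSite α p.1.1) = (legSite α p'.1.1) := by
      refine Prod.ext ?_ hd
      have := congrArg Prod.fst h
      simp only [outerSite, hb2] at this
      exact add_right_cancel this
    exact Subtype.ext (Prod.ext (legSite_injective hL α hbase) hb2)
  · intro a p h
    have hd : a.1 = p.1.1.1 := congrArg Prod.snd h
    have e1 := houter p
    rw [← h, legSite_apply_of_ne α a (fun e => p.2 (by rw [← hd, e]))] at e1
    exact hs _ (left_eq_add.mp e1)

lemma placed_legSite [NeZero L] (α : Vertex ν L) (c : ℝ) :
    placed (legSite α) (fun _ => c) = c • starVec α := by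
  funext x
  have h : placed (legSite α) (fun _ => c) x = c * ∑ l : Fin ν,
      ((if x = (α, l) then 1 else 0) + (if x = (α - unitVec l, l) then 1 else 0)) := by
    simp only [placed, Finset.sum_apply, Pi.smul_apply, smul_eq_mul, ← Finset.mul_sum]
    rw [Fintype.sum_prod_type]
    simp only [Fintype.sum_bool, legSite, if_true, Bool.false_eq_true, if_false, sub_zero,
      Pi.single_apply]
  obtain ⟨β, i⟩ := x
  rw [h, Pi.smul_apply, smul_eq_mul]
  congr 1
  simp only [Prod.mk.injEq, starVec, Finset.sum_add_distrib]
  congr 1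
  · by_cases hb : β = α <;> simp [hb]
  · rw [Finset.sum_eq_single i]
    · simp [eq_sub_iff_add_eq]
    · intro l _ hl; simp [hl.symm]
    · simp

/-- The corner of the plaquette spanned by two legs with the smallest coordinates. -/
def cornerBase (α : Vertex ν L) (p : Corner ν) : Vertex ν L :=
  α - (if p.1.1.2 then 0 else unitVec p.1.1.1) - (if p.1.2.2 then 0 else unitVec p.1.2.1)

lemma railVec_eq (hL : 3 ≤ L) (α : Vertex ν L) (l m : Fin ν) :
    railVec α l m = Pi.single (α, l) 1 + Pi.single (α + unitVec m, l) 1 := by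
  funext ⟨β, i⟩
  have h := unitVec_ne_zero hL m
  by_cases h1 : i = l <;> simp [railVec, Pi.single_apply, h1]

lemma plaqVec_legSite (hL : 3 ≤ L) (α : Vertex ν L) (p : Corner ν) :
    plaqVec (legSite α) (outerSite α) p = plaquette (cornerBase α p) p.1.1.1 p.1.2.1 := by
  obtain ⟨⟨⟨l, ε⟩, ⟨m, ε'⟩⟩, h⟩ := p
  rw [plaquette, railVec_eq hL, railVec_eq hL]
  cases ε <;> cases ε' <;>
    simp [plaqVec, legSite, outerSite, cornerBase, sub_eq_add_neg, add_right_comm, add_assoc] <;> abel_nf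

end Energy
end Hubbard
end

/-! ### Lower bound for the energy -/

noncomputable section
namespace Hubbard
section EnergyBound
variable {ν L : ℕ} [NeZero L]

lemma sum_cre_mul_ann {X J : Type} [Fintype X] [DecidableEq X] [Fintype J] (f : J → X → ℝ)
    (σ : Fin 2) : ∑ j, cre (f j) σ * ann (f j) σ =
      ∑ x, ∑ y, ((∑ j, f j x * f j y : ℝ) : ℂ) • (creation (x, σ) * annihilation (y, σ)) := by
  simp_rw [cre_mul_ann_eq, Complex.ofReal_sum, Finset.sum_smul]
  rw [Finset.sum_comm]
  exact Finset.sum_congr rfl fun x _ => Finset.sum_comm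

lemma hoppingTerm_eq (hL : 3 ≤ L) (s t : ℝ) :
    hoppingTerm ν L s t =
      ((-s : ℝ) : ℂ) • ∑ σ, ∑ α, cre (starVec α) σ * ann (starVec α) σ +
      ((t / 2 : ℝ) : ℂ) • ∑ σ, ∑ α, ∑ l, ∑ m,
        cre (plaquette α l m) σ * ann (plaquette α l m) σ := by
  unfold hoppingTerm
  rw [Finset.smul_sum, Finset.smul_sum, ← Finset.sum_add_distrib]
  refine Finset.sum_congr rfl fun σ _ => ?_
  have e1 := sum_cre_mul_ann (fun α : Vertex ν L => starVec α) σ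
  have e2 := sum_cre_mul_ann
    (fun p : Vertex ν L × Fin ν × Fin ν => plaquette p.1 p.2.1 p.2.2) σ
  simp only [Fintype.sum_prod_type (α₁ := Vertex ν L) (α₂ := Fin ν × Fin ν),
    Fintype.sum_prod_type (α₁ := Fin ν) (α₂ := Fin ν)] at e2
  rw [e1, e2, Finset.smul_sum, Finset.smul_sum, ← Finset.sum_add_distrib]
  refine Finset.sum_congr rfl fun x _ => ?_
  rw [Finset.smul_sum, Finset.smul_sum, ← Finset.sum_add_distrib]
  refine Finset.sum_congr rfl fun y _ => ?_
  rw [hoppingAmplitude_eq hL]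
  push_cast
  rw [add_smul, mul_smul, mul_smul]

lemma interactionTerm_eq (U : ℝ) :
    interactionTerm ν L U = (U : ℂ) • ∑ x : Site ν L,
      star (pairAnn (Pi.single x 1)) * pairAnn (Pi.single x 1) := by
  unfold interactionTerm
  simp_rw [star_mul_pairAnn_single]

lemma re_inner_hamiltonian (hL : 3 ≤ L) (s t U : ℝ) (Φ : Fock (Mode ν L)) :
    (inner ℂ Φ (hamiltonian ν L s t U Φ)).re =
      -s * ∑ σ, ∑ α, ‖ann (starVec α) σ Φ‖ ^ 2 +
      t / 2 * ∑ σ, ∑ α, ∑ l, ∑ m, ‖ann (plaquette α l m) σ Φ‖ ^ 2 +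
      U * ∑ x : Site ν L, ‖pairAnn (Pi.single x 1) Φ‖ ^ 2 := by
  rw [hamiltonian, hoppingTerm_eq hL, interactionTerm_eq]
  simp only [← star_ann, LinearMap.add_apply, LinearMap.smul_apply, LinearMap.sum_apply,
    inner_add_right, inner_smul_right, inner_sum, Complex.add_re, Complex.re_ofReal_mul,
    Complex.re_sum, re_inner_star_mul]

/-- Every edge is a leg at each of its two endpoints. -/
lemma sum_legSite (g : Site ν L → ℝ) :
    ∑ α : Vertex ν L, ∑ a, g (legSite α a) = 2 * ∑ x, g x := by
  rw [Finset.sum_comm, Fintype.sum_prod_type, Fintype.sum_prod_type_right, Finset.mul_sum]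
  refine Finset.sum_congr rfl fun l _ => ?_
  rw [Fintype.sum_bool, two_mul]
  congr 1
  · simp [legSite]
  · exact (Equiv.subRight (unitVec l : Vertex ν L)).sum_comp (fun α => g (α, l))

/-- For fixed directions and signs, shifting the corner to its base is a bijection of the vertices.
The factor 4 counts the signs of the two legs. -/
lemma sum_plaqVec_le (hL : 3 ≤ L) (g : (Site ν L → ℝ) → ℝ) (hg : ∀ f, 0 ≤ g f) :
    ∑ α : Vertex ν L, ∑ p, g (plaqVec (legSite α) (outerSite α) p) ≤
      4 * ∑ α : Vertex ν L, ∑ l, ∑ m, g (plaquette α l m) := by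
  simp_rw [plaqVec_legSite hL]
  rw [Finset.sum_comm]
  have e1 : ∀ p : Corner ν, ∑ α : Vertex ν L, g (plaquette (cornerBase α p) p.1.1.1 p.1.2.1) =
      ∑ α : Vertex ν L, g (plaquette α p.1.1.1 p.1.2.1) := by
    intro p
    have h := (Equiv.subRight ((if p.1.1.2 then 0 else unitVec p.1.1.1) +
      (if p.1.2.2 then 0 else unitVec p.1.2.1) : Vertex ν L)).sum_comp
      (fun α => g (plaquette α p.1.1.1 p.1.2.1))
    rw [← h]
    simp [cornerBase, sub_sub]
  simp_rw [e1]
  rw [sum_corner (fun a b => ∑ α : Vertex ν L, g (plaquette α a.1 b.1))]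
  have e2 : ∑ a : Leg ν, ∑ b : Leg ν, ∑ α : Vertex ν L, g (plaquette α a.1 b.1) =
      4 * ∑ α : Vertex ν L, ∑ l, ∑ m, g (plaquette α l m) := by
    simp only [Fintype.sum_prod_type, Fintype.sum_bool, Finset.sum_add_distrib]
    rw [Finset.sum_comm (s := (Finset.univ : Finset (Vertex ν L)))]
    have : ∑ l, ∑ m, ∑ α : Vertex ν L, g (plaquette α l m) =
        ∑ l, ∑ α : Vertex ν L, ∑ m, g (plaquette α l m) :=
      Finset.sum_congr rfl fun _ _ => Finset.sum_comm
    rw [← this]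
    ring
  rw [← e2]
  refine Finset.sum_le_sum fun a _ => Finset.sum_le_sum fun b _ => ?_
  split_ifs
  · exact le_rfl
  · exact Finset.sum_nonneg fun _ _ => hg _

/-- Lower bound for the energy by the ferromagnetic energy plus the plaquette and interaction
energies. -/
theorem exists_energy_bound (ν : ℕ) (hν : 2 ≤ ν) : ∃ K : ℝ, 0 ≤ K ∧
    ∀ (L : ℕ) [NeZero L], 3 ≤ L → ∀ s t U : ℝ, 0 ≤ s → ∀ Φ : Fock (Mode ν L),
      -2 * ν * s * (Fintype.card (Vertex ν L) : ℝ) * ‖Φ‖ ^ 2 +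
        (t - K * s) / 2 * ∑ σ, ∑ α, ∑ l, ∑ m, ‖ann (plaquette α l m) σ Φ‖ ^ 2 +
        (U - K * s) * ∑ x : Site ν L, ‖pairAnn (Pi.single x 1) Φ‖ ^ 2 ≤
      (inner ℂ Φ (hamiltonian ν L s t U Φ)).re := by
  obtain ⟨C, hC, hloc⟩ := exists_double_occupancy_bound hν
  -- The squared length 2ν of a star, times the multiplicity 4 of plaquettes, times 2 because the
  -- plaquette term carries t/2. The interaction alone would need only 4νC.
  refine ⟨16 * ν * C, by positivity, ?_⟩
  intro L _ hL s t U hs Φ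
  have hν' : (2 : ℝ) ≤ ν := by exact_mod_cast hν
  rw [re_inner_hamiltonian hL]
  set P := ∑ σ, ∑ α, ∑ l, ∑ m, ‖ann (plaquette α l m : Site ν L → ℝ) σ Φ‖ ^ 2 with hP
  set Q := ∑ x : Site ν L, ‖pairAnn (Pi.single x 1) Φ‖ ^ 2 with hQ
  have hQ0 : 0 ≤ Q := Finset.sum_nonneg fun _ _ => sq_nonneg _
  have hα : ∀ α : Vertex ν L, ∑ σ, ‖ann (starVec α) σ Φ‖ ^ 2 ≤ 2 * ν * ‖Φ‖ ^ 2 +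
      2 * ν * C * (∑ a, ‖pairAnn (Pi.single (legSite α a) 1) Φ‖ ^ 2 +
        ∑ p, ∑ σ, ‖ann (plaqVec (legSite α) (outerSite α) p) σ Φ‖ ^ 2) := by
    intro α
    have h1 := hloc _ _ _ (injective_leg_outer hL α) Φ
    have hdd : placed (legSite α) (fun _ => 1 / √(2 * (ν : ℝ))) ⬝ᵥ
        placed (legSite α) (fun _ => 1 / √(2 * (ν : ℝ))) = 1 := by
      rw [placed_dotProduct (legSite_injective hL α)]
      have h2 := Real.mul_self_sqrt (show 0 ≤ 2 * (ν : ℝ) by positivity)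
      have h3 : √(2 * (ν : ℝ)) ≠ 0 := by positivity
      simp only [Finset.sum_const, Finset.card_univ, Fintype.card_prod, Fintype.card_fin,
        Fintype.card_bool, nsmul_eq_mul]
      push_cast
      field_simp
      nlinarith [Real.sq_sqrt (show 0 ≤ (ν : ℝ) * 2 by positivity)]
    have h2 := norm_sq_pair_sub hdd Φ
    have h3 : ∀ σ, ‖ann (placed (legSite α) (fun _ => 1 / √(2 * (ν : ℝ)))) σ Φ‖ ^ 2 =
        ‖ann (starVec α) σ Φ‖ ^ 2 / (2 * ν) := by
      intro σ
      rw [placed_legSite, ann_smul, LinearMap.smul_apply, norm_smul, mul_pow, Complex.norm_real,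
        Real.norm_eq_abs, sq_abs, div_pow, Real.sq_sqrt (by positivity)]
      ring
    simp only [h3, ← Finset.sum_div] at h2
    set R := ∑ a, ‖pairAnn (Pi.single (legSite α a) 1) Φ‖ ^ 2 +
        ∑ p, ∑ σ, ‖ann (plaqVec (legSite α) (outerSite α) p) σ Φ‖ ^ 2
    have h4 : (∑ σ, ‖ann (starVec α) σ Φ‖ ^ 2) / (2 * ν) ≤ ‖Φ‖ ^ 2 + C * R := by linarith
    rw [div_le_iff₀ (by positivity)] at h4
    linarith
  have hsum := Finset.sum_le_sum fun α (_ : α ∈ (Finset.univ : Finset (Vertex ν L))) => hα α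
  rw [Finset.sum_comm, Finset.sum_add_distrib, Finset.sum_const, Finset.card_univ, nsmul_eq_mul,
    ← Finset.mul_sum, Finset.sum_add_distrib,
    sum_legSite (fun x => ‖pairAnn (Pi.single x 1) Φ‖ ^ 2), ← hQ] at hsum
  have hple := sum_plaqVec_le (ν := ν) hL (fun f => ∑ σ, ‖ann f σ Φ‖ ^ 2)
    (fun f => Finset.sum_nonneg fun _ _ => sq_nonneg _)
  have hPe : ∑ α : Vertex ν L, ∑ l, ∑ m, ∑ σ, ‖ann (plaquette α l m) σ Φ‖ ^ 2 = P := by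
    rw [hP]
    symm
    rw [Finset.sum_comm]
    refine Finset.sum_congr rfl fun α _ => ?_
    rw [Finset.sum_comm]
    exact Finset.sum_congr rfl fun l _ => Finset.sum_comm
  rw [hPe] at hple
  set T := ∑ α : Vertex ν L, ∑ p, ∑ σ, ‖ann (plaqVec (legSite α) (outerSite α) p) σ Φ‖ ^ 2
  set A := ∑ σ, ∑ α : Vertex ν L, ‖ann (starVec α) σ Φ‖ ^ 2
  set V : ℝ := (Fintype.card (Vertex ν L) : ℝ)
  have h1 : A ≤ V * (2 * ν * ‖Φ‖ ^ 2) + 2 * ν * C * (2 * Q + 4 * P) := by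
    refine hsum.trans ?_
    gcongr
  have h2 : s * A ≤ s * (V * (2 * ν * ‖Φ‖ ^ 2) + 2 * ν * C * (2 * Q + 4 * P)) := by gcongr
  have h3 : 0 ≤ ν * C * s * Q := by positivity
  nlinarith

end EnergyBound
end Hubbard
end

/-! ### Occupation-number basis -/

noncomputable section
namespace Hubbard
section OccupationBasis
variable {ι : Type} [Fintype ι] [DecidableEq ι]

lemma number_apply (i : ι) (ψ : Fock ι) (S : Finset ι) :
    (creation i * annihilation i) ψ S = if i ∈ S then ψ S else 0 := by
  rw [Module.End.mul_apply, creation_apply]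
  split_ifs with h
  · rw [annihilation_apply, if_neg (Finset.notMem_erase _ _), Finset.insert_erase h, ← mul_assoc]
    have : fermiSign i (S.erase i) = fermiSign i S := by
      rw [← fermiSign_insert_self, Finset.insert_erase h]
    rw [this, fermiSign_mul_self, one_mul]
  · rfl

lemma totalNumber_apply (ψ : Fock ι) (S : Finset ι) :
    totalNumber ι ψ S = (S.card : ℂ) * ψ S := by
  simp only [totalNumber, LinearMap.sum_apply, WithLp.ofLp_sum, Finset.sum_apply, number_apply]
  simp

lemma spinHop_diag_apply {X : Type} [Fintype X] [DecidableEq X] (σ : Fin 2)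
    (ψ : Fock (X × Fin 2)) (S : Finset (X × Fin 2)) :
    spinHop X σ σ ψ S = ((Finset.univ.filter fun x : X => (x, σ) ∈ S).card : ℂ) * ψ S := by
  simp only [spinHop, LinearMap.sum_apply, WithLp.ofLp_sum, Finset.sum_apply, number_apply]
  rw [← Finset.sum_filter]
  simp

lemma mem_electronSpace {N : ℕ} {ψ : Fock ι} :
    ψ ∈ electronSpace ι N ↔ totalNumber ι ψ = (N : ℂ) • ψ := Module.End.mem_eigenspace_iff

variable (ι) in
/-- The state without electrons. -/
def vacuum : Fock ι := EuclideanSpace.single ∅ 1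

lemma annihilation_vacuum (i : ι) : annihilation i (vacuum ι) = 0 := by
  rw [vacuum, annihilation_single, if_neg (Finset.notMem_empty i)]

lemma vacuum_ne_zero : vacuum ι ≠ 0 := by
  simp [vacuum]

lemma eq_smul_vacuum {ψ : Fock ι} (h : totalNumber ι ψ = 0) : ψ = ψ ∅ • vacuum ι := by
  ext S
  by_cases hS : S = ∅
  · subst hS; simp [vacuum]
  · have h1 := totalNumber_apply ψ S
    rw [h] at h1
    have h2 : (S.card : ℂ) ≠ 0 := by simpa using hS
    have h3 : ψ S = 0 := by
      rcases mul_eq_zero.mp h1.symm with h | h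
      · exact absurd h h2
      · exact h
    rw [h3]
    simp [vacuum, hS]

lemma totalNumber_mul_annihilation (i : ι) :
    totalNumber ι * annihilation i = annihilation i * totalNumber ι - annihilation i := by
  unfold totalNumber
  rw [Finset.sum_mul, Finset.mul_sum]
  have h : ∀ j, creation j * annihilation j * annihilation i =
      annihilation i * (creation j * annihilation j) - if i = j then annihilation i else 0 := by
    intro j
    have h1 := annihilation_mul_creation i j
    have h2 := annihilation_mul_annihilation j i
    have h3 : (if i = j then annihilation i else 0) = (if i = j then 1 else 0) * annihilation j := by
      split_ifs with h <;> simp [h]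
    rw [h3]
    linear_combination (norm := noncomm_ring) creation j * h2 - h1 * annihilation j
  simp_rw [h, Finset.sum_sub_distrib]
  simp

lemma totalNumber_mul_creation (i : ι) :
    totalNumber ι * creation i = creation i * totalNumber ι + creation i := by
  have hs : star (totalNumber ι) = totalNumber ι := by
    simp [totalNumber, star_sum, star_creation, star_annihilation]
  have h := congrArg star (totalNumber_mul_annihilation i)
  rw [star_sub, star_mul, star_mul, hs, star_annihilation] at h
  rw [h]; noncomm_ring

end OccupationBasis

/-! ### States with one electron per vector of a dual frame -/

section DualFrame
variable {V X : Type} [Fintype V] [DecidableEq V] [Fintype X] [DecidableEq X]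

/-- An algebraic substitute for positivity, since the frame numbers need not be self-adjoint.
Applying `P i` moves one term of the sum into the scalar, so `P i ψ` satisfies the same equation
with `k + 1` and one index fewer. The scalar stays a positive integer. -/
lemma forall_apply_eq_zero_of_sum_eq_zero {M J : Type*} [AddCommGroup M] [Module ℂ M]
    [DecidableEq J] (P : J → Module.End ℂ M) (hc : ∀ i j, Commute (P i) (P j)) (n : ℕ) :
    ∀ (s : Finset J), s.card = n → ∀ (k : ℕ) (ψ : M), (∀ j, P j (P j ψ) = P j ψ) →
      (k : ℂ) • ψ + ∑ j ∈ s, P j ψ = 0 → ∀ j ∈ s, P j ψ = 0 := by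
  induction n with
  | zero =>
    intro s hs k ψ _ _ j hj
    rw [Finset.card_eq_zero] at hs
    simp [hs] at hj
  | succ n ih =>
    intro s hs k ψ hP hsum i hi
    have hcomm : ∀ a b v, P a (P b v) = P b (P a v) := fun a b v =>
      LinearMap.congr_fun (hc a b).eq v
    have h1 : ((k + 1 : ℕ) : ℂ) • P i ψ + ∑ j ∈ s.erase i, P j (P i ψ) = 0 := by
      have := congrArg (P i) hsum
      rw [map_add, map_smul, map_sum, map_zero, ← Finset.add_sum_erase _ _ hi, hP] at this
      rw [← this]
      simp_rw [hcomm _ i]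
      push_cast
      module
    have h2 := ih (s.erase i) (by rw [Finset.card_erase_of_mem hi, hs]; rfl) (k + 1) (P i ψ)
      (fun j => by rw [hcomm j i, hcomm j i, hP]) h1
    rw [Finset.sum_eq_zero h2, add_zero, smul_eq_zero] at h1
    exact h1.resolve_left (by exact_mod_cast Nat.succ_ne_zero k)

/-- The occupation number of the vertex `x` for the frame `u` with dual points `τ`. -/
def frameNumber (u : V → X → ℝ) (τ : V → X) (x : V) : Op (X × Fin 2) :=
  ∑ σ, cre (u x) σ * annihilation (τ x, σ)

variable {u : V → X → ℝ} {τ : V → X}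

lemma annihilation_mul_cre (u : X → ℝ) (y : X) (σ ρ : Fin 2) :
    annihilation (y, σ) * cre u ρ =
      (if σ = ρ then (u y : ℂ) else 0) • 1 - cre u ρ * annihilation (y, σ) := by
  rw [← ann_single, ann_mul_cre]; simp

section
variable (hdual : ∀ x z, u x (τ z) = if x = z then 1 else 0)
include hdual

omit [Fintype V] in
lemma frameNumber_mul_annihilation (x z : V) (σ : Fin 2) :
    frameNumber u τ x * annihilation (τ z, σ) =
      annihilation (τ z, σ) * frameNumber u τ x - if x = z then annihilation (τ z, σ) else 0 := by
  unfold frameNumber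
  rw [Finset.sum_mul, Finset.mul_sum]
  have h : ∀ ρ, cre (u x) ρ * annihilation (τ x, ρ) * annihilation (τ z, σ) =
      annihilation (τ z, σ) * (cre (u x) ρ * annihilation (τ x, ρ)) -
        if σ = ρ then (if x = z then annihilation (τ z, σ) else 0) else 0 := by
    intro ρ
    have h1 := annihilation_mul_cre (u x) (τ z) σ ρ
    have h2 := annihilation_mul_annihilation (τ x, ρ) (τ z, σ)
    have h3 : (if σ = ρ then (if x = z then annihilation (τ z, σ) else 0) else 0) =
        ((if σ = ρ then (u x (τ z) : ℂ) else 0) • (1 : Op (X × Fin 2))) * annihilation (τ x, ρ) := by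
      rw [hdual]
      by_cases hx : x = z <;> by_cases hs : σ = ρ <;> simp [hx, hs]
    rw [h3]
    linear_combination (norm := noncomm_ring)
      cre (u x) ρ * h2 - h1 * annihilation (τ x, ρ)
  simp_rw [h, Finset.sum_sub_distrib]
  simp

omit [Fintype V] in
lemma frameNumber_comm (x z : V) : Commute (frameNumber u τ x) (frameNumber u τ z) := by
  rcases eq_or_ne x z with rfl | hxz
  · exact Commute.refl _
  conv => arg 2; unfold frameNumber
  refine Commute.sum_right _ _ _ fun σ _ => ?_
  have h1 := frameNumber_mul_annihilation hdual x z σ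
  rw [if_neg hxz, sub_zero] at h1
  refine Commute.mul_right ?_ h1
  unfold frameNumber
  refine Commute.sum_left _ _ _ fun ρ _ => ?_
  have h2 := annihilation_mul_cre (u z) (τ x) ρ σ
  rw [hdual, if_neg hxz.symm] at h2
  simp only [Complex.ofReal_zero, ite_self, zero_smul] at h2
  have h3 := cre_mul_cre (u x) (u z) ρ σ
  unfold Commute SemiconjBy
  linear_combination (norm := noncomm_ring) cre (u x) ρ * h2 - h3 * annihilation (τ x, ρ)

-- The square of the frame number differs from it by a term that begins by annihilating an up-down
-- pair at the dual point.
omit [Fintype V] in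
lemma frameNumber_idem {Φ : Fock (X × Fin 2)} (x : V)
    (h2 : annihilation (τ x, 1) (annihilation (τ x, 0) Φ) = 0) :
    frameNumber u τ x (frameNumber u τ x Φ) = frameNumber u τ x Φ := by
  have key : frameNumber u τ x * frameNumber u τ x = frameNumber u τ x +
      (2 : ℂ) • (cre (u x) 1 * cre (u x) 0 * (annihilation (τ x, 0) * annihilation (τ x, 1))) := by
    have h00 := annihilation_mul_cre (u x) (τ x) 0 0
    have h01 := annihilation_mul_cre (u x) (τ x) 0 1
    have h10 := annihilation_mul_cre (u x) (τ x) 1 0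
    have h11 := annihilation_mul_cre (u x) (τ x) 1 1
    have ha := annihilation_mul_annihilation (τ x, (0 : Fin 2)) (τ x, 1)
    have hc := cre_mul_cre (u x) (u x) 0 1
    have ha0 := annihilation_mul_annihilation (τ x, (0 : Fin 2)) (τ x, 0)
    have ha1 := annihilation_mul_annihilation (τ x, (1 : Fin 2)) (τ x, 1)
    have ha0' := eq_zero_of_eq_neg_self ha0
    have ha1' := eq_zero_of_eq_neg_self ha1
    simp only [hdual, if_true, zero_ne_one, one_ne_zero, if_false, zero_smul, zero_sub,
      Complex.ofReal_one, one_smul] at h00 h01 h10 h11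
    rw [frameNumber, Fin.sum_univ_two, two_smul]
    generalize annihilation (τ x, (0 : Fin 2)) = a at *
    generalize annihilation (τ x, (1 : Fin 2)) = b at *
    generalize cre (u x) 0 = a' at *
    generalize cre (u x) 1 = b' at *
    linear_combination (norm := noncomm_ring) a' * h00 * a - a' * a' * ha0' + b' * h11 * b
      - b' * b' * ha1' + a' * h01 * b + b' * h10 * a - b' * a' * ha - hc * a * b
  have := LinearMap.congr_fun key Φ
  rw [Module.End.mul_apply] at this
  rw [this, LinearMap.add_apply, LinearMap.smul_apply, Module.End.mul_apply]
  have h3 : (annihilation (τ x, (0 : Fin 2)) * annihilation (τ x, (1 : Fin 2))) Φ = 0 := by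
    rw [annihilation_mul_annihilation, LinearMap.neg_apply, Module.End.mul_apply, h2, neg_zero]
  rw [h3, map_zero, smul_zero, add_zero]

/-- A state with as many electrons as frame vectors and without double occupancy has one electron
in each frame vector. -/
lemma frameNumber_apply_eq {Φ : Fock (X × Fin 2)}
    (h1 : ∀ y σ, annihilation (y, σ) Φ = ∑ x, (u x y : ℂ) • annihilation (τ x, σ) Φ)
    (h2 : ∀ y, annihilation (y, 1) (annihilation (y, 0) Φ) = 0)
    (h3 : totalNumber (X × Fin 2) Φ = (Fintype.card V : ℂ) • Φ) (x : V) :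
    frameNumber u τ x Φ = Φ := by
  -- Expanding each annihilator on Φ through the dual points collects the creators into `cre (u x)`,
  -- so the frame numbers sum to the electron number. There are as many electrons as frame vectors,
  -- hence the sum of the `1 - frameNumber` vanishes on Φ.
  have hsum : ∑ x, frameNumber u τ x Φ = (Fintype.card V : ℂ) • Φ := by
    rw [← h3, totalNumber, Fintype.sum_prod_type_right, LinearMap.sum_apply]
    simp only [frameNumber, LinearMap.sum_apply]
    rw [Finset.sum_comm]
    refine Finset.sum_congr rfl fun σ _ => ?_
    simp only [Module.End.mul_apply]
    conv_rhs =>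
      enter [2, y]
      rw [h1 y σ, map_sum]
    rw [Finset.sum_comm]
    refine Finset.sum_congr rfl fun x _ => ?_
    rw [cre_eq, LinearMap.sum_apply]
    simp
  have hPc : ∀ i j, Commute (1 - frameNumber u τ i) (1 - frameNumber u τ j) := fun i j =>
    ((Commute.one_left _).sub_left
      ((Commute.one_right _).sub_right (frameNumber_comm hdual i j)))
  have h := forall_apply_eq_zero_of_sum_eq_zero (fun x => 1 - frameNumber u τ x) hPc _
    Finset.univ rfl 0 Φ (fun j => by
      simp only [LinearMap.sub_apply, Module.End.one_apply, map_sub,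
        frameNumber_idem hdual j (h2 _)]
      abel) (by simp [hsum, Nat.cast_smul_eq_nsmul]) x (Finset.mem_univ _)
  rw [LinearMap.sub_apply, Module.End.one_apply, sub_eq_zero] at h
  exact h.symm

/-- A term that removes electrons at two distinct frame vectors has frame number 0 at these two and
1 elsewhere. The frame numbers therefore separate the sum into unordered pairs. The two orders of
one pair carry the same coefficient and add up to a singlet annihilator. -/
lemma singlet_of_sum_eq_zero {Φ : Fock (X × Fin 2)} (hn : ∀ x, frameNumber u τ x Φ = Φ)
    (hd : ∀ x, annihilation (τ x, 1) (annihilation (τ x, 0) Φ) = 0) (a : V → ℝ)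
    (hsum : ∑ x, ∑ z, ((a x * a z : ℝ) : ℂ) •
      annihilation (τ x, 1) (annihilation (τ z, 0) Φ) = 0) {x z : V} (hx : a x ≠ 0)
    (hz : a z ≠ 0) : singletAnn (τ x) (τ z) Φ = 0 := by
  set Ψ : V → V → Fock (X × Fin 2) := fun x z => annihilation (τ x, 1) (annihilation (τ z, 0) Φ)
    with hΨ
  have hnΨ : ∀ w x z, frameNumber u τ w (Ψ x z) =
      (1 - (if w = x then 1 else 0) - (if w = z then 1 else 0) : ℂ) • Ψ x z := by
    intro w x z
    have e1 := LinearMap.congr_fun (frameNumber_mul_annihilation hdual w x 1)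
      (annihilation (τ z, 0) Φ)
    have e2 := LinearMap.congr_fun (frameNumber_mul_annihilation hdual w z 0) Φ
    simp only [Module.End.mul_apply, LinearMap.sub_apply, hn] at e1 e2
    rw [e2] at e1
    simp only [hΨ]
    rw [e1, map_sub]
    split_ifs <;> simp
  -- Applying the frame number of `w` kills the off-diagonal terms meeting `w` and leaves those
  -- avoiding it unchanged. Diagonal terms vanish by `hd`.
  have hs : ∀ s : Finset V, ∑ x, ∑ z, (if x ∈ s ∨ z ∈ s then (0 : ℂ) else ((a x * a z : ℝ) : ℂ)) •
      Ψ x z = 0 := by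
    intro s
    induction s using Finset.induction_on with
    | empty => simpa using hsum
    | insert w s hw ih =>
      have := congrArg (frameNumber u τ w) ih
      simp only [map_sum, map_smul, map_zero, hnΨ] at this
      rw [← this]
      refine Finset.sum_congr rfl fun x _ => Finset.sum_congr rfl fun z _ => ?_
      rcases eq_or_ne x z with rfl | hxz
      · simp [hΨ, hd]
      · by_cases hwx : w = x
        · subst hwx; simp [hxz]
        · by_cases hwz : w = z
          · subst hwz; simp [hwx]
          · simp [hwx, hwz, Ne.symm hwx, Ne.symm hwz]
  rcases eq_or_ne x z with rfl | hxz
  · rw [singletAnn, LinearMap.add_apply, Module.End.mul_apply, hd, add_zero]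
  have h := hs (Finset.univ \ {x, z})
  have hzero : ∀ v, v ∉ ({x, z} : Finset V) → v ∈ Finset.univ \ {x, z} := fun v hv => by
    simpa using hv
  rw [← Finset.sum_subset (Finset.subset_univ {x, z})
    (fun v _ hv => Finset.sum_eq_zero fun w _ => by rw [if_pos (.inl (hzero v hv)), zero_smul]),
    Finset.sum_pair hxz,
    ← Finset.sum_subset (Finset.subset_univ {x, z})
    (fun v _ hv => by rw [if_pos (.inr (hzero v hv)), zero_smul]),
    ← Finset.sum_subset (Finset.subset_univ {x, z})
    (fun v _ hv => by rw [if_pos (.inr (hzero v hv)), zero_smul]),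
    Finset.sum_pair hxz, Finset.sum_pair hxz] at h
  simp only [Finset.mem_sdiff, Finset.mem_univ, true_and, Finset.mem_insert,
    Finset.mem_singleton, true_or, or_true, not_true_eq_false, or_self, if_false] at h
  have hxx : Ψ x x = 0 := hd x
  have hzz : Ψ z z = 0 := hd z
  rw [hxx, hzz, smul_zero, smul_zero, zero_add, add_zero, mul_comm (a z), ← smul_add] at h
  rw [singletAnn, LinearMap.add_apply, Module.End.mul_apply, Module.End.mul_apply]
  exact (smul_eq_zero.mp h).resolve_left (by exact_mod_cast mul_ne_zero hx hz)

-- Removing the electron at y after a singlet at x, z can be rewritten through the singlets at x, y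
-- and at y, z, so it gives zero. Yet the state with the singlet x, z removed still has frame number
-- one at y, and hence vanishes.
omit [Fintype V] in
lemma singlet_trans {Φ : Fock (X × Fin 2)} (hn : ∀ x, frameNumber u τ x Φ = Φ) {x y z : V}
    (hxy : singletAnn (τ x) (τ y) Φ = 0) (hyz : singletAnn (τ y) (τ z) Φ = 0) :
    singletAnn (τ x) (τ z) Φ = 0 := by
  rcases eq_or_ne y x with rfl | hyx
  · exact hyz
  rcases eq_or_ne y z with rfl | hyz'
  · exact hxy
  set W := singletAnn (τ x) (τ z) with hW
  have hcomm : frameNumber u τ y * W = W * frameNumber u τ y := by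
    have e : ∀ σ w, y ≠ w → Commute (frameNumber u τ y) (annihilation (τ w, σ)) := fun σ w h => by
      have := frameNumber_mul_annihilation hdual y w σ
      rwa [if_neg h, sub_zero] at this
    exact ((e _ _ hyx).mul_right (e _ _ hyz')).add_right ((e _ _ hyz').mul_right (e _ _ hyx))
  have hY : ∀ σ, annihilation (τ y, σ) (W Φ) = 0 := by
    have cx := fun σ ρ : Fin 2 => annihilation_mul_annihilation (τ x, σ) (τ y, ρ)
    have cz := fun σ ρ : Fin 2 => annihilation_mul_annihilation (τ z, σ) (τ y, ρ)
    have cxz := fun σ ρ : Fin 2 => annihilation_mul_annihilation (τ x, σ) (τ z, ρ)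
    have k0 : annihilation (τ y, (0 : Fin 2)) * W =
        -(annihilation (τ z, 0) * singletAnn (τ x) (τ y)) -
          annihilation (τ x, 0) * singletAnn (τ y) (τ z) := by
      rw [hW]; unfold singletAnn
      have x0 := cx 0 0; have x1 := cx 1 0; have z0 := cz 0 0; have z1 := cz 1 0
      have x0' := cx 0 1; have z0' := cz 0 1
      have xz00 := cxz 0 0; have xz10 := cxz 1 0; have xz01 := cxz 0 1
      generalize annihilation (τ x, (0 : Fin 2)) = p at *
      generalize annihilation (τ x, (1 : Fin 2)) = p' at *
      generalize annihilation (τ y, (0 : Fin 2)) = r at *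
      generalize annihilation (τ y, (1 : Fin 2)) = r' at *
      generalize annihilation (τ z, (0 : Fin 2)) = w at *
      generalize annihilation (τ z, (1 : Fin 2)) = w' at *
      linear_combination (norm := noncomm_ring) w * x1 - z0 * p' + r * xz10 + p * z1 - x0 * w'
        + r * xz01 + w * x0' + p * z0' - xz00 * r'
    have k1 : annihilation (τ y, (1 : Fin 2)) * W =
        -(annihilation (τ z, 1) * singletAnn (τ x) (τ y)) -
          annihilation (τ x, 1) * singletAnn (τ y) (τ z) := by
      rw [hW]; unfold singletAnn
      linear_combination (norm := noncomm_ring) cx 1 1 * annihilation (τ z, (0 : Fin 2)) +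
        cz 1 1 * annihilation (τ x, (0 : Fin 2)) + cxz 1 1 * annihilation (τ y, (0 : Fin 2))
    intro σ
    fin_cases σ
    · have := LinearMap.congr_fun k0 Φ
      simp only [Module.End.mul_apply, LinearMap.sub_apply, LinearMap.neg_apply, hxy, hyz,
        map_zero, neg_zero, sub_zero] at this
      exact this
    · have := LinearMap.congr_fun k1 Φ
      simp only [Module.End.mul_apply, LinearMap.sub_apply, LinearMap.neg_apply, hxy, hyz,
        map_zero, neg_zero, sub_zero] at this
      exact this
  have h1 : frameNumber u τ y (W Φ) = W Φ := by
    rw [← Module.End.mul_apply, hcomm, Module.End.mul_apply, hn]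
  rw [← h1, frameNumber, LinearMap.sum_apply]
  exact Finset.sum_eq_zero fun σ _ => by rw [Module.End.mul_apply, hY, map_zero]

end

omit [DecidableEq V] in
lemma pair_apply_eq_sum {Φ : Fock (X × Fin 2)}
    (h1 : ∀ y σ, annihilation (y, σ) Φ = ∑ x, (u x y : ℂ) • annihilation (τ x, σ) Φ) (y w : X) :
    annihilation (y, 1) (annihilation (w, 0) Φ) = ∑ x, ∑ z, ((u x y * u z w : ℝ) : ℂ) •
      annihilation (τ x, 1) (annihilation (τ z, 0) Φ) := by
  have hanti : ∀ i j : X × Fin 2, annihilation i (annihilation j Φ) =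
      -annihilation j (annihilation i Φ) := fun i j =>
    LinearMap.congr_fun (annihilation_mul_annihilation i j) Φ
  rw [h1 w, map_sum, Finset.sum_comm]
  refine Finset.sum_congr rfl fun z _ => ?_
  rw [map_smul, hanti, h1 y, map_sum, smul_neg, Finset.smul_sum, ← Finset.sum_neg_distrib]
  refine Finset.sum_congr rfl fun x _ => ?_
  rw [map_smul, hanti, smul_neg, smul_neg, neg_neg, smul_smul, mul_comm, Complex.ofReal_mul]

omit [DecidableEq V] in
lemma singletAnn_eq_zero {Φ : Fock (X × Fin 2)}
    (h1 : ∀ y σ, annihilation (y, σ) Φ = ∑ x, (u x y : ℂ) • annihilation (τ x, σ) Φ)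
    (h : ∀ x z, singletAnn (τ x) (τ z) Φ = 0) (y w : X) : singletAnn y w Φ = 0 := by
  rw [singletAnn, LinearMap.add_apply, Module.End.mul_apply, Module.End.mul_apply,
    pair_apply_eq_sum h1, pair_apply_eq_sum h1 w y]
  rw [Finset.sum_comm (f := fun x z => ((u x w * u z y : ℝ) : ℂ) •
    annihilation (τ x, 1) (annihilation (τ z, 0) Φ)), ← Finset.sum_add_distrib]
  refine Finset.sum_eq_zero fun x _ => ?_
  rw [← Finset.sum_add_distrib]
  refine Finset.sum_eq_zero fun z _ => ?_
  rw [mul_comm (u z w), ← smul_add]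
  have := h x z
  rw [singletAnn, LinearMap.add_apply, Module.End.mul_apply, Module.End.mul_apply] at this
  rw [this, smul_zero]

end DualFrame
end Hubbard
end

/-! ### Fully polarized filled states -/

noncomputable section
namespace Hubbard
section FilledState
variable {V X : Type} [Fintype X] [DecidableEq X]

/-- The state obtained from the vacuum by adding spin-up electrons in the states `u x`, `x ∈ l`. -/
def filled (u : V → X → ℝ) (l : List V) : Fock (X × Fin 2) :=
  (l.map fun x => cre (u x) 0).prod (vacuum _)

variable {u : V → X → ℝ}

lemma filled_nil : filled u [] = vacuum _ := rfl

lemma filled_cons (x : V) (l : List V) : filled u (x :: l) = cre (u x) 0 (filled u l) := by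
  simp [filled]

lemma ann_vacuum (f : X → ℝ) (σ : Fin 2) : ann f σ (vacuum _) = 0 := by
  simp [ann, annihilation_vacuum]

lemma ann_filled (f : X → ℝ) (σ : Fin 2) (l : List V) (h : ∀ x ∈ l, σ = 0 → f ⬝ᵥ u x = 0) :
    ann f σ (filled u l) = 0 := by
  induction l with
  | nil => exact ann_vacuum _ _
  | cons x l ih =>
    rw [filled_cons, ← Module.End.mul_apply, ann_mul_cre]
    have h1 : (if σ = 0 then ((f ⬝ᵥ u x : ℝ) : ℂ) else 0) = 0 := by
      split_ifs with hs
      · rw [h x (by simp) hs]; simp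
      · rfl
    rw [h1, zero_smul, zero_sub, LinearMap.neg_apply, Module.End.mul_apply,
      ih fun z hz => h z (by simp [hz])]
    simp

lemma cre_filled_of_mem (l : List V) {x : V} (hx : x ∈ l) : cre (u x) 0 (filled u l) = 0 := by
  induction l with
  | nil => simp at hx
  | cons z l ih =>
    rw [filled_cons, ← Module.End.mul_apply]
    rcases List.mem_cons.mp hx with rfl | h
    · rw [cre_mul_self]; rfl
    · rw [cre_mul_cre, LinearMap.neg_apply, Module.End.mul_apply, ih h]; simp

lemma totalNumber_filled (l : List V) :
    totalNumber (X × Fin 2) (filled u l) = (l.length : ℂ) • filled u l := by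
  induction l with
  | nil => simp [filled_nil, totalNumber, annihilation_vacuum]
  | cons x l ih =>
    have h : totalNumber (X × Fin 2) * cre (u x) 0 =
        cre (u x) 0 * totalNumber (X × Fin 2) + cre (u x) 0 := by
      rw [cre_eq, Finset.mul_sum, Finset.sum_mul, ← Finset.sum_add_distrib]
      refine Finset.sum_congr rfl fun y _ => ?_
      rw [mul_smul_comm, totalNumber_mul_creation, smul_mul_assoc, smul_add]
    have := LinearMap.congr_fun h (filled u l)
    rw [filled_cons, ← Module.End.mul_apply, h, LinearMap.add_apply, Module.End.mul_apply, ih,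
      map_smul, List.length_cons]
    push_cast
    module

variable [DecidableEq V] {τ : V → X}

/-- Annihilating at the dual point of the first vector recovers the state filled with the rest of
the list. -/
lemma filled_ne_zero (hdual : ∀ x z, u x (τ z) = if x = z then 1 else 0) (l : List V)
    (hl : l.Nodup) : filled u l ≠ 0 := by
  induction l with
  | nil => exact vacuum_ne_zero
  | cons x l ih =>
    obtain ⟨hx, hl⟩ := List.nodup_cons.mp hl
    intro h0
    apply ih hl
    have h1 : ann (Pi.single (τ x) 1) 0 (filled u l) = 0 := by
      refine ann_filled _ _ _ fun z hz _ => ?_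
      rw [single_one_dotProduct, hdual, if_neg]
      rintro rfl
      exact hx hz
    have h2 := congrArg (ann (Pi.single (τ x) 1) 0) h0
    rw [filled_cons, ← Module.End.mul_apply, ann_mul_cre_same, single_one_dotProduct, hdual,
      if_pos rfl, LinearMap.sub_apply, Module.End.mul_apply, h1] at h2
    simpa using h2

/-- Electrons are stripped off one at a time. By duality the conditions for the other vectors
survive the annihilation at `τ x`. -/
lemma exists_eq_filled (hdual : ∀ x z, u x (τ z) = if x = z then 1 else 0) (l : List V)
    (hl : l.Nodup) (ψ : Fock (X × Fin 2))
    (h : ∀ x ∈ l, cre (u x) 0 (annihilation (τ x, 0) ψ) = ψ) (n : ℂ)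
    (hn : totalNumber (X × Fin 2) ψ = n • ψ) :
    ∃ ψ₀, ψ = (l.map fun x => cre (u x) 0).prod ψ₀ ∧
      totalNumber (X × Fin 2) ψ₀ = (n - l.length) • ψ₀ := by
  induction l generalizing ψ n with
  | nil => exact ⟨ψ, rfl, by simpa using hn⟩
  | cons x l ih =>
    obtain ⟨hx, hl⟩ := List.nodup_cons.mp hl
    obtain ⟨ψ₀, h1, h2⟩ := ih hl (annihilation (τ x, 0) ψ) (fun z hz => by
      have hzx : z ≠ x := by rintro rfl; exact hx hz
      have e1 := annihilation_mul_cre (u z) (τ x) 0 0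
      rw [hdual, if_neg hzx] at e1
      have e2 := annihilation_mul_annihilation (τ z, (0 : Fin 2)) (τ x, 0)
      have e3 : cre (u z) 0 * annihilation (τ z, 0) * annihilation (τ x, 0) =
          annihilation (τ x, 0) * (cre (u z) 0 * annihilation (τ z, 0)) := by
        simp only [if_true, Complex.ofReal_zero, zero_smul] at e1
        linear_combination (norm := noncomm_ring) cre (u z) 0 * e2 - e1 * annihilation (τ z, 0)
      have e4 := LinearMap.congr_fun e3 ψ
      simp only [Module.End.mul_apply] at e4
      rw [e4, h z (by simp [hz])]) (n - 1) (by
      rw [← Module.End.mul_apply, totalNumber_mul_annihilation, LinearMap.sub_apply,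
        Module.End.mul_apply, hn, map_smul]
      module)
    refine ⟨ψ₀, ?_, ?_⟩
    · rw [List.map_cons, List.prod_cons, Module.End.mul_apply, ← h1, h x (by simp)]
    · rw [h2, List.length_cons]; push_cast; congr 1; ring

end FilledState

/-! ### A basis of the complement of the plaquettes -/

section Rods
variable {ν L : ℕ}

/-- Coefficients of the state dual to an edge in direction `l₀`, in terms of stars. -/
def rodWeight (l₀ : Fin ν) (γ : Vertex ν L) : ℝ :=
  if ∀ i, i ≠ l₀ → γ i = 0 then 1 / 2 * (-1) ^ (γ l₀).val else 0

/-- The state orthogonal to all plaquettes that is `1` on `(x, l₀)` and vanishes on all other edges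
in direction `l₀`. -/
def rodVec (l₀ : Fin ν) (x : Vertex ν L) (y : Site ν L) : ℝ :=
  rodWeight l₀ (x - y.1) + rodWeight l₀ (x - (y.1 + unitVec y.2))

lemma rodWeight_add (l₀ : Fin ν) (hodd : Odd L) (hL : 3 ≤ L) (γ : Vertex ν L) :
    rodWeight l₀ γ + rodWeight l₀ (γ - unitVec l₀) = if γ = 0 then 1 else 0 := by
  have hiff : (∀ i, i ≠ l₀ → (γ - unitVec l₀ : Vertex ν L) i = 0) ↔ (∀ i, i ≠ l₀ → γ i = 0) :=
    forall_congr' fun i => forall_congr' fun hi => by simp [unitVec_apply, hi]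
  have : NeZero L := ⟨by omega⟩
  have : Fact (1 < L) := ⟨by omega⟩
  unfold rodWeight
  simp only [hiff]
  by_cases h : ∀ i, i ≠ l₀ → γ i = 0
  · have h0 : γ = 0 ↔ γ l₀ = 0 := by
      constructor
      · rintro rfl; rfl
      · intro h'
        funext i
        by_cases hi : i = l₀
        · rw [hi, h']; rfl
        · exact h i hi
    simp only [h0, if_pos h, Pi.sub_apply, unitVec_apply, if_true]
    generalize γ l₀ = z
    by_cases hz : z = 0
    · subst hz
      -- At the seam both weights are +1/2 because L - 1 is even, and they add up to one. For even L
      -- they would cancel.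
      have h1 : (0 - 1 : ZMod L).val = L - 1 := by
        obtain ⟨n, rfl⟩ : ∃ n, L = n + 1 := ⟨L - 1, by omega⟩
        rw [zero_sub, ZMod.val_neg_one]; rfl
      have h2 : Even (L - 1) := by
        obtain ⟨k, hk⟩ := hodd
        exact ⟨k, by omega⟩
      rw [if_pos rfl, h1, h2.neg_one_pow, ZMod.val_zero]
      norm_num
    · have hz' : z.val ≠ 0 := by rwa [Ne, ZMod.val_eq_zero]
      have h1 : (z - 1).val = z.val - 1 := by
        rw [ZMod.val_sub (by rw [ZMod.val_one]; omega), ZMod.val_one]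
      obtain ⟨k, hk⟩ := Nat.exists_eq_succ_of_ne_zero hz'
      rw [if_neg hz, h1, hk, Nat.succ_eq_add_one, Nat.add_sub_cancel, pow_succ]
      ring
  · have h0 : γ ≠ 0 := by
      rintro rfl
      exact h fun _ _ => rfl
    simp [h, h0]

lemma rodVec_dual (l₀ : Fin ν) (hodd : Odd L) (hL : 3 ≤ L) (x z : Vertex ν L) :
    rodVec l₀ x (z, l₀) = if x = z then 1 else 0 := by
  have := rodWeight_add l₀ hodd hL (x - z)
  simp only [sub_eq_zero] at this
  rw [← this, rodVec, sub_sub]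

lemma plaquette_dotProduct [NeZero L] (hL : 3 ≤ L) (α : Vertex ν L) (l m : Fin ν)
    (f : Site ν L → ℝ) : plaquette α l m ⬝ᵥ f =
      f (α, l) + f (α + unitVec m, l) - (f (α, m) + f (α + unitVec l, m)) := by
  rw [plaquette, railVec_eq hL, railVec_eq hL]
  simp [sub_dotProduct, add_dotProduct]

/-- A rod vector is a superposition of stars: its value on an edge is the sum of a vertex function
over the two ends. The alternating sum around a plaquette cancels at each corner. -/
lemma plaquette_dotProduct_rodVec [NeZero L] (hL : 3 ≤ L) (l₀ : Fin ν) (α : Vertex ν L)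
    (l m : Fin ν) (x : Vertex ν L) : plaquette α l m ⬝ᵥ rodVec l₀ x = 0 := by
  rw [plaquette_dotProduct hL]
  simp only [rodVec]
  rw [add_right_comm α (unitVec l) (unitVec m)]
  ring

/-- A function on the edges that is orthogonal to the plaquettes is determined by its values on the
edges in direction `l₀`. -/
lemma eq_sum_rodVec [NeZero L] {M : Type*} [AddCommGroup M] [Module ℂ M] (l₀ : Fin ν)
    (hodd : Odd L) (hL : 3 ≤ L) (f : Site ν L → M)
    (hf : ∀ α l, f (α, l₀) + f (α + unitVec l, l₀) = f (α, l) + f (α + unitVec l₀, l))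
    (y : Site ν L) : f y = ∑ x, (rodVec l₀ x y : ℂ) • f (x, l₀) := by
  set w : Vertex ν L → M := fun α => ∑ x, (rodWeight l₀ (x - α) : ℂ) • f (x, l₀) with hw
  have hw1 : ∀ α, w α + w (α + unitVec l₀) = f (α, l₀) := by
    intro α
    simp only [hw, ← Finset.sum_add_distrib, ← add_smul]
    have : ∀ x, ((rodWeight l₀ (x - α) : ℂ) + (rodWeight l₀ (x - (α + unitVec l₀)) : ℂ)) =
        if x = α then 1 else 0 := by
      intro x
      have h := rodWeight_add l₀ hodd hL (x - α)
      rw [sub_sub] at h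
      simp only [sub_eq_zero] at h
      rw [← Complex.ofReal_add, h]
      split_ifs <;> simp
    simp [this]
  obtain ⟨α, l⟩ := y
  have hrhs : ∑ x, (rodVec l₀ x (α, l) : ℂ) • f (x, l₀) = w α + w (α + unitVec l) := by
    simp only [hw, ← Finset.sum_add_distrib, ← add_smul, rodVec, Complex.ofReal_add]
  rw [hrhs]
  -- The plaquette relation makes the defect `g` change sign under a step along `l₀`. After an odd
  -- number L of steps it returns to its starting point with the opposite sign.
  set g : Vertex ν L → M := fun α => f (α, l) - (w α + w (α + unitVec l)) with hg
  have hg1 : ∀ α, g (α + unitVec l₀) = - g α := by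
    intro α
    have h1 := hw1 α
    have h2 := hw1 (α + unitVec l)
    have h3 := hf α l
    rw [← h1, ← h2] at h3
    simp only [hg]
    rw [add_right_comm α (unitVec l₀) (unitVec l)]
    have h4 : f (α + unitVec l₀, l) = w α + w (α + unitVec l₀) + (w (α + unitVec l) +
        w (α + unitVec l + unitVec l₀)) - f (α, l) := by rw [h3]; abel
    rw [h4]; abel
  have hg2 : ∀ n : ℕ, g (α + n • unitVec l₀) = (-1 : ℂ) ^ n • g α := by
    intro n
    induction n with
    | zero => simp
    | succ n ih => rw [succ_nsmul, ← add_assoc, hg1, ih, pow_succ, mul_neg_one, neg_smul]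
  have hg3 := hg2 L
  have hL0 : L • (unitVec l₀ : Vertex ν L) = 0 := by
    funext i
    simp
  rw [hL0, add_zero, hodd.neg_one_pow, neg_one_smul] at hg3
  have := eq_zero_of_eq_neg_self hg3
  simpa [hg, sub_eq_zero] using this

lemma starVec_eq_sum [NeZero L] (l₀ : Fin ν) (hodd : Odd L) (hL : 3 ≤ L) (α : Vertex ν L) :
    starVec α = ∑ x, starVec α (x, l₀) • rodVec l₀ x := by
  funext y
  have h := eq_sum_rodVec (M := ℂ) l₀ hodd hL (fun y => (starVec α y : ℂ)) (fun β l => by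
    simp only [starVec]
    rw [add_right_comm β (unitVec l) (unitVec l₀)]
    push_cast
    ring) y
  rw [Finset.sum_apply]
  simp only [Pi.smul_apply, smul_eq_mul]
  have h2 : ((starVec α y : ℝ) : ℂ) = ((∑ x, starVec α (x, l₀) * rodVec l₀ x y : ℝ) : ℂ) := by
    rw [h]
    push_cast
    exact Finset.sum_congr rfl fun x _ => by rw [smul_eq_mul, mul_comm]
  exact_mod_cast h2

lemma rodWeight_of_ne (l₀ : Fin ν) (γ : Vertex ν L) {i : Fin ν} (hi : i ≠ l₀) (h : γ i ≠ 0) :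
    rodWeight l₀ γ = 0 := if_neg fun h' => h (h' i hi)

lemma rodWeight_ne_zero (l₀ : Fin ν) (γ : Vertex ν L) (h : ∀ i, i ≠ l₀ → γ i = 0) :
    rodWeight l₀ γ ≠ 0 := by
  rw [rodWeight, if_pos h]
  positivity

/-- Induction on the periodic lattice. -/
lemma forall_of_forall_unitVec [NeZero L] (R : Vertex ν L → Vertex ν L → Prop) (hrefl : ∀ α, R α α)
    (htrans : ∀ α β γ, R α β → R β γ → R α γ) (h : ∀ α l, R α (α + unitVec l)) (α β) : R α β := by
  let A : AddSubmonoid (Vertex ν L) :=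
    { carrier := {v | ∀ α, R α (α + v)}
      zero_mem' := fun α => by rw [add_zero]; exact hrefl α
      add_mem' := fun {a b} ha hb α => htrans _ _ _ (ha α) (by rw [← add_assoc]; exact hb _) }
  have hA : β - α ∈ A := by
    have : β - α = ∑ l, ((β - α) l).val • unitVec l := by
      funext i
      have : ∀ l, (((β - α) l).val • (unitVec l : Vertex ν L)) i = if i = l then (β - α) l else 0 := by
        intro l
        rw [Pi.smul_apply, unitVec_apply, nsmul_eq_mul, ZMod.natCast_zmod_val, mul_ite, mul_one,
          mul_zero]
      rw [Finset.sum_apply, Finset.sum_congr rfl fun l _ => this l, Finset.sum_ite_eq,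
        if_pos (Finset.mem_univ i)]
    rw [this]
    exact A.sum_mem fun l _ => A.nsmul_mem (fun γ => h γ l) _
  have := hA α
  rwa [add_sub_cancel] at this

end Rods
end Hubbard
end

/-! ### Maximal spin and the spin multiplet -/

noncomputable section
namespace Hubbard
section Multiplet
variable {X : Type} [Fintype X] [DecidableEq X] {N : ℕ} {ψ : Fock (X × Fin 2)}

lemma hasTotalSpin_of_singletAnn_eq_zero (hN : totalNumber (X × Fin 2) ψ = (N : ℂ) • ψ)
    (hs : ∀ x y, singletAnn x y ψ = 0) : HasTotalSpin ((N : ℝ) / 2) ψ := by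
  rw [HasTotalSpin, totalSpinSq_eq, sq]
  simp only [LinearMap.sub_apply, LinearMap.add_apply, LinearMap.smul_apply, LinearMap.sum_apply,
    Module.End.mul_apply, hN, map_smul, hs, map_zero, Finset.sum_const_zero, smul_zero, sub_zero]
  push_cast
  module

/-- By `totalSpinSq_eq` the expectation of the squared spin is the maximal value minus half a sum of
squared norms. -/
lemma spin_le_of_hasTotalSpin (hN : totalNumber (X × Fin 2) ψ = (N : ℂ) • ψ) (hψ : ψ ≠ 0) {S : ℝ}
    (hS : 0 ≤ S) (h : HasTotalSpin S ψ) : S ≤ (N : ℝ) / 2 := by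
  have h1 : (inner ℂ ψ (totalSpinSq X ψ)).re = S * (S + 1) * ‖ψ‖ ^ 2 := by
    rw [h, inner_smul_right, Complex.re_ofReal_mul, re_inner_self]
  have h2 : totalSpinSq X ψ = (((N : ℝ) / 2 * ((N : ℝ) / 2 + 1) : ℝ) : ℂ) • ψ -
      (((1 / 2 : ℝ) : ℂ) • ∑ x : X, ∑ y : X, (star (singletAnn x y) * singletAnn x y) ψ) := by
    rw [totalSpinSq_eq, sq]
    simp only [LinearMap.sub_apply, LinearMap.add_apply, LinearMap.smul_apply,
      LinearMap.sum_apply, Module.End.mul_apply, hN, map_smul]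
    push_cast
    module
  rw [h2, inner_sub_right, inner_smul_right, inner_smul_right, Complex.sub_re,
    Complex.re_ofReal_mul, Complex.re_ofReal_mul, re_inner_self] at h1
  simp only [inner_sum, Complex.re_sum, re_inner_star_mul] at h1
  have h3 : 0 ≤ ∑ x : X, ∑ y : X, ‖singletAnn x y ψ‖ ^ 2 :=
    Finset.sum_nonneg fun _ _ => Finset.sum_nonneg fun _ _ => sq_nonneg _
  have h4 : 0 < ‖ψ‖ ^ 2 := by positivity
  have h5 : S * (S + 1) ≤ (N : ℝ) / 2 * ((N : ℝ) / 2 + 1) := by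
    refine le_of_mul_le_mul_right ?_ h4
    linarith
  by_contra! hlt
  have : (0 : ℝ) ≤ (N : ℝ) / 2 := by positivity
  nlinarith

lemma spinHop_lower_raise_apply (hN : totalNumber (X × Fin 2) ψ = (N : ℂ) • ψ)
    (hs : ∀ x y, singletAnn x y ψ = 0) {m : ℂ} (hm : spinHop X 1 1 ψ = m • ψ) :
    spinHop X 1 0 (spinHop X 0 1 ψ) = (m * (N + 1 - m)) • ψ := by
  have h0 : spinHop X 0 0 ψ = (N - m) • ψ := by
    rw [totalNumber_eq, LinearMap.add_apply, hm] at hN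
    rw [eq_sub_of_add_eq hN, sub_smul]
  rw [← Module.End.mul_apply, spinHop_lower_mul_raise]
  simp only [LinearMap.sub_apply, LinearMap.add_apply, LinearMap.smul_apply, LinearMap.sum_apply,
    Module.End.mul_apply, hs, map_zero, Finset.sum_const_zero, smul_zero, sub_zero, hm, map_smul,
    h0]
  module

lemma spinHop_raise_lower_apply (hN : totalNumber (X × Fin 2) ψ = (N : ℂ) • ψ)
    (hs : ∀ x y, singletAnn x y ψ = 0) {m : ℂ} (hm : spinHop X 1 1 ψ = m • ψ) :
    spinHop X 0 1 (spinHop X 1 0 ψ) = ((m + 1) * (N - m)) • ψ := by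
  have h0 : spinHop X 0 0 ψ = (N - m) • ψ := by
    rw [totalNumber_eq, LinearMap.add_apply, hm] at hN
    rw [eq_sub_of_add_eq hN, sub_smul]
  have h := LinearMap.congr_fun (spinHop_mul_spinHop_sub (X := X) 0 1 1 0) ψ
  simp only [if_true, LinearMap.sub_apply, LinearMap.add_apply, Module.End.mul_apply,
    spinHop_lower_raise_apply hN hs hm, h0, hm] at h
  rw [h]
  module

lemma spinHop_down_raise_apply {m : ℂ} (hm : spinHop X 1 1 ψ = m • ψ) :
    spinHop X 1 1 (spinHop X 0 1 ψ) = (m - 1) • spinHop X 0 1 ψ := by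
  have h := LinearMap.congr_fun (spinHop_mul_spinHop_sub (X := X) 1 1 0 1) ψ
  simp only [if_true, zero_ne_one, if_false, LinearMap.sub_apply, Module.End.mul_apply, hm,
    map_smul, add_zero] at h
  rw [h]
  module

lemma spinHop_down_lower_apply {m : ℂ} (hm : spinHop X 1 1 ψ = m • ψ) :
    spinHop X 1 1 (spinHop X 1 0 ψ) = (m + 1) • spinHop X 1 0 ψ := by
  have h := LinearMap.congr_fun (spinHop_mul_spinHop_sub (X := X) 1 1 1 0) ψ
  simp only [if_true, zero_ne_one, if_false, LinearMap.add_apply, Module.End.mul_apply, hm,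
    map_smul, sub_zero] at h
  rw [h]
  module

lemma exists_nat_eq_of_spinHop_down (hN : totalNumber (X × Fin 2) ψ = (N : ℂ) • ψ) (hψ : ψ ≠ 0)
    {m : ℂ} (hm : spinHop X 1 1 ψ = m • ψ) : ∃ k : ℕ, k ≤ N ∧ m = k := by
  obtain ⟨S, hS⟩ : ∃ S, ψ S ≠ 0 := by
    by_contra! h
    exact hψ (by ext S; exact h S)
  have h1 := spinHop_diag_apply 1 ψ S
  have h2 := totalNumber_apply ψ S
  rw [hm] at h1
  rw [hN] at h2
  have h1' := mul_right_cancel₀ hS h1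
  have h2' : (N : ℂ) = S.card := mul_right_cancel₀ hS h2
  refine ⟨_, ?_, h1'⟩
  have h3 : N = S.card := by exact_mod_cast h2'
  rw [h3]
  exact Finset.card_le_card_of_injOn (fun x => (x, 1)) (fun x hx => by simpa using hx)
    (fun x _ y _ h => congrArg Prod.fst h)

variable {W : Submodule ℂ (Fock (X × Fin 2))} {Φ : Fock (X × Fin 2)}

section
variable (hF : ∀ σ τ, ∀ ψ ∈ W, spinHop X σ τ ψ ∈ W)
include hF

lemma spinHop_lower_pow_mem (hΦ : Φ ∈ W) (k : ℕ) : (spinHop X 1 0 ^ k) Φ ∈ W := by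
  induction k with
  | zero => exact hΦ
  | succ k ih => rw [pow_succ', Module.End.mul_apply]; exact hF _ _ _ ih

omit hF in
lemma spinHop_down_lower_pow (hΦ0 : spinHop X 1 1 Φ = 0) (k : ℕ) :
    spinHop X 1 1 ((spinHop X 1 0 ^ k) Φ) = (k : ℂ) • (spinHop X 1 0 ^ k) Φ := by
  induction k with
  | zero => simp [hΦ0]
  | succ k ih =>
    rw [pow_succ', Module.End.mul_apply, spinHop_down_lower_apply ih]
    push_cast
    rfl

variable (hN : ∀ ψ ∈ W, totalNumber (X × Fin 2) ψ = (N : ℂ) • ψ)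
  (hs : ∀ ψ ∈ W, ∀ x y, singletAnn x y ψ = 0)
include hN hs

lemma spinHop_lower_pow_ne_zero (hΦ : Φ ∈ W) (hΦne : Φ ≠ 0) (hΦ0 : spinHop X 1 1 Φ = 0) (k : ℕ)
    (hk : k ≤ N) : (spinHop X 1 0 ^ k) Φ ≠ 0 := by
  induction k with
  | zero => exact hΦne
  | succ k ih =>
    intro h0
    have hmem := spinHop_lower_pow_mem hF hΦ k
    have h := spinHop_raise_lower_apply (hN _ hmem) (hs _ hmem) (spinHop_down_lower_pow hΦ0 k)
    rw [pow_succ', Module.End.mul_apply] at h0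
    rw [h0, map_zero] at h
    have h1 : ((k : ℂ) + 1) * (N - k) ≠ 0 :=
      mul_ne_zero (by exact_mod_cast Nat.succ_ne_zero k)
        (sub_ne_zero.mpr (by exact_mod_cast (by omega : N ≠ k)))
    exact ih (by omega) ((smul_eq_zero.mp h.symm).resolve_left h1)

/-- Raising leads to the previous level, where the state is known. Lowering again multiplies by
(k+1)(N-k), which is nonzero below the bottom of the multiplet. -/
lemma exists_eq_smul_lower_pow (huniq : ∀ ψ ∈ W, spinHop X 1 1 ψ = 0 → ∃ c : ℂ, ψ = c • Φ) (k : ℕ)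
    (hk : k ≤ N) : ∀ ψ ∈ W, spinHop X 1 1 ψ = (k : ℂ) • ψ →
      ∃ c : ℂ, ψ = c • (spinHop X 1 0 ^ k) Φ := by
  induction k with
  | zero => intro ψ hψ h; exact huniq ψ hψ (by simpa using h)
  | succ k ih =>
    intro ψ hψ h
    have h1 := spinHop_down_raise_apply h
    push_cast at h1
    rw [add_sub_cancel_right] at h1
    obtain ⟨c, hc⟩ := ih (by omega) _ (hF 0 1 ψ hψ) h1
    have h2 := spinHop_lower_raise_apply (hN ψ hψ) (hs ψ hψ) h
    rw [hc, map_smul, ← Module.End.mul_apply, ← pow_succ'] at h2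
    have h3 : (((k + 1 : ℕ) : ℂ)) * (N + 1 - (k + 1 : ℕ)) ≠ 0 := by
      refine mul_ne_zero (by exact_mod_cast Nat.succ_ne_zero k) (sub_ne_zero.mpr ?_)
      exact_mod_cast (by omega : N + 1 ≠ k + 1)
    refine ⟨(((k + 1 : ℕ) : ℂ) * (N + 1 - (k + 1 : ℕ)))⁻¹ * c, ?_⟩
    rw [mul_smul, h2, inv_smul_smul₀ h3]

/-- A space of maximal spin, invariant under spin rotations, with a single state of maximal
magnetization is a single multiplet. -/
theorem eq_span_lower_pow (hΦ : Φ ∈ W)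
    (huniq : ∀ ψ ∈ W, spinHop X 1 1 ψ = 0 → ∃ c : ℂ, ψ = c • Φ) :
    W = Submodule.span ℂ (Set.range fun k : Fin (N + 1) => (spinHop X 1 0 ^ (k : ℕ)) Φ) := by
  apply le_antisymm
  · have hsym : (spinHop X 1 1).IsSymmetric :=
      (LinearMap.isSymmetric_iff_isSelfAdjoint _).mpr (star_spinHop 1 1)
    have htop : ⨆ μ, (spinHop X 1 1).genEigenspace μ 1 = ⊤ :=
      (Submodule.orthogonal_eq_bot_iff).mp hsym.orthogonalComplement_iSup_eigenspaces_eq_bot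
    have h := Submodule.inf_iSup_genEigenspace (hF 1 1) 1
    rw [htop, inf_top_eq] at h
    rw [h]
    refine iSup_le fun μ ψ hψ => ?_
    obtain ⟨hψW, hψμ⟩ := Submodule.mem_inf.mp hψ
    have hμ : spinHop X 1 1 ψ = μ • ψ := Module.End.mem_eigenspace_iff.mp hψμ
    rcases eq_or_ne ψ 0 with rfl | hne
    · exact Submodule.zero_mem _
    obtain ⟨k, hk, rfl⟩ := exists_nat_eq_of_spinHop_down (hN ψ hψW) hne hμ
    obtain ⟨c, rfl⟩ := exists_eq_smul_lower_pow hF hN hs huniq k hk ψ hψW hμ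
    exact Submodule.smul_mem _ _ (Submodule.subset_span ⟨⟨k, by omega⟩, rfl⟩)
  · rw [Submodule.span_le]
    rintro _ ⟨k, rfl⟩
    exact spinHop_lower_pow_mem hF hΦ k

theorem finrank_eq_of_multiplet (hΦ : Φ ∈ W) (hΦne : Φ ≠ 0) (hΦ0 : spinHop X 1 1 Φ = 0)
    (huniq : ∀ ψ ∈ W, spinHop X 1 1 ψ = 0 → ∃ c : ℂ, ψ = c • Φ) :
    Module.finrank ℂ W = N + 1 := by
  have hli : LinearIndependent ℂ fun k : Fin (N + 1) => (spinHop X 1 0 ^ (k : ℕ)) Φ :=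
    Module.End.eigenvectors_linearIndependent' (spinHop X 1 1) (fun k : Fin (N + 1) => ((k : ℕ) : ℂ))
      (fun a b h => Fin.ext (Nat.cast_injective (R := ℂ) h)) _ fun k =>
      Module.End.hasEigenvector_iff.mpr
        ⟨Module.End.mem_eigenspace_iff.mpr (spinHop_down_lower_pow hΦ0 k),
        spinHop_lower_pow_ne_zero hF hN hs hΦ hΦne hΦ0 k (by omega)⟩
  rw [eq_span_lower_pow hF hN hs hΦ huniq, finrank_span_eq_card hli, Fintype.card_fin]

end
end Multiplet
end Hubbard
end

/-! ### Ground states of the Hamiltonian -/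

noncomputable section
namespace Hubbard
section GroundStates
variable {ν L : ℕ} [NeZero L]

lemma commute_spinHop_hamiltonian (s t U : ℝ) (σ τ : Fin 2) :
    Commute (spinHop (Site ν L) σ τ) (hamiltonian ν L s t U) := by
  have h : hoppingTerm ν L s t = ∑ x : Site ν L, ∑ y : Site ν L,
      (hoppingAmplitude s t x y : ℂ) • ∑ ρ, creation (x, ρ) * annihilation (y, ρ) := by
    rw [hoppingTerm, Finset.sum_comm]
    refine Finset.sum_congr rfl fun x _ => ?_
    rw [Finset.sum_comm]
    exact Finset.sum_congr rfl fun y _ => Finset.smul_sum.symm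
  rw [hamiltonian, h, interactionTerm]
  exact (Commute.sum_right _ _ _ fun x _ => Commute.sum_right _ _ _ fun y _ =>
    (commute_spinHop_pair σ τ x y).smul_right _).add_right
    ((Commute.sum_right _ _ _ fun x _ => commute_spinHop_double σ τ x).smul_right _)

lemma mem_energySpace {ι : Type} [Fintype ι] [DecidableEq ι] {H : Op ι} {N : ℕ} {E : ℝ}
    {ψ : Fock ι} :
    ψ ∈ energySpace H N E ↔ totalNumber ι ψ = (N : ℂ) • ψ ∧ H ψ = (E : ℂ) • ψ := by
  rw [energySpace, Submodule.mem_inf, mem_electronSpace, Module.End.mem_eigenspace_iff]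

lemma spinHop_mem_energySpace {s t U : ℝ} {N : ℕ} {E : ℝ} (σ τ : Fin 2) (ψ : Fock (Mode ν L))
    (hψ : ψ ∈ energySpace (hamiltonian ν L s t U) N E) :
    spinHop (Site ν L) σ τ ψ ∈ energySpace (hamiltonian ν L s t U) N E := by
  obtain ⟨h1, h2⟩ := mem_energySpace.mp hψ
  have e1 := LinearMap.congr_fun (commute_spinHop_totalNumber (X := Site ν L) σ τ).eq ψ
  have e2 := LinearMap.congr_fun (commute_spinHop_hamiltonian (ν := ν) (L := L) s t U σ τ).eq ψ
  rw [Module.End.mul_apply, Module.End.mul_apply] at e1 e2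
  rw [mem_energySpace, ← e1, ← e2, h1, h2, map_smul, map_smul]
  exact ⟨rfl, rfl⟩

lemma starVec_dotProduct_self (hL : 3 ≤ L) (α : Vertex ν L) :
    starVec α ⬝ᵥ starVec α = 2 * ν := by
  have h := placed_dotProduct (legSite_injective hL α) (fun _ => 1) (fun _ => 1)
  rw [placed_legSite, one_smul] at h
  rw [h]
  simp [mul_comm]

/-- The ferromagnetic state with all spins up. -/
def allUp (ν L : ℕ) [NeZero L] (l₀ : Fin ν) : Fock (Mode ν L) :=
  filled (rodVec l₀) (Finset.univ : Finset (Vertex ν L)).toList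

section
variable (l₀ : Fin ν)

lemma allUp_ne_zero (hodd : Odd L) (hL : 3 ≤ L) : allUp ν L l₀ ≠ 0 :=
  filled_ne_zero (τ := fun x => (x, l₀)) (rodVec_dual l₀ hodd hL) _ (Finset.nodup_toList _)

lemma ann_down_allUp (f : Site ν L → ℝ) : ann f 1 (allUp ν L l₀) = 0 :=
  ann_filled _ _ _ fun _ _ h => absurd h one_ne_zero

lemma ann_plaquette_allUp (hL : 3 ≤ L) (α : Vertex ν L) (l m : Fin ν) (σ : Fin 2) :
    ann (plaquette α l m) σ (allUp ν L l₀) = 0 :=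
  ann_filled _ _ _ fun x _ _ => plaquette_dotProduct_rodVec hL l₀ α l m x

/-- Stars lie in the span of the rod vectors, all of which are already filled. Hence every star
operator takes its full value 2ν for spin up. -/
lemma cre_starVec_allUp (hodd : Odd L) (hL : 3 ≤ L) (α : Vertex ν L) :
    cre (starVec α) 0 (allUp ν L l₀) = 0 := by
  rw [starVec_eq_sum l₀ hodd hL, cre_sum, LinearMap.sum_apply]
  refine Finset.sum_eq_zero fun x _ => ?_
  rw [cre_smul, LinearMap.smul_apply, allUp, cre_filled_of_mem _ (by simp), smul_zero]

lemma totalNumber_allUp :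
    totalNumber _ (allUp ν L l₀) = (Fintype.card (Vertex ν L) : ℂ) • allUp ν L l₀ := by
  rw [allUp, totalNumber_filled, Finset.length_toList, Finset.card_univ]

lemma hamiltonian_allUp (hodd : Odd L) (hL : 3 ≤ L) (s t U : ℝ) :
    hamiltonian ν L s t U (allUp ν L l₀) =
      ((-2 * ν * s * (Fintype.card (Vertex ν L) : ℝ) : ℝ) : ℂ) • allUp ν L l₀ := by
  have h1 : ∀ α : Vertex ν L, (cre (starVec α) 0 * ann (starVec α) 0) (allUp ν L l₀) =
      ((2 * ν : ℝ) : ℂ) • allUp ν L l₀ := by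
    intro α
    have h := ann_mul_cre_same (starVec α) (starVec α) 0
    rw [starVec_dotProduct_self hL] at h
    rw [eq_sub_iff_add_eq, ← eq_sub_iff_add_eq'] at h
    rw [h, LinearMap.sub_apply, Module.End.mul_apply, cre_starVec_allUp l₀ hodd hL, map_zero,
      sub_zero]
    rfl
  have h2 : ∀ α : Vertex ν L, (cre (starVec α) 1 * ann (starVec α) 1) (allUp ν L l₀) = 0 := by
    intro α
    rw [Module.End.mul_apply, ann_down_allUp, map_zero]
  have h3 : ∀ x : Site ν L, pairAnn (Pi.single x 1) (allUp ν L l₀) = 0 := by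
    intro x
    have : pairAnn (Pi.single x 1 : Site ν L → ℝ) =
        -(ann (Pi.single x 1) 0 * ann (Pi.single x 1) 1) := by
      rw [pairAnn, ann_mul_ann]
    rw [this, LinearMap.neg_apply, Module.End.mul_apply, ann_down_allUp, map_zero, neg_zero]
  rw [hamiltonian, hoppingTerm_eq hL, interactionTerm_eq]
  simp only [LinearMap.add_apply, LinearMap.smul_apply, LinearMap.sum_apply, Fin.sum_univ_two, h1,
    h2]
  simp only [Module.End.mul_apply, ann_plaquette_allUp l₀ hL, h3, map_zero,
    Finset.sum_const_zero, smul_zero, add_zero, Finset.sum_const, Finset.card_univ,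
    ← Nat.cast_smul_eq_nsmul ℂ]
  push_cast
  module

lemma allUp_mem_energySpace (hodd : Odd L) (hL : 3 ≤ L) (s t U : ℝ) :
    allUp ν L l₀ ∈ energySpace (hamiltonian ν L s t U) (Fintype.card (Vertex ν L))
      (-2 * ν * s * (Fintype.card (Vertex ν L) : ℝ)) :=
  mem_energySpace.mpr ⟨totalNumber_allUp l₀, hamiltonian_allUp l₀ hodd hL s t U⟩

lemma spinHop_down_allUp : spinHop (Site ν L) 1 1 (allUp ν L l₀) = 0 := by
  rw [spinHop, LinearMap.sum_apply]
  refine Finset.sum_eq_zero fun x _ => ?_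
  rw [Module.End.mul_apply, ← ann_single, ann_down_allUp, map_zero]

end

/-- States with one electron per vertex, no double occupancy and energy zero on the plaquettes. -/
structure IsFlat (Φ : Fock (Mode ν L)) : Prop where
  number : totalNumber _ Φ = (Fintype.card (Vertex ν L) : ℂ) • Φ
  plaquette : ∀ α l m σ, ann (plaquette α l m) σ Φ = 0
  pair : ∀ x : Site ν L, pairAnn (Pi.single x 1) Φ = 0

namespace IsFlat
variable {Φ : Fock (Mode ν L)} (l₀ : Fin ν)

lemma annihilation_annihilation (h : IsFlat Φ) (y : Site ν L) :
    annihilation (y, 1) (annihilation (y, 0) Φ) = 0 := by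
  have := h.pair y
  rwa [pairAnn, Module.End.mul_apply, ann_single, ann_single] at this

lemma annihilation_eq_sum (h : IsFlat Φ) (hodd : Odd L) (hL : 3 ≤ L) (y : Site ν L) (σ : Fin 2) :
    annihilation (y, σ) Φ = ∑ x, (rodVec l₀ x y : ℂ) • annihilation ((x, l₀), σ) Φ := by
  refine eq_sum_rodVec l₀ hodd hL (fun y => annihilation (y, σ) Φ) (fun α l => ?_) y
  have := h.plaquette α l₀ l σ
  rw [Hubbard.plaquette, railVec_eq hL, railVec_eq hL, ann_sub, ann_add, ann_add, ann_single,
    ann_single, ann_single, ann_single, LinearMap.sub_apply, sub_eq_zero] at this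
  exact this

lemma frameNumber_apply (h : IsFlat Φ) (hodd : Odd L) (hL : 3 ≤ L) (x : Vertex ν L) :
    frameNumber (rodVec l₀) (fun x => (x, l₀)) x Φ = Φ :=
  frameNumber_apply_eq (rodVec_dual l₀ hodd hL) (h.annihilation_eq_sum l₀ hodd hL)
    h.annihilation_annihilation h.number x

lemma singletAnn_of_rodVec_ne_zero (h : IsFlat Φ) (hodd : Odd L) (hL : 3 ≤ L) (y : Site ν L)
    {x z : Vertex ν L} (hx : rodVec l₀ x y ≠ 0) (hz : rodVec l₀ z y ≠ 0) :
    singletAnn (x, l₀) (z, l₀) Φ = 0 := by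
  refine singlet_of_sum_eq_zero (τ := fun x => (x, l₀)) (rodVec_dual l₀ hodd hL)
    (h.frameNumber_apply l₀ hodd hL) (fun x => h.annihilation_annihilation _)
    (fun x => rodVec l₀ x y) ?_ hx hz
  rw [← pair_apply_eq_sum (τ := fun x => (x, l₀)) (h.annihilation_eq_sum l₀ hodd hL),
    h.annihilation_annihilation]

lemma singletAnn_apply (h : IsFlat Φ) (hodd : Odd L) (hL : 3 ≤ L) (hν : 2 ≤ ν) (y w : Site ν L) :
    singletAnn y w Φ = 0 := by
  set l₀ : Fin ν := ⟨0, by omega⟩ with hl₀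
  refine singletAnn_eq_zero (τ := fun x => (x, l₀)) (h.annihilation_eq_sum l₀ hodd hL) ?_ y w
  have h1 : (1 : ZMod L) ≠ 0 := zmod_one_ne_zero hL
  -- An edge in a direction other than `l₀` sees the rods on the two disjoint `l₀`-lines through its
  -- ends. At the vertices α, α + e_l and α + e_{l₀} exactly one of the two weights is nonzero, so
  -- nothing cancels.
  have hA : ∀ (α : Vertex ν L) (l : Fin ν), l ≠ l₀ → rodVec l₀ α (α, l) ≠ 0 := by
    intro α l hl
    rw [rodVec, rodWeight_of_ne l₀ (α - (α + unitVec l)) hl (by simp [unitVec_apply, h1]), add_zero]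
    exact rodWeight_ne_zero _ _ fun i _ => by simp
  have hB : ∀ (α : Vertex ν L) (l : Fin ν), l ≠ l₀ → rodVec l₀ (α + unitVec l) (α, l) ≠ 0 := by
    intro α l hl
    rw [rodVec, rodWeight_of_ne l₀ (α + unitVec l - α) hl (by simp [unitVec_apply, h1]), zero_add]
    exact rodWeight_ne_zero _ _ fun i _ => by simp
  have hC : ∀ (α : Vertex ν L) (l : Fin ν), l ≠ l₀ → rodVec l₀ (α + unitVec l₀) (α, l) ≠ 0 := by
    intro α l hl
    rw [rodVec, rodWeight_of_ne l₀ (α + unitVec l₀ - (α + unitVec l)) hl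
      (by simp [unitVec_apply, h1, hl]), add_zero]
    exact rodWeight_ne_zero _ _ fun i hi => by simp [unitVec_apply, hi]
  refine forall_of_forall_unitVec (fun x z => singletAnn (x, l₀) (z, l₀) Φ = 0) (fun α => ?_)
    (fun α β γ => singlet_trans (τ := fun x => (x, l₀)) (rodVec_dual l₀ hodd hL)
      (h.frameNumber_apply l₀ hodd hL)) (fun α l => ?_)
  · rw [singletAnn, LinearMap.add_apply, Module.End.mul_apply, h.annihilation_annihilation,
      add_zero]
  · by_cases hl : l = l₀
    · rw [hl]
      -- Neighbours along `l₀` are linked by an edge in a second direction, which `2 ≤ ν` provides.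
      have h01 : (⟨1, by omega⟩ : Fin ν) ≠ l₀ := by simp [hl₀]
      exact h.singletAnn_of_rodVec_ne_zero l₀ hodd hL _ (hA α _ h01) (hC α _ h01)
    · exact h.singletAnn_of_rodVec_ne_zero l₀ hodd hL _ (hA α l hl) (hB α l hl)

lemma exists_eq_smul_allUp (h : IsFlat Φ) (hodd : Odd L) (hL : 3 ≤ L)
    (hdown : spinHop (Site ν L) 1 1 Φ = 0) : ∃ c : ℂ, Φ = c • allUp ν L l₀ := by
  have h1 : ∀ y : Site ν L, annihilation (y, 1) Φ = 0 := by
    intro y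
    have h2 : (inner ℂ Φ (spinHop (Site ν L) 1 1 Φ)).re =
        ∑ y : Site ν L, ‖annihilation (y, 1) Φ‖ ^ 2 := by
      rw [spinHop, LinearMap.sum_apply, inner_sum, Complex.re_sum]
      refine Finset.sum_congr rfl fun x _ => ?_
      rw [← star_annihilation, re_inner_star_mul]
    rw [hdown, inner_zero_right, Complex.zero_re] at h2
    have := (Finset.sum_eq_zero_iff_of_nonneg fun _ _ => sq_nonneg _).mp h2.symm y
      (Finset.mem_univ _)
    simpa using this
  obtain ⟨ψ₀, hψ₀, hψ₀'⟩ := exists_eq_filled (τ := fun x => (x, l₀)) (rodVec_dual l₀ hodd hL)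
    (Finset.univ : Finset (Vertex ν L)).toList (Finset.nodup_toList _) Φ (fun x _ => by
      have := h.frameNumber_apply l₀ hodd hL x
      rw [frameNumber, LinearMap.sum_apply, Fin.sum_univ_two, Module.End.mul_apply,
        Module.End.mul_apply, h1, map_zero, add_zero] at this
      exact this) _ h.number
  rw [Finset.length_toList, Finset.card_univ, sub_self, zero_smul] at hψ₀'
  refine ⟨ψ₀ ∅, ?_⟩
  rw [hψ₀]
  conv_lhs => rw [eq_smul_vacuum hψ₀', map_smul]
  rfl

end IsFlat
end GroundStates
end Hubbard
end

/-! ### The main theorem -/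

theorem theorem1 (ν : ℕ) (hν : 2 ≤ ν) (s : ℝ) (hs : 0 ≤ s) :
    ∃ tc Uc : ℝ, 0 ≤ tc ∧ 0 ≤ Uc ∧ (s = 0 → tc = 0 ∧ Uc = 0) ∧
      ∀ (L : ℕ) [NeZero L], Odd L → 3 ≤ L →
      ∀ t U : ℝ, tc < t → Uc < U →
      ∀ Ne : ℕ, Ne = Fintype.card (Hubbard.Vertex ν L) →
      ∀ E₀ : ℝ, E₀ = -2 * ν * s * (Fintype.card (Hubbard.Vertex ν L) : ℝ) →
        -- the ground-state energy
        Hubbard.IsGroundEnergy (Hubbard.hamiltonian ν L s t U) Ne E₀ ∧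
        -- the ground states have the maximal total spin
        (IsGreatest (Hubbard.spinValues (Hubbard.Site ν L) Ne) ((Ne : ℝ) / 2) ∧
          ∀ ψ ∈ Hubbard.energySpace (Hubbard.hamiltonian ν L s t U) Ne E₀,
            Hubbard.HasTotalSpin ((Ne : ℝ) / 2) ψ) ∧
        -- the ground states form a single spin multiplet, of dimension `2 S_tot + 1`
        (Module.finrank ℂ (Hubbard.energySpace (Hubbard.hamiltonian ν L s t U) Ne E₀) = Ne + 1 ∧
          ∃ Φ ∈ Hubbard.energySpace (Hubbard.hamiltonian ν L s t U) Ne E₀,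
            Hubbard.energySpace (Hubbard.hamiltonian ν L s t U) Ne E₀ =
              Submodule.span ℂ (Set.range fun k : Fin (Ne + 1) =>
                (Hubbard.spinLowering (Hubbard.Site ν L) ^ (k : ℕ)) Φ)) := by
  obtain ⟨K, hK, hbound⟩ := Hubbard.exists_energy_bound ν hν
  -- Both thresholds are proportional to s, so they vanish in the flat-band case.
  refine ⟨K * s, K * s, by positivity, by positivity, fun h => by simp [h], ?_⟩
  rintro L _ hodd hL t U ht hU Ne rfl E₀ rfl
  set l₀ : Fin ν := ⟨0, by omega⟩
  set E₀ : ℝ := -2 * ν * s * (Fintype.card (Hubbard.Vertex ν L) : ℝ)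
  have hP0 : ∀ ψ : Hubbard.Fock (Hubbard.Mode ν L), 0 ≤ ∑ σ, ∑ α, ∑ l, ∑ m,
      ‖Hubbard.ann (Hubbard.plaquette (L := L) α l m) σ ψ‖ ^ 2 := fun ψ => by positivity
  have hQ0 : ∀ ψ : Hubbard.Fock (Hubbard.Mode ν L), 0 ≤ ∑ x : Hubbard.Site ν L,
      ‖Hubbard.pairAnn (Pi.single x 1) ψ‖ ^ 2 := fun ψ => by positivity
  have hre : ∀ (ψ : Hubbard.Fock (Hubbard.Mode ν L)) (E : ℝ),
      Hubbard.hamiltonian ν L s t U ψ = (E : ℂ) • ψ →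
      (inner ℂ ψ (Hubbard.hamiltonian ν L s t U ψ)).re = E * ‖ψ‖ ^ 2 := by
    intro ψ E h
    rw [h, inner_smul_right, Complex.re_ofReal_mul, Hubbard.re_inner_self]
  have hflat : ∀ ψ ∈ Hubbard.energySpace (Hubbard.hamiltonian ν L s t U)
      (Fintype.card (Hubbard.Vertex ν L)) E₀, Hubbard.IsFlat ψ := by
    intro ψ hψ
    obtain ⟨h1, h2⟩ := Hubbard.mem_energySpace.mp hψ
    have h3 := hbound L hL s t U hs ψ
    rw [hre ψ E₀ h2] at h3
    have hp := hP0 ψ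
    have hq := hQ0 ψ
    -- At the energy `E₀` the bound leaves two nonnegative sums with strictly positive coefficients
    -- and total at most zero, so each of them vanishes.
    have hP : ∑ σ, ∑ α, ∑ l, ∑ m,
        ‖Hubbard.ann (Hubbard.plaquette (L := L) α l m) σ ψ‖ ^ 2 = 0 := by nlinarith
    have hQ : ∑ x : Hubbard.Site ν L, ‖Hubbard.pairAnn (Pi.single x 1) ψ‖ ^ 2 = 0 := by nlinarith
    refine ⟨h1, fun α l m σ => ?_, fun x => ?_⟩
    · have e1 := (Finset.sum_eq_zero_iff_of_nonneg fun _ _ => by positivity).mp hP σ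
        (Finset.mem_univ _)
      have e2 := (Finset.sum_eq_zero_iff_of_nonneg fun _ _ => by positivity).mp e1 α
        (Finset.mem_univ _)
      have e3 := (Finset.sum_eq_zero_iff_of_nonneg fun _ _ => by positivity).mp e2 l
        (Finset.mem_univ _)
      have e4 := (Finset.sum_eq_zero_iff_of_nonneg fun _ _ => by positivity).mp e3 m
        (Finset.mem_univ _)
      simpa using e4
    · have e1 := (Finset.sum_eq_zero_iff_of_nonneg fun _ _ => by positivity).mp hQ x
        (Finset.mem_univ _)
      simpa using e1
  have hup := Hubbard.allUp_mem_energySpace l₀ hodd hL s t U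
  have hupne := Hubbard.allUp_ne_zero l₀ hodd hL
  have hN : ∀ ψ ∈ Hubbard.energySpace (Hubbard.hamiltonian ν L s t U)
      (Fintype.card (Hubbard.Vertex ν L)) E₀, Hubbard.totalNumber _ ψ =
        (Fintype.card (Hubbard.Vertex ν L) : ℂ) • ψ := fun ψ hψ => (hflat ψ hψ).number
  have hsing : ∀ ψ ∈ Hubbard.energySpace (Hubbard.hamiltonian ν L s t U)
      (Fintype.card (Hubbard.Vertex ν L)) E₀, ∀ x y, Hubbard.singletAnn x y ψ = 0 :=
    fun ψ hψ => (hflat ψ hψ).singletAnn_apply hodd hL hν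
  have hspin : ∀ ψ ∈ Hubbard.energySpace (Hubbard.hamiltonian ν L s t U)
      (Fintype.card (Hubbard.Vertex ν L)) E₀,
      Hubbard.HasTotalSpin ((Fintype.card (Hubbard.Vertex ν L) : ℝ) / 2) ψ := fun ψ hψ =>
    Hubbard.hasTotalSpin_of_singletAnn_eq_zero (hN ψ hψ) (hsing ψ hψ)
  have huniq : ∀ ψ ∈ Hubbard.energySpace (Hubbard.hamiltonian ν L s t U)
      (Fintype.card (Hubbard.Vertex ν L)) E₀, Hubbard.spinHop _ 1 1 ψ = 0 →
      ∃ c : ℂ, ψ = c • Hubbard.allUp ν L l₀ := fun ψ hψ h =>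
    (hflat ψ hψ).exists_eq_smul_allUp l₀ hodd hL h
  refine ⟨⟨⟨_, (Submodule.mem_inf.mp hup).1, hupne, (Hubbard.mem_energySpace.mp hup).2⟩, ?_⟩,
    ⟨⟨⟨by positivity, _, (Submodule.mem_inf.mp hup).1, hupne, hspin _ hup⟩, ?_⟩, hspin⟩,
    Hubbard.finrank_eq_of_multiplet Hubbard.spinHop_mem_energySpace hN hsing hup hupne
      (Hubbard.spinHop_down_allUp l₀) huniq, _, hup, ?_⟩
  · rintro E ⟨ψ, -, hne, hE⟩
    have h3 := hbound L hL s t U hs ψ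
    rw [hre ψ E hE] at h3
    have hp := mul_nonneg (by linarith : 0 ≤ (t - K * s) / 2) (hP0 ψ)
    have hq := mul_nonneg (by linarith : 0 ≤ U - K * s) (hQ0 ψ)
    have h4 : 0 < ‖ψ‖ ^ 2 := by positivity
    refine le_of_mul_le_mul_right ?_ h4
    linarith
  · rintro S ⟨hS, ψ, hψ, hne, h⟩
    exact Hubbard.spin_le_of_hasTotalSpin (Hubbard.mem_electronSpace.mp hψ) hne hS h
  · rw [Hubbard.spinLowering_eq]
    exact Hubbard.eq_span_lower_pow Hubbard.spinHop_mem_energySpace hN hsing hup huniq
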